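/- **Setting.** Let $Y$ be a $C^\infty$ $n$-manifold with corners (Hausdorff, paracompact). A *partition* $\mathcal P$ of $Y$ is a decomposition $Y=\bigcup_{i\in I}Y_i$ into connected embedded $C^\infty$ $n$-manifolds with corners (the *blocks*) with pairwise disjoint interiors. It is *regular* if every $p\in Y$ has an *adapted chart*: a diffeomorphism from an open neighbourhood $U$ of $p$ onto a neighbourhood of the origin in $[0,\infty)^l\times\mathbb R^{m}\times\mathbb R^{n-l-m}$, for some $l,m\ge 0$ with $l+m\le n$, which sends $p$ to the origin and the nonempty sets $U\cap Y_i$ to the pieces cut out by the $2^m$ closed coordinate orthants of $\mathbb R^m$. The coordinates of $\mathbb R^m$ are called the wall coordinates of the chart. The points with $m=k$ form the *codimension-$k$ stratum* of $\mathcal P$, and a *codimension-$k$ facet* is the closure of a connected component of this stratum. Let $Z$ be a codimension-$k$ facet. A *normal cube* of $Z$ at $p\in Z$ is the image of $[-1,1]^k$ under a map that, in an adapted chart at $p$, is $t\mapsto \varepsilon t$ ($\varepsilon>0$) into the coordinate $k$-plane of $k$ wall coordinates that vanish on $Z$, the other coordinates being $0$. If $p$ is in the codimension-$k$ stratum, these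 are all the wall coordinates and the cube is $\mathbf 0_l\times[-\varepsilon,\varepsilon]^k\times\mathbf 0_{n-k-l}$. For $k=1$ it is called a *normal interval*. A *normal-cube bundle* of $Z$ is a choice of pairwise disjoint normal cubes $C_p$, $p\in Z$, that is locally trivial. Here a trivialization over $S\subseteq Z$ is a smooth map $\Phi:S\times[-1,1]^k\to Y$ that is a topological embedding and for which each $\Phi(p,\cdot)$ parametrizes $C_p$ as above. The bundle is *trivial* if it has a trivialization over $Z$. **Lemma 1.1.4.2.** Let $\mathcal P$ be a regular partition of $Y$ and $Z$ a codimension-$k$ facet of $\mathcal P$. Then $Z$ has a trivial normal-cube bundle. Moreover, $Z$ is contained in some block, and for every block $Y_i\supseteq Z$ there are exactly $k$ codimension-1 facets $W_1,\dots,W_k$ of $\mathcal P$ with $Z\subseteq W_a\subseteq Y_i$, and their normal intervals give a global $k$-frame along $Z$: there is a normal-cube bundle of $Z$ with a trivialization $\Phi$ over $Z$ such that, for all $p\in Z$, the $a$-th axis $\tau\mapsto\Phi(p,\tau e_a)$ parametrizes a normal interval of $W_a$ at $p$ ($a=1,\dots,k$), and $\Phi(p,t)\in Y_i$ for all $t\in[0,1]^k$.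 -/

import Mathlib

open scoped Manifold ContDiff Topology

/-- The model with corners of `[0,∞)ⁿ`. A smooth `n`-manifold with corners is a space with an atlas
of charts onto relatively open subsets of `[0,∞)ⁿ` (these contain open pieces of every
`[0,∞)ˡ × ℝⁿ⁻ˡ` up to diffeomorphism) and smooth coordinate changes. -/
noncomputable abbrev cornersModel (n : ℕ) :
    ModelWithCorners ℝ (EuclideanSpace ℝ (Fin n)) (EuclideanQuadrant n) :=
  modelWithCornersEuclideanQuadrant n

/-- The sector `{x ∈ ℝⁿ | x i ≥ 0 for i ∈ L}`, a coordinate copy of `[0,∞)ˡ × ℝⁿ⁻ˡ`, `l = |L|`. -/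
def sector {n : ℕ} (L : Finset (Fin n)) : Set (EuclideanSpace ℝ (Fin n)) :=
  {x | ∀ i ∈ L, 0 ≤ x i}

/-- A closed orthant with respect to the coordinates in `K`, with signs `s`. Letting `s` vary, these
are the blocks of the standard partition of `ℝᵏ × ℝⁿ⁻ᵏ`, `k = |K|`, by the `2ᵏ` orthants of `ℝᵏ`. -/
def orthant {n : ℕ} (K : Finset (Fin n)) (s : Fin n → ℤˣ) : Set (EuclideanSpace ℝ (Fin n)) :=
  {x | ∀ i ∈ K, 0 ≤ (((s i : ℤˣ) : ℤ) : ℝ) * x i}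

/-- The standard cube `[-1,1]ᵏ`. -/
def stdCube (k : ℕ) : Set (Fin k → ℝ) := Set.Icc (fun _ => -1) (fun _ => 1)

/-- `S ⊆ Y` is an embedded smooth `n`-manifold with corners in the `n`-manifold with corners `Y`:
with its subspace topology it carries a smooth structure with corners for which the inclusion is
smooth with injective differentials. -/
def IsEmbeddedWithCorners {n : ℕ} {Y : Type*} [TopologicalSpace Y]
    [ChartedSpace (EuclideanQuadrant n) Y] (S : Set Y) : Prop :=
  ∃ c : ChartedSpace (EuclideanQuadrant n) S,
    letI := c
    IsManifold (cornersModel n) ∞ S ∧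
    ContMDiff (cornersModel n) (cornersModel n) ∞ (Subtype.val : S → Y) ∧
    ∀ x : S, Function.Injective (mfderiv (cornersModel n) (cornersModel n) (Subtype.val : S → Y) x)

/-- A partition of `Y` into connected embedded `n`-manifolds with corners (the blocks), whose
interiors are pairwise disjoint. -/
structure CornerPartition (n : ℕ) (Y : Type*) [TopologicalSpace Y]
    [ChartedSpace (EuclideanQuadrant n) Y] (ι : Type*) where
  /-- The blocks. -/
  block : ι → Set Y
  iUnion_block : ⋃ i, block i = Set.univ
  isConnected_block : ∀ i, IsConnected (block i)
  isEmbedded_block : ∀ i, IsEmbeddedWithCorners (n := n) (block i)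
  disjoint_interior : ∀ i i', i ≠ i' → Disjoint (interior (block i)) (interior (block i'))

namespace CornerPartition

variable {n : ℕ} {Y : Type*} [TopologicalSpace Y] [ChartedSpace (EuclideanQuadrant n) Y]
  {ι : Type*}

/-- A diffeomorphism of a neighbourhood of `p` in `Y`, with the induced partition, onto a
neighbourhood of the origin in `[0,∞)ˡ × ℝᵏ × ℝⁿ⁻ˡ⁻ᵏ`, where `ℝᵏ` has the standard partition into
orthants and `p` goes to the origin. The `l` boundary coordinates are those in `bdry`, the `k`
coordinates cut by the partition are those in `wall`; the case `l = 0` is that of interior points. -/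
structure AdaptedChart (P : CornerPartition n Y ι) (p : Y) where
  toPartialEquiv : PartialEquiv Y (EuclideanSpace ℝ (Fin n))
  bdry : Finset (Fin n)
  wall : Finset (Fin n)
  disjoint_bdry_wall : Disjoint bdry wall
  open_source : IsOpen toPartialEquiv.source
  mem_source : p ∈ toPartialEquiv.source
  map_base : toPartialEquiv p = 0
  target_eq : ∃ O : Set (EuclideanSpace ℝ (Fin n)), IsOpen O ∧
    toPartialEquiv.target = O ∩ sector bdry
  contMDiffOn : ContMDiffOn (cornersModel n) 𝓘(ℝ, EuclideanSpace ℝ (Fin n)) ∞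
    toPartialEquiv toPartialEquiv.source
  contMDiffOn_symm : ContMDiffOn 𝓘(ℝ, EuclideanSpace ℝ (Fin n)) (cornersModel n) ∞
    toPartialEquiv.symm toPartialEquiv.target
  /-- Every nonempty piece of the induced partition is an orthant. -/
  block_eq_orthant : ∀ i, (toPartialEquiv.source ∩ P.block i).Nonempty →
    ∃ s, toPartialEquiv.source ∩ P.block i =
      toPartialEquiv.source ∩ toPartialEquiv ⁻¹' orthant wall s
  /-- Every orthant is a piece of the induced partition. -/
  orthant_eq_block : ∀ s, ∃ i, toPartialEquiv.source ∩ P.block i =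
      toPartialEquiv.source ∩ toPartialEquiv ⁻¹' orthant wall s

/-- A partition is regular if it is locally diffeomorphic to a standard one at each point. -/
def IsRegular (P : CornerPartition n Y ι) : Prop :=
  ∀ p : Y, Nonempty (P.AdaptedChart p)

/-- The codimension-`k` stratum of the partition. -/
def stratum (P : CornerPartition n Y ι) (k : ℕ) : Set Y :=
  {p | ∃ c : P.AdaptedChart p, c.wall.card = k}

/-- A (closed) codimension-`k` facet: the closure of a connected component of the codimension-`k`
stratum. -/
def IsFacet (P : CornerPartition n Y ι) (k : ℕ) (Z : Set Y) : Prop :=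
  ∃ p ∈ P.stratum k, Z = closure (connectedComponentIn (P.stratum k) p)

/-- `γ` parametrizes a normal cube at `p` of the codimension-`k` facet `Z`: in an adapted chart at
`p` it is `t ↦ ε • t`, with image the cube `[-ε,ε]ᵏ` in the coordinates `j 0, …, j (k-1)` (the other
coordinates being zero), where the `j a` are wall coordinates that vanish on `Z`.
If `p` is in the codimension-`k` stratum, the `j a` are all the wall coordinates. -/
def IsNormalCubeParam (P : CornerPartition n Y ι) (k : ℕ) (Z : Set Y) (p : Y)
    (γ : (Fin k → ℝ) → Y) : Prop :=
  ∃ (c : P.AdaptedChart p) (j : Fin k ↪ Fin n) (ε : ℝ), 0 < ε ∧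
    (∀ a, j a ∈ c.wall) ∧
    (∀ q ∈ Z ∩ c.toPartialEquiv.source, ∀ a, c.toPartialEquiv q (j a) = 0) ∧
    ∀ t ∈ stdCube k,
      (∑ a, EuclideanSpace.single (j a) (ε * t a)) ∈ c.toPartialEquiv.target ∧
      γ t = c.toPartialEquiv.symm (∑ a, EuclideanSpace.single (j a) (ε * t a))

/-- `C` is a normal cube at `p` of the codimension-`k` facet `Z`. -/
def IsNormalCube (P : CornerPartition n Y ι) (k : ℕ) (Z : Set Y) (p : Y) (C : Set Y) : Prop :=
  ∃ γ, P.IsNormalCubeParam k Z p γ ∧ C = γ '' stdCube k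

/-- `Φ` trivializes, over `S ⊆ Z`, the family of cubes `fiber p`, `p ∈ Z`: it is a smooth map on
`S × [-1,1]ᵏ`, a topological embedding into `Y`, and for each `p ∈ S` the map `Φ p` parametrizes
`fiber p` as a normal cube at `p`. -/
def IsCubeTrivialization (P : CornerPartition n Y ι) (k : ℕ) (Z : Set Y) (fiber : Y → Set Y)
    (S : Set Y) (Φ : Y → (Fin k → ℝ) → Y) : Prop :=
  ContMDiffOn ((cornersModel n).prod 𝓘(ℝ, Fin k → ℝ)) (cornersModel n) ∞
    (fun x : Y × (Fin k → ℝ) => Φ x.1 x.2) (S ×ˢ stdCube k) ∧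
  Topology.IsEmbedding (fun x : ↥(S ×ˢ stdCube k) => Φ x.1.1 x.1.2) ∧
  ∀ p ∈ S, P.IsNormalCubeParam k Z p (Φ p) ∧ Φ p '' stdCube k = fiber p

/-- A normal-cube bundle of a codimension-`k` facet `Z`: a choice of pairwise disjoint normal cubes
at the points of `Z` that is locally trivial over `Z`. -/
structure NormalCubeBundle (P : CornerPartition n Y ι) (k : ℕ) (Z : Set Y) where
  /-- The normal cube at a point of `Z` (values at other points are irrelevant). -/
  fiber : Y → Set Y
  isNormalCube : ∀ p ∈ Z, P.IsNormalCube k Z p (fiber p)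
  disjoint : ∀ p ∈ Z, ∀ q ∈ Z, p ≠ q → Disjoint (fiber p) (fiber q)
  locallyTrivial : ∀ p ∈ Z, ∃ V : Set Y, IsOpen V ∧ p ∈ V ∧
    ∃ Φ, P.IsCubeTrivialization k Z fiber (Z ∩ V) Φ

/-- A global trivialization `Φ : Z × [-1,1]ᵏ → Y` of a normal-cube bundle. -/
def NormalCubeBundle.IsTrivialization {P : CornerPartition n Y ι} {k : ℕ} {Z : Set Y}
    (E : P.NormalCubeBundle k Z) (Φ : Y → (Fin k → ℝ) → Y) : Prop :=
  P.IsCubeTrivialization k Z E.fiber Z Φ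

/-- A normal-cube bundle is trivial if it has a global trivialization. -/
def NormalCubeBundle.IsTrivial {P : CornerPartition n Y ι} {k : ℕ} {Z : Set Y}
    (E : P.NormalCubeBundle k Z) : Prop :=
  ∃ Φ, E.IsTrivialization Φ

end CornerPartition

/-! ### Sectors -/

/-! A block containing the facet removes all monodromy. In a chart at a point of `Z` where the block
`i` is the positive orthant, its walls are the open coordinate faces. Each face lies in one
component of the codimension-1 stratum and has one further block on its other side. At a point of
the codimension-`k` stratum there are `k` such faces. Lying in the closure of a given codimension-1
component is a locally constant condition along the connected set `Z`, so the same `k` facets, with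
the same neighbouring blocks `w a`, occur along all of `Z` (`exists_walls`). They label `k` axes in
a chart around every point of `Z`, deeper strata included (`FramedChart`).

It remains to straighten these axes simultaneously. One looks for a smooth `r`, retracting a
neighbourhood onto the plane where the axis coordinates vanish and keeping the signs of the other
boundary and wall coordinates, and for smooth functions `f a` with the sign of the axis coordinate
and at least a positive multiple of its size. These conditions survive convex combinations in a
chart. They are also independent of the chart: the differential of a coordinate change respects the
tangent cones of the blocks, so boundary and wall coordinates correspond to each other up to
positive factors (`exists_single_of_map_sector`, `exists_dominates`, `IsTubular.of_chart`). Hence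
the local coordinate projections can be glued with bump functions (`exists_glue`,
`exists_forall_good_of_local`, `exists_isTube`).

Finally `f` and the remaining coordinates of `r` are themselves coordinates. The inverse function
theorem for sectors (`exists_partialEquiv_sector`) turns them into framed charts in which the fibres
of `r` are coordinate planes (`IsTubularAt.exists_chart`). For a small smooth `ε > 0` on `Z`, the
point `Φ z t` is reached from `z` by a straight segment in such a chart and satisfies `r = z`, `f =
ε z • t`. Different charts give the same point, the cubes are linear in the charts, and `(r, f / ε ∘
r)` inverts `Φ` continuously (`exists_trivialization_of_isTube`). -/

theorem convex_sector {n : ℕ} (L : Finset (Fin n)) : Convex ℝ (sector L) :=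
  fun _ hx _ hy _ _ _ _ _ i hi => by
    have := hx i hi; have := hy i hi
    simp only [PiLp.add_apply, PiLp.smul_apply, smul_eq_mul]; positivity

theorem isClosed_sector {n : ℕ} (L : Finset (Fin n)) : IsClosed (sector L) := by
  simp only [sector, Set.ofPred_forall]
  exact isClosed_biInter fun i _ => isClosed_le continuous_const (by fun_prop)

theorem isOpen_setOf_forall_pos {n : ℕ} (L : Finset (Fin n)) :
    IsOpen {x : EuclideanSpace ℝ (Fin n) | ∀ i ∈ L, 0 < x i} := by
  simp only [Set.ofPred_forall]
  exact isOpen_biInter_finset fun i _ => isOpen_lt continuous_const (by fun_prop)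

theorem zero_mem_sector {n : ℕ} (L : Finset (Fin n)) : (0 : EuclideanSpace ℝ (Fin n)) ∈ sector L :=
  fun i _ => by simp

theorem uniqueDiffOn_inter_sector {n : ℕ} (L : Finset (Fin n))
    {O : Set (EuclideanSpace ℝ (Fin n))} (hO : IsOpen O) : UniqueDiffOn ℝ (O ∩ sector L) := by
  rw [Set.inter_comm]
  refine UniqueDiffOn.inter (uniqueDiffOn_convex (convex_sector L) ?_) hO
  refine ⟨WithLp.toLp 2 fun _ => 1, ?_⟩
  refine mem_interior.2 ⟨_, ?_, isOpen_setOf_forall_pos L, ?_⟩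
  · exact fun x hx i hi => (hx i hi).le
  · intro i _; simp

/-- The derivative within the set is continuous, and a ball intersected with `s` is convex, so the
mean value inequality applies there although `x₀` may be a boundary point. -/
theorem exists_approximatesLinearOn {E F : Type*} [NormedAddCommGroup E] [NormedSpace ℝ E]
    [NormedAddCommGroup F] [NormedSpace ℝ F] {s O : Set E} (hs : Convex ℝ s) (hO : IsOpen O)
    (hu : UniqueDiffOn ℝ (O ∩ s)) {g : E → F} (hg : ContDiffOn ℝ ∞ g (O ∩ s)) {x₀ : E}
    (hx₀ : x₀ ∈ O ∩ s) {c : NNReal} (hc : 0 < c) :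
    ∃ δ > 0, Metric.ball x₀ δ ⊆ O ∧
      (∀ x ∈ Metric.ball x₀ δ ∩ s,
        ‖fderivWithin ℝ g (O ∩ s) x - fderivWithin ℝ g (O ∩ s) x₀‖ ≤ c) ∧
      ApproximatesLinearOn g (fderivWithin ℝ g (O ∩ s) x₀) (Metric.ball x₀ δ ∩ s) c := by
  have hcont := hg.continuousOn_fderivWithin hu (by simp)
  have h1 : ∀ᶠ x in 𝓝[O ∩ s] x₀,
      ‖fderivWithin ℝ g (O ∩ s) x - fderivWithin ℝ g (O ∩ s) x₀‖ < c := by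
    have := ((hcont x₀ hx₀).sub continuousWithinAt_const).norm
      (f := fun x => fderivWithin ℝ g (O ∩ s) x - fderivWithin ℝ g (O ∩ s) x₀)
    refine this.eventually_lt continuousWithinAt_const ?_
    simpa using hc
  rw [nhdsWithin_inter_of_mem (mem_nhdsWithin_of_mem_nhds (hO.mem_nhds hx₀.1)),
    Metric.nhdsWithin_basis_ball.eventually_iff] at h1
  obtain ⟨δ₁, hδ₁, h1⟩ := h1
  obtain ⟨δ₂, hδ₂, h2⟩ := Metric.isOpen_iff.1 hO x₀ hx₀.1
  have hsub : Metric.ball x₀ (min δ₁ δ₂) ∩ s ⊆ O ∩ s := fun x hx =>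
    ⟨h2 (Metric.ball_subset_ball (min_le_right _ _) hx.1), hx.2⟩
  have hb : ∀ x ∈ Metric.ball x₀ (min δ₁ δ₂) ∩ s,
      ‖fderivWithin ℝ g (O ∩ s) x - fderivWithin ℝ g (O ∩ s) x₀‖ ≤ c := fun x hx =>
    (h1 ⟨Metric.ball_subset_ball (min_le_left _ _) hx.1, hx.2⟩).le
  refine ⟨min δ₁ δ₂, lt_min hδ₁ hδ₂, ?_, hb, ?_⟩
  · exact (Metric.ball_subset_ball (min_le_right _ _)).trans h2
  · intro x hx y hy
    exact ((convex_ball _ _).inter hs).norm_image_sub_le_of_norm_hasFDerivWithin_le'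
      (fun z hz => ((hg.differentiableOn (by simp) z (hsub hz)).hasFDerivWithinAt).mono hsub)
      hb hy hx

/-- An inverse of a smooth map with invertible derivatives within sets of unique
differentiability is smooth. -/
theorem contDiffOn_inverse_of_leftInverse {E F : Type*} [NormedAddCommGroup E] [NormedSpace ℝ E]
    [NormedAddCommGroup F] [NormedSpace ℝ F] [CompleteSpace E] {s : Set E} {t : Set F}
    (hs : UniqueDiffOn ℝ s) (ht : UniqueDiffOn ℝ t) {g : E → F} {h : F → E}
    (hg : ContDiffOn ℝ ∞ g s) (hh : ContinuousOn h t) (hm : Set.MapsTo h t s)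
    (hgh : ∀ y ∈ t, g (h y) = y)
    (hinv : ∀ x ∈ s, ∃ e : E ≃L[ℝ] F, (e : E →L[ℝ] F) = fderivWithin ℝ g s x) :
    ContDiffOn ℝ ∞ h t := by
  rw [contDiffOn_infty]
  intro N
  induction N with
  | zero => exact contDiffOn_zero.2 hh
  | succ N ih =>
    push_cast
    rw [contDiffOn_succ_iff_hasFDerivWithinAt_of_uniqueDiffOn ht]
    -- Bootstrap: the derivative of `h` is the inverse of the derivative of `g` at `h y`, which is
    -- as smooth as `h` is already known to be.
    refine ⟨by simp, fun y => ContinuousLinearMap.inverse (fderivWithin ℝ g s (h y)), ?_, ?_⟩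
    · intro y hy
      obtain ⟨e, he⟩ := hinv (h y) (hm hy)
      have h1 : ContDiffWithinAt ℝ N (fun y => fderivWithin ℝ g s (h y)) t y :=
        ((hg.fderivWithin hs (m := N) (by exact_mod_cast le_top)).comp ih hm) y hy
      have h2 := contDiffAt_map_inverse (n := (N : WithTop ℕ∞)) e
      rw [he] at h2
      exact h2.comp_contDiffWithinAt y h1
    · intro y hy
      obtain ⟨e, he⟩ := hinv (h y) (hm hy)
      beta_reduce
      rw [← he, ContinuousLinearMap.inverse_equiv]
      refine HasFDerivWithinAt.of_local_left_inverse (f := g) (s := t) (t := s) ?_ ?_ hy ?_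
      · exact (hh y hy).tendsto_nhdsWithin hm
      · rw [he]
        exact (hg.differentiableOn (by simp) _ (hm hy)).hasFDerivWithinAt
      · exact eventually_nhdsWithin_of_forall hgh

theorem exists_continuousLinearEquiv_of_injective {E : Type*} [NormedAddCommGroup E]
    [NormedSpace ℝ E] [FiniteDimensional ℝ E] (B : E →L[ℝ] E) (hB : ∀ v, B v = 0 → v = 0) :
    ∃ e : E ≃L[ℝ] E, (e : E →L[ℝ] E) = B := by
  have hi : Function.Injective (B : E →ₗ[ℝ] E) :=
    (injective_iff_map_eq_zero _).2 hB
  refine ⟨(LinearEquiv.ofInjectiveEndo (B : E →ₗ[ℝ] E) hi).toContinuousLinearEquiv, ?_⟩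
  ext v
  simp

/-- The inverse function theorem for maps of sectors that preserve the faces. -/
theorem exists_partialEquiv_sector {n : ℕ} (L : Finset (Fin n))
    {O : Set (EuclideanSpace ℝ (Fin n))} (hO : IsOpen O) (h0 : 0 ∈ O)
    {G : EuclideanSpace ℝ (Fin n) → EuclideanSpace ℝ (Fin n)}
    (hG : ContDiffOn ℝ ∞ G (O ∩ sector L)) (hG0 : G 0 = 0)
    (hinj : ∀ v, fderivWithin ℝ G (O ∩ sector L) 0 v = 0 → v = 0)
    (hpos : ∀ x ∈ O ∩ sector L, ∀ j ∈ L, 0 < x j → 0 < G x j)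
    (hzero : ∀ x ∈ O ∩ sector L, ∀ j ∈ L, x j = 0 → G x j = 0) :
    ∃ (e : PartialEquiv (EuclideanSpace ℝ (Fin n)) (EuclideanSpace ℝ (Fin n))) (ρ : ℝ)
      (O' : Set (EuclideanSpace ℝ (Fin n))), 0 < ρ ∧ IsOpen O' ∧ O' ⊆ O ∧ 0 ∈ O' ∧
      e.source = O' ∩ sector L ∧ e.target = Metric.ball 0 ρ ∩ sector L ∧
      Set.EqOn e G e.source ∧ ContDiffOn ℝ ∞ e.symm e.target := by
  set s := sector L with hs
  have hu := uniqueDiffOn_inter_sector L hO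
  obtain ⟨A, hA⟩ := exists_continuousLinearEquiv_of_injective _ hinj
  -- The first bound allows an extension to a global homeomorphism; the second keeps the derivative
  -- of `G` invertible on the whole small ball.
  obtain ⟨c, hc, hc1, hc2⟩ : ∃ c : NNReal, 0 < c ∧
      (Subsingleton (EuclideanSpace ℝ (Fin n)) ∨
        lipschitzExtensionConstant (EuclideanSpace ℝ (Fin n)) * c <
          ‖(A.symm : EuclideanSpace ℝ (Fin n) →L[ℝ] EuclideanSpace ℝ (Fin n))‖₊⁻¹) ∧
      (Subsingleton (EuclideanSpace ℝ (Fin n)) ∨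
        c < ‖(A.symm : EuclideanSpace ℝ (Fin n) →L[ℝ] EuclideanSpace ℝ (Fin n))‖₊⁻¹) := by
    rcases subsingleton_or_nontrivial (EuclideanSpace ℝ (Fin n)) with h | h
    · exact ⟨1, one_pos, Or.inl h, Or.inl h⟩
    · have hN : 0 < ‖(A.symm : EuclideanSpace ℝ (Fin n) →L[ℝ] EuclideanSpace ℝ (Fin n))‖₊⁻¹ :=
        inv_pos.2 A.norm_symm_pos
      have hK := lipschitzExtensionConstant_pos (EuclideanSpace ℝ (Fin n))
      obtain ⟨c, hc, hc'⟩ := exists_between (lt_min (div_pos hN hK) hN)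
      refine ⟨c, hc, Or.inr ?_, Or.inr (hc'.trans_le (min_le_right _ _))⟩
      rw [mul_comm]
      exact (lt_div_iff₀ hK).1 (hc'.trans_le (min_le_left _ _))
  obtain ⟨δ, hδ, hδO, hder, happ⟩ :=
    exists_approximatesLinearOn (convex_sector L) hO hu hG ⟨h0, zero_mem_sector L⟩ hc
  rw [← hs, ← hA] at happ hder
  -- `H` agrees with `G` on the sector near 0, but nothing yet says that its inverse preserves the
  -- sector.
  obtain ⟨H, hH⟩ := happ.exists_homeomorph_extension hc1
  have hball0 : (0 : EuclideanSpace ℝ (Fin n)) ∈ Metric.ball 0 δ ∩ s :=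
    ⟨Metric.mem_ball_self hδ, zero_mem_sector L⟩
  have hH0 : H 0 = 0 := by rw [← hH hball0, hG0]
  have hH0' : H.symm 0 = 0 := by rw [H.symm_apply_eq, hH0]
  obtain ⟨ρ, hρ, hρδ⟩ : ∃ ρ > 0, ∀ y ∈ Metric.ball 0 ρ, H.symm y ∈ Metric.ball 0 δ := by
    have : ∀ᶠ y in 𝓝 0, H.symm y ∈ Metric.ball 0 δ := by
      refine H.symm.continuous.continuousAt.eventually_mem ?_
      rw [hH0']; exact Metric.ball_mem_nhds _ hδ
    exact Metric.eventually_nhds_iff_ball.1 this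
  have hsub : Metric.ball 0 δ ∩ s ⊆ O ∩ s := Set.inter_subset_inter_left _ hδO
  set s' : Set (EuclideanSpace ℝ (Fin n)) := {x | ∀ i ∈ L, 0 < x i} with hs'
  have hs'o : IsOpen s' := isOpen_setOf_forall_pos L
  have hs's : s' ⊆ s := fun x hx i hi => (hx i hi).le
  have hGs : ∀ x ∈ O ∩ s, G x ∈ s := fun x hx j hj => by
    rcases (hx.2 j hj).eq_or_lt with h | h
    · exact (hzero x hx j hj h.symm).ge
    · exact (hpos x hx j hj h).le
  have hdiag : ∀ t : ℝ, 0 < t → ∀ y ∈ s, y + t • WithLp.toLp 2 (fun _ => (1 : ℝ)) ∈ s' := by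
    intro t ht y hy i hi
    have := hy i hi
    simp only [PiLp.add_apply, PiLp.smul_apply, smul_eq_mul, mul_one]
    linarith
  have htend : ∀ y : EuclideanSpace ℝ (Fin n), Filter.Tendsto
      (fun t : ℝ => y + t • WithLp.toLp 2 (fun _ => (1 : ℝ))) (𝓝[>] 0) (𝓝 y) := by
    intro y
    have : Continuous (fun t : ℝ => y + t • WithLp.toLp 2 (fun _ : Fin n => (1 : ℝ))) := by fun_prop
    simpa using this.continuousWithinAt.tendsto (x := 0) (s := Set.Ioi 0)
  -- Connectedness: the convex open piece cannot be split between preimages inside the open sector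
  -- and outside the closed one. A preimage on a face is impossible because `G` maps faces into the
  -- corresponding faces.
  have hQ : Metric.ball 0 ρ ∩ s' ⊆ H.symm ⁻¹' s' := by
    refine IsPreconnected.subset_left_of_subset_union (v := H.symm ⁻¹' sᶜ)
      (hs'o.preimage H.symm.continuous)
      ((isClosed_sector L).isOpen_compl.preimage H.symm.continuous) ?_ ?_ ?_ ?_
    · refine Set.disjoint_left.2 fun y hy hy' => hy' (hs's hy)
    · rintro y ⟨hy, hy'⟩
      by_cases hx : H.symm y ∈ s
      · left
        intro j hj
        have hmem : H.symm y ∈ Metric.ball 0 δ ∩ s := ⟨hρδ y hy, hx⟩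
        refine (hx j hj).lt_of_ne fun h => ?_
        have h1 := hzero _ (hsub hmem) j hj h.symm
        rw [hH hmem, H.apply_symm_apply] at h1
        exact (hy' j hj).ne' h1
      · right; exact hx
    · have hev : ∀ᶠ x in 𝓝 (0 : EuclideanSpace ℝ (Fin n)),
          x ∈ Metric.ball 0 δ ∧ H x ∈ Metric.ball 0 ρ := by
        refine Filter.Eventually.and (Metric.ball_mem_nhds _ hδ)
          (H.continuous.continuousAt.eventually_mem ?_)
        rw [hH0]; exact Metric.ball_mem_nhds _ hρ
      have := ((htend 0).eventually hev).and self_mem_nhdsWithin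
      obtain ⟨t, ⟨h1, h2⟩, ht⟩ := this.exists
      have h3 := hdiag t ht 0 (zero_mem_sector L)
      refine ⟨H _, ⟨h2, ?_⟩, ?_⟩
      · rw [← hH ⟨h1, hs's h3⟩]
        exact fun j hj => hpos _ (hsub ⟨h1, hs's h3⟩) j hj (h3 j hj)
      · simpa using h3
    · refine Convex.isPreconnected ((convex_ball _ _).inter ?_)
      intro x hx y hy a b ha hb hab i hi
      have h1 := hx i hi
      have h2 := hy i hi
      simp only [PiLp.add_apply, PiLp.smul_apply, smul_eq_mul]
      rcases ha.eq_or_lt with rfl | ha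
      · have : b = 1 := by linarith
        subst this; simpa using h2
      · have := mul_pos ha h1
        have := mul_nonneg hb h2.le
        linarith
  -- Points of the closed sector are limits of interior points along the diagonal direction.
  have hQs : ∀ y ∈ Metric.ball 0 ρ ∩ s, H.symm y ∈ s := by
    rintro y ⟨hy, hys⟩
    refine (isClosed_sector L).mem_of_tendsto
      (H.symm.continuous.continuousAt.tendsto.comp (htend y)) ?_
    filter_upwards [(htend y).eventually (Metric.isOpen_ball.mem_nhds hy), self_mem_nhdsWithin]
      with t ht ht'
    exact hs's (hQ ⟨ht, hdiag t ht' y hys⟩)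
  let e : PartialEquiv (EuclideanSpace ℝ (Fin n)) (EuclideanSpace ℝ (Fin n)) :=
    { toFun := H
      invFun := H.symm
      source := H ⁻¹' Metric.ball 0 ρ ∩ s
      target := Metric.ball 0 ρ ∩ s
      map_source' := by
        rintro x ⟨hx, hxs⟩
        refine ⟨hx, ?_⟩
        have h1 : x ∈ Metric.ball 0 δ ∩ s := ⟨by simpa using hρδ _ hx, hxs⟩
        rw [← hH h1]
        exact hGs x (hsub h1)
      map_target' := by
        rintro y ⟨hy, hys⟩
        exact ⟨by simpa using hy, hQs y ⟨hy, hys⟩⟩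
      left_inv' := by intro x _; simp
      right_inv' := by intro x _; simp }
  have hsrc : ∀ x ∈ H ⁻¹' Metric.ball 0 ρ, x ∈ Metric.ball 0 δ := fun x hx => by
    simpa using hρδ _ hx
  have hsrc' : ∀ x ∈ e.source, x ∈ Metric.ball 0 δ ∩ s := fun x hx => ⟨hsrc x hx.1, hx.2⟩
  have heq : Set.EqOn e G e.source := fun x hx => (hH (hsrc' x hx)).symm
  refine ⟨e, ρ, H ⁻¹' Metric.ball 0 ρ, hρ, Metric.isOpen_ball.preimage H.continuous,
    fun x hx => hδO (hsrc x hx), ?_, rfl, rfl, heq, ?_⟩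
  · simpa [hH0] using hρ
  · have hO' : IsOpen (Metric.ball (0 : EuclideanSpace ℝ (Fin n)) δ) := Metric.isOpen_ball
    refine contDiffOn_inverse_of_leftInverse (s := Metric.ball 0 δ ∩ s) (g := G)
      (uniqueDiffOn_inter_sector L hO') (uniqueDiffOn_inter_sector L Metric.isOpen_ball)
      (hG.mono hsub) H.symm.continuous.continuousOn
      (fun y hy => hsrc' _ (e.map_target hy)) (fun y hy => ?_) (fun x hx => ?_)
    · rw [← heq (e.map_target hy)]; exact e.right_inv hy
    · have hx' : fderivWithin ℝ G (Metric.ball 0 δ ∩ s) x = fderivWithin ℝ G (O ∩ s) x := by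
        have h1 := ((hG.differentiableOn (by simp) x (hsub hx)).hasFDerivWithinAt).mono hsub
        exact h1.fderivWithin (uniqueDiffOn_inter_sector L hO' x hx)
      rw [hx']
      refine exists_continuousLinearEquiv_of_injective _ fun v hv => ?_
      rcases hc2 with hc2 | hc2
      · exact Subsingleton.elim _ _
      -- A kernel vector `v` is moved by `A` only as far as the two derivatives differ, which
      -- contradicts `c < ‖A⁻¹‖⁻¹` unless `v = 0`.
      have h1 : ‖A v‖ ≤ c * ‖v‖ := by
        have := (fderivWithin ℝ G (O ∩ s) x - (A : _ →L[ℝ] _)).le_of_opNorm_le (hder x hx) v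
        simpa [hv] using this
      by_contra hv0
      have h2 : ‖v‖ ≤ ‖(A.symm : EuclideanSpace ℝ (Fin n) →L[ℝ] EuclideanSpace ℝ (Fin n))‖ *
          ‖A v‖ := by
        simpa using (A.symm : EuclideanSpace ℝ (Fin n) →L[ℝ] EuclideanSpace ℝ (Fin n)).le_opNorm
          (A v)
      set N := ‖(A.symm : EuclideanSpace ℝ (Fin n) →L[ℝ] EuclideanSpace ℝ (Fin n))‖ with hN
      have hNc : (c : ℝ) < N⁻¹ := by exact_mod_cast hc2
      have hN0 : 0 < N := by
        have := (NNReal.coe_nonneg c).trans_lt hNc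
        exact inv_pos.1 this
      have hv1 : 0 < ‖v‖ := norm_pos_iff.2 hv0
      have h3 : N * (c * ‖v‖) < ‖v‖ := by
        have : N * c < 1 := by
          have := mul_lt_mul_of_pos_left hNc hN0
          rwa [mul_inv_cancel₀ hN0.ne'] at this
        calc N * (c * ‖v‖) = (N * c) * ‖v‖ := by ring
          _ < 1 * ‖v‖ := by gcongr
          _ = ‖v‖ := one_mul _
      have := mul_le_mul_of_nonneg_left h1 hN0.le
      linarith

/-! ### Adapted charts: local structure of the blocks and composition with diffeomorphisms -/

namespace CornerPartition

variable {n : ℕ} {Y : Type*} [TopologicalSpace Y] [ChartedSpace (EuclideanQuadrant n) Y]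
  {ι : Type*}

theorem nonneg_iff_of_sign_eq {a b : ℝ} (h : SignType.sign a = SignType.sign b) :
    0 ≤ a ↔ 0 ≤ b := by rw [← sign_nonneg_iff, h, sign_nonneg_iff]

theorem nonpos_iff_of_sign_eq {a b : ℝ} (h : SignType.sign a = SignType.sign b) :
    a ≤ 0 ↔ b ≤ 0 := by rw [← sign_nonpos_iff, h, sign_nonpos_iff]

theorem eq_zero_iff_of_sign_eq {a b : ℝ} (h : SignType.sign a = SignType.sign b) :
    a = 0 ↔ b = 0 := by rw [← sign_eq_zero_iff, h, sign_eq_zero_iff]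

theorem pos_iff_of_sign_eq {a b : ℝ} (h : SignType.sign a = SignType.sign b) :
    0 < a ↔ 0 < b := by rw [← sign_eq_one_iff, h, sign_eq_one_iff]

namespace AdaptedChart

variable {P : CornerPartition n Y ι} {p : Y}

theorem target_subset (c : P.AdaptedChart p) : c.toPartialEquiv.target ⊆ sector c.bdry := by
  obtain ⟨O, -, h⟩ := c.target_eq
  rw [h]; exact Set.inter_subset_right

theorem continuousOn (c : P.AdaptedChart p) :
    ContinuousOn c.toPartialEquiv c.toPartialEquiv.source := c.contMDiffOn.continuousOn

theorem continuousOn_symm (c : P.AdaptedChart p) :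
    ContinuousOn c.toPartialEquiv.symm c.toPartialEquiv.target := c.contMDiffOn_symm.continuousOn

theorem continuousAt (c : P.AdaptedChart p) {q : Y} (hq : q ∈ c.toPartialEquiv.source) :
    ContinuousAt c.toPartialEquiv q := c.continuousOn.continuousAt (c.open_source.mem_nhds hq)

theorem nonneg_of_mem_bdry (c : P.AdaptedChart p) {q : Y} (hq : q ∈ c.toPartialEquiv.source)
    {j : Fin n} (hj : j ∈ c.bdry) : 0 ≤ c.toPartialEquiv q j :=
  c.target_subset (c.toPartialEquiv.map_source hq) j hj

theorem eventually_nhdsWithin (c : P.AdaptedChart p) {q : Y} (hq : q ∈ c.toPartialEquiv.source)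
    {U : Set Y} (hU : U ∈ 𝓝 q) :
    ∀ᶠ x in 𝓝[sector c.bdry] (c.toPartialEquiv q),
      x ∈ c.toPartialEquiv.target ∧ c.toPartialEquiv.symm x ∈ U := by
  obtain ⟨O, hO, h⟩ := c.target_eq
  have hx := c.toPartialEquiv.map_source hq
  have h1 : c.toPartialEquiv.target ∈ 𝓝[sector c.bdry] (c.toPartialEquiv q) := by
    rw [h, Set.inter_comm]
    exact inter_mem_nhdsWithin _ (hO.mem_nhds (h ▸ hx : _ ∈ O ∩ _).1)
  have h2 := (c.continuousOn_symm _ hx).mono_of_mem_nhdsWithin h1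
  refine Filter.Eventually.and h1 (h2.eventually ?_)
  rwa [c.toPartialEquiv.left_inv hq]

/-- Boundary coordinates that are positive at `q` stay positive for small times, so only the
vanishing ones restrict the direction. -/
theorem tendsto_add_smul (c : P.AdaptedChart p) {q : Y} (hq : q ∈ c.toPartialEquiv.source)
    {v : EuclideanSpace ℝ (Fin n)}
    (hv : ∀ j ∈ c.bdry, c.toPartialEquiv q j = 0 → 0 ≤ v j) :
    Filter.Tendsto (fun t : ℝ => c.toPartialEquiv q + t • v) (𝓝[>] 0)
      (𝓝[sector c.bdry] (c.toPartialEquiv q)) := by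
  have hcont : Continuous (fun t : ℝ => c.toPartialEquiv q + t • v) := by fun_prop
  have h1 : Filter.Tendsto (fun t : ℝ => c.toPartialEquiv q + t • v) (𝓝[>] 0)
      (𝓝 (c.toPartialEquiv q)) := by
    simpa using hcont.continuousWithinAt.tendsto (x := 0) (s := Set.Ioi 0)
  refine tendsto_nhdsWithin_iff.2 ⟨h1, ?_⟩
  simp only [sector, Set.mem_ofPred_eq]
  rw [Filter.eventually_all_finset]
  intro j hj
  rcases (c.nonneg_of_mem_bdry hq hj).eq_or_lt with h | h
  · filter_upwards [self_mem_nhdsWithin] with t ht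
    simp only [PiLp.add_apply, PiLp.smul_apply, smul_eq_mul, ← h, zero_add]
    exact mul_nonneg (le_of_lt ht) (hv j hj h.symm)
  · have h2 : Continuous (fun x : EuclideanSpace ℝ (Fin n) => x j) := by fun_prop
    have h3 := (h2.tendsto _).comp h1
    filter_upwards [h3.eventually (lt_mem_nhds h)] with t ht
    exact le_of_lt ht

/-- Moving from `q` in the direction `v` one stays in the chart. -/
theorem exists_add_smul (c : P.AdaptedChart p) {q : Y} (hq : q ∈ c.toPartialEquiv.source)
    {U : Set Y} (hU : U ∈ 𝓝 q) {v : EuclideanSpace ℝ (Fin n)}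
    (hv : ∀ j ∈ c.bdry, c.toPartialEquiv q j = 0 → 0 ≤ v j) :
    ∃ t : ℝ, 0 < t ∧ ∃ q' ∈ U, q' ∈ c.toPartialEquiv.source ∧
      c.toPartialEquiv q' = c.toPartialEquiv q + t • v := by
  have := ((c.tendsto_add_smul hq hv).eventually (c.eventually_nhdsWithin hq hU)).and
    self_mem_nhdsWithin
  obtain ⟨t, ⟨h1, h2⟩, ht⟩ := this.exists
  exact ⟨t, ht, _, h2, c.toPartialEquiv.map_target h1, c.toPartialEquiv.right_inv h1⟩

theorem zero_mem_orthant (K : Finset (Fin n)) (s : Fin n → ℤˣ) :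
    (0 : EuclideanSpace ℝ (Fin n)) ∈ orthant K s := fun i _ => by simp

theorem exists_sign (c : P.AdaptedChart p) {i : ι} {q : Y} (hq : q ∈ c.toPartialEquiv.source)
    (hi : q ∈ P.block i) : ∃ s, ∀ q' ∈ c.toPartialEquiv.source,
      (q' ∈ P.block i ↔ c.toPartialEquiv q' ∈ orthant c.wall s) := by
  obtain ⟨s, hs⟩ := c.block_eq_orthant i ⟨q, hq, hi⟩
  refine ⟨s, fun q' hq' => ?_⟩
  have : q' ∈ c.toPartialEquiv.source ∩ P.block i ↔
      q' ∈ c.toPartialEquiv.source ∩ c.toPartialEquiv ⁻¹' orthant c.wall s := by rw [hs]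
  simpa [hq'] using this

theorem exists_block (c : P.AdaptedChart p) (s : Fin n → ℤˣ) :
    ∃ i, ∀ q' ∈ c.toPartialEquiv.source,
      (q' ∈ P.block i ↔ c.toPartialEquiv q' ∈ orthant c.wall s) := by
  obtain ⟨i, hs⟩ := c.orthant_eq_block s
  refine ⟨i, fun q' hq' => ?_⟩
  have : q' ∈ c.toPartialEquiv.source ∩ P.block i ↔
      q' ∈ c.toPartialEquiv.source ∩ c.toPartialEquiv ⁻¹' orthant c.wall s := by rw [hs]
  simpa [hq'] using this

/-- The origin lies in every closed orthant, so the centre of a chart lies in all blocks that the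
chart meets. -/
theorem mem_block_base (c : P.AdaptedChart p) {i : ι} {q : Y} (hq : q ∈ c.toPartialEquiv.source)
    (hi : q ∈ P.block i) : p ∈ P.block i := by
  obtain ⟨s, hs⟩ := c.exists_sign hq hi
  rw [hs p c.mem_source, c.map_base]
  exact zero_mem_orthant _ _

theorem cast_units_mul_self (u : ℤˣ) : ((u : ℤ) : ℝ) * ((u : ℤ) : ℝ) = 1 := by
  rcases Int.units_eq_one_or u with rfl | rfl <;> simp

/-- Blocks with the same orthant are equal. -/
theorem block_unique (c : P.AdaptedChart p) {i i' : ι} {s : Fin n → ℤˣ}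
    (h : ∀ q ∈ c.toPartialEquiv.source,
      (q ∈ P.block i ↔ c.toPartialEquiv q ∈ orthant c.wall s))
    (h' : ∀ q ∈ c.toPartialEquiv.source,
      (q ∈ P.block i' ↔ c.toPartialEquiv q ∈ orthant c.wall s)) : i = i' := by
  classical
  by_contra hne
  -- The open orthant would lie in the interiors of both blocks; a short step along the sign vector
  -- `v` shows that it is nonempty.
  set V : Set Y := c.toPartialEquiv.source ∩
    c.toPartialEquiv ⁻¹' {x | ∀ j ∈ c.wall, 0 < (((s j : ℤˣ) : ℤ) : ℝ) * x j} with hV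
  have hVo : IsOpen V := by
    refine c.continuousOn.isOpen_inter_preimage c.open_source ?_
    simp only [Set.ofPred_forall]
    exact isOpen_biInter_finset fun j _ => isOpen_lt continuous_const (by fun_prop)
  have hVi : V ⊆ interior (P.block i) := interior_maximal (fun q hq =>
    (h q hq.1).2 fun j hj => (hq.2 j hj).le) hVo
  have hVi' : V ⊆ interior (P.block i') := interior_maximal (fun q hq =>
    (h' q hq.1).2 fun j hj => (hq.2 j hj).le) hVo
  let v : EuclideanSpace ℝ (Fin n) := WithLp.toLp 2 fun j =>
    if j ∈ c.wall then (((s j : ℤˣ) : ℤ) : ℝ) else 0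
  obtain ⟨t, ht, q, -, hq, hcq⟩ := c.exists_add_smul c.mem_source Filter.univ_mem (v := v)
    (fun j hj _ => by simp [v, Finset.disjoint_left.1 c.disjoint_bdry_wall hj])
  have hqV : q ∈ V := by
    refine ⟨hq, fun j hj => ?_⟩
    rw [hcq, c.map_base]
    simp only [zero_add, PiLp.smul_apply, smul_eq_mul, v, hj, if_true]
    rw [mul_left_comm, cast_units_mul_self, mul_one]
    exact ht
  exact Set.disjoint_left.1 (P.disjoint_interior i i' hne) (hVi hqV) (hVi' hqV)

/-- The chart obtained by composition with a diffeomorphism between pieces of sectors that preserves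
the signs of the wall coordinates up to fixed changes. -/
noncomputable def comp (c : P.AdaptedChart p)
    (G : PartialEquiv (EuclideanSpace ℝ (Fin n)) (EuclideanSpace ℝ (Fin n)))
    (bdry' wall' : Finset (Fin n)) (q : Y) (d : Fin n → ℤˣ)
    (hdisj : Disjoint bdry' wall') (hw : wall' ⊆ c.wall)
    (hs : ∃ O, IsOpen O ∧ G.source = c.toPartialEquiv.target ∩ O)
    (ht : ∃ O, IsOpen O ∧ G.target = O ∩ sector bdry')
    (hG : ContDiffOn ℝ ∞ G G.source) (hG' : ContDiffOn ℝ ∞ G.symm G.target)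
    (hq : q ∈ c.toPartialEquiv.source) (hq' : c.toPartialEquiv q ∈ G.source)
    (hq0 : G (c.toPartialEquiv q) = 0)
    (hsign : ∀ x ∈ G.source, ∀ j ∈ wall',
      SignType.sign (G x j) = SignType.sign ((((d j : ℤˣ) : ℤ) : ℝ) * x j))
    (hconst : ∀ j ∈ c.wall, j ∉ wall' → ∃ σ : ℤˣ, ∀ x ∈ G.source, 0 < ((σ : ℤ) : ℝ) * x j) :
    P.AdaptedChart q where
  toPartialEquiv := c.toPartialEquiv.trans G
  bdry := bdry'
  wall := wall'
  disjoint_bdry_wall := hdisj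
  open_source := by
    obtain ⟨O, hO, h⟩ := hs
    have : (c.toPartialEquiv.trans G).source =
        c.toPartialEquiv.source ∩ c.toPartialEquiv ⁻¹' O := by
      rw [PartialEquiv.trans_source, h]
      ext x
      simp only [Set.mem_inter_iff, Set.mem_preimage]
      exact ⟨fun hx => ⟨hx.1, hx.2.2⟩, fun hx => ⟨hx.1, c.toPartialEquiv.map_source hx.1, hx.2⟩⟩
    rw [this]
    exact c.continuousOn.isOpen_inter_preimage c.open_source hO
  mem_source := ⟨hq, hq'⟩
  map_base := hq0
  target_eq := by
    obtain ⟨O, hO, h⟩ := hs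
    obtain ⟨O', hO', h'⟩ := ht
    refine ⟨O', hO', ?_⟩
    rw [PartialEquiv.trans_target, ← h', Set.inter_eq_left]
    intro y hy
    have := G.map_target hy
    rw [h] at this
    exact this.1
  contMDiffOn := by
    rw [PartialEquiv.coe_trans, PartialEquiv.trans_source]
    exact (hG.contMDiffOn).comp (c.contMDiffOn.mono Set.inter_subset_left) (fun x hx => hx.2)
  contMDiffOn_symm := by
    rw [PartialEquiv.coe_trans_symm, PartialEquiv.trans_target]
    exact c.contMDiffOn_symm.comp (hG'.contMDiffOn.mono Set.inter_subset_left) (fun x hx => hx.2)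
  block_eq_orthant := by
    rintro i ⟨q₁, ⟨hq₁, hq₁'⟩, hi⟩
    obtain ⟨s, hsi⟩ := c.exists_sign hq₁ hi
    -- Retained walls change sign by `d`; a discarded wall coordinate has constant sign, already
    -- compatible with `s` because the piece contains `q₁`.
    refine ⟨s * d, ?_⟩
    ext q₂
    simp only [Set.mem_inter_iff, and_congr_right_iff]
    rintro ⟨h1, h2⟩
    rw [hsi q₂ h1]
    have key : ∀ j ∈ wall', ∀ x ∈ G.source, (0 ≤ (((s j : ℤˣ) : ℤ) : ℝ) * x j ↔
        0 ≤ ((((s * d) j : ℤˣ) : ℤ) : ℝ) * G x j) := by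
      intro j hj x hx
      have := hsign x hx j hj
      have h3 := nonneg_iff_of_sign_eq this
      have h4 := nonpos_iff_of_sign_eq this
      rcases Int.units_eq_one_or (s j) with h5 | h5 <;>
      rcases Int.units_eq_one_or (d j) with h6 | h6 <;>
      simp only [Pi.mul_apply, h5, h6] at h3 h4 ⊢ <;> simp at h3 h4 ⊢ <;> simp [h3, h4]
    constructor
    · intro h j hj
      exact (key j hj _ h2).1 (h j (hw hj))
    · intro h j hj
      by_cases hj' : j ∈ wall'
      · exact (key j hj' _ h2).2 (h j hj')
      · obtain ⟨σ, hσ⟩ := hconst j hj hj'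
        have h3 := hσ _ h2
        have h4 := hσ _ hq₁'
        have h5 := (hsi q₁ hq₁).1 hi j hj
        rcases Int.units_eq_one_or (s j) with h6 | h6 <;>
        rcases Int.units_eq_one_or σ with h7 | h7 <;>
        simp [h6, h7] at h3 h4 h5 ⊢ <;> linarith
  orthant_eq_block := by
    classical
    intro s
    choose! σ hσ using hconst
    -- On discarded walls the sign must be the constant one `σ j`, the only one that occurs in the
    -- domain.
    obtain ⟨i, hi⟩ := c.exists_block (fun j => if j ∈ wall' then s j * d j else σ j)
    refine ⟨i, ?_⟩
    ext q₂
    simp only [Set.mem_inter_iff, and_congr_right_iff]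
    rintro ⟨h1, h2⟩
    rw [hi q₂ h1]
    have key : ∀ j ∈ wall', ∀ x ∈ G.source, (0 ≤ (((s j * d j : ℤˣ) : ℤ) : ℝ) * x j ↔
        0 ≤ (((s j : ℤˣ) : ℤ) : ℝ) * G x j) := by
      intro j hj x hx
      have := hsign x hx j hj
      have h3 := nonneg_iff_of_sign_eq this
      have h4 := nonpos_iff_of_sign_eq this
      rcases Int.units_eq_one_or (s j) with h5 | h5 <;>
      rcases Int.units_eq_one_or (d j) with h6 | h6 <;>
      simp only [h5, h6] at h3 h4 ⊢ <;> simp at h3 h4 ⊢ <;> simp [h3, h4]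
    constructor
    · intro h j hj
      have := h j (hw hj)
      simp only [hj, if_true] at this
      exact (key j hj _ h2).1 this
    · intro h j hj
      by_cases hj' : j ∈ wall'
      · simp only [hj', if_true]
        exact (key j hj' _ h2).2 (h j hj')
      · simp only [hj', if_false]
        exact (hσ j hj hj' _ h2).le

end AdaptedChart
end CornerPartition

/-! ### Recentring adapted charts -/

namespace CornerPartition

variable {n : ℕ} {Y : Type*} [TopologicalSpace Y] [ChartedSpace (EuclideanQuadrant n) Y]
  {ι : Type*}

/-- The points whose coordinates in `N` have the same sign as those of `x₀` where the latter do not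
vanish. -/
def signRegion (N : Finset (Fin n)) (x₀ : EuclideanSpace ℝ (Fin n)) :
    Set (EuclideanSpace ℝ (Fin n)) :=
  {x | ∀ j ∈ N, x₀ j ≠ 0 → 0 < x₀ j * x j}

theorem isOpen_signRegion (N : Finset (Fin n)) (x₀ : EuclideanSpace ℝ (Fin n)) :
    IsOpen (signRegion N x₀) := by
  simp only [signRegion, Set.ofPred_forall]
  refine isOpen_biInter_finset fun j _ => ?_
  by_cases h : x₀ j = 0
  · simp [h]
  · simp only [ne_eq, h, not_false_eq_true, Set.iInter_true]
    exact isOpen_lt continuous_const (by fun_prop)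

theorem mem_signRegion_self (N : Finset (Fin n)) (x₀ : EuclideanSpace ℝ (Fin n)) :
    x₀ ∈ signRegion N x₀ := fun _ _ h => mul_self_pos.2 h

theorem signRegion_zero (N : Finset (Fin n)) : signRegion N 0 = Set.univ := by
  ext; simp [signRegion]

/-- The change of signs of coordinates. -/
noncomputable def flip (d : Fin n → ℤˣ) (x : EuclideanSpace ℝ (Fin n)) :
    EuclideanSpace ℝ (Fin n) := WithLp.toLp 2 fun j => (((d j : ℤˣ) : ℤ) : ℝ) * x j

@[simp] theorem flip_apply (d : Fin n → ℤˣ) (x : EuclideanSpace ℝ (Fin n)) (j : Fin n) :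
    flip d x j = (((d j : ℤˣ) : ℤ) : ℝ) * x j := rfl

@[simp] theorem flip_flip (d : Fin n → ℤˣ) (x : EuclideanSpace ℝ (Fin n)) :
    flip d (flip d x) = x := by
  ext j; simp [← mul_assoc, AdaptedChart.cast_units_mul_self]

@[simp] theorem flip_one (x : EuclideanSpace ℝ (Fin n)) : flip 1 x = x := by
  ext j; simp

theorem contDiff_flip (d : Fin n → ℤˣ) : ContDiff ℝ ∞ (flip d) := by
  rw [contDiff_euclidean]
  intro j
  simp only [flip_apply]
  fun_prop

/-- Translation of `x₀` to the origin followed by a change of signs. -/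
noncomputable def flipTranslate (d : Fin n → ℤˣ) (x₀ : EuclideanSpace ℝ (Fin n))
    (S : Set (EuclideanSpace ℝ (Fin n))) :
    PartialEquiv (EuclideanSpace ℝ (Fin n)) (EuclideanSpace ℝ (Fin n)) where
  toFun x := flip d (x - x₀)
  invFun v := flip d v + x₀
  source := S
  target := {v | flip d v + x₀ ∈ S}
  map_source' x hx := by simpa using hx
  map_target' v hv := hv
  left_inv' x _ := by simp
  right_inv' v _ := by simp

namespace AdaptedChart

variable {P : CornerPartition n Y ι} {p : Y}

/-- The adapted chart at a point of the domain of an adapted chart obtained by translation, change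
of signs of wall coordinates, and restriction. -/
noncomputable def recenter (c : P.AdaptedChart p) {q : Y} (hq : q ∈ c.toPartialEquiv.source)
    (d : Fin n → ℤˣ) (hd : ∀ j ∈ c.bdry, d j = 1) {O : Set (EuclideanSpace ℝ (Fin n))}
    (hO : IsOpen O) (hqO : c.toPartialEquiv q ∈ O) : P.AdaptedChart q :=
  c.comp
    (flipTranslate d (c.toPartialEquiv q)
      (c.toPartialEquiv.target ∩ (O ∩ signRegion (c.bdry ∪ c.wall) (c.toPartialEquiv q))))
    (c.bdry.filter fun j => c.toPartialEquiv q j = 0)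
    (c.wall.filter fun j => c.toPartialEquiv q j = 0) q d
    (Finset.disjoint_filter_filter c.disjoint_bdry_wall) (Finset.filter_subset _ _)
    ⟨_, hO.inter (isOpen_signRegion _ _), rfl⟩
    (by
      obtain ⟨O₁, hO₁, h⟩ := c.target_eq
      have hcont : Continuous (fun v => flip d v + c.toPartialEquiv q) :=
        (contDiff_flip d).continuous.add continuous_const
      -- Boundary coordinates that are nonzero at `q` are positive on the sign region, so their
      -- inequalities drop out; for the vanishing ones `d = 1` keeps the inequality.
      refine ⟨(fun v => flip d v + c.toPartialEquiv q) ⁻¹'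
        (O₁ ∩ (O ∩ signRegion (c.bdry ∪ c.wall) (c.toPartialEquiv q))),
        (hO₁.inter (hO.inter (isOpen_signRegion _ _))).preimage hcont, ?_⟩
      ext v
      simp only [flipTranslate, h, Set.mem_ofPred_eq, Set.mem_inter_iff, Set.mem_preimage]
      constructor
      · rintro ⟨⟨h1, h2⟩, h3, h4⟩
        refine ⟨⟨h1, h3, h4⟩, fun j hj => ?_⟩
        rw [Finset.mem_filter] at hj
        have := h2 j hj.1
        simpa [hd j hj.1, hj.2] using this
      · rintro ⟨⟨h1, h3, h4⟩, h5⟩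
        refine ⟨⟨h1, fun j hj => ?_⟩, h3, h4⟩
        by_cases h0 : c.toPartialEquiv q j = 0
        · have := h5 j (Finset.mem_filter.2 ⟨hj, h0⟩)
          simpa [hd j hj, h0] using this
        · have h6 := h4 j (Finset.mem_union_left _ hj) h0
          exact (pos_of_mul_pos_right h6 (c.nonneg_of_mem_bdry hq hj)).le)
    (((contDiff_flip d).comp (contDiff_id.sub contDiff_const)).contDiffOn)
    (((contDiff_flip d).add contDiff_const).contDiffOn)
    hq ⟨c.toPartialEquiv.map_source hq, hqO, mem_signRegion_self _ _⟩
    (by ext j; simp [flipTranslate])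
    (by
      intro x _ j hj
      rw [Finset.mem_filter] at hj
      simp [flipTranslate, hj.2])
    (by
      intro j hj hj'
      have h0 : c.toPartialEquiv q j ≠ 0 := fun h => hj' (Finset.mem_filter.2 ⟨hj, h⟩)
      rcases h0.lt_or_gt with h | h
      · refine ⟨-1, fun x hx => ?_⟩
        have := hx.2.2 j (Finset.mem_union_right _ hj) h0
        simpa using neg_of_mul_pos_right this h.le
      · refine ⟨1, fun x hx => ?_⟩
        have := hx.2.2 j (Finset.mem_union_right _ hj) h0
        simpa using pos_of_mul_pos_right this h.le)

section recenter

variable (c : P.AdaptedChart p) {q : Y} (hq : q ∈ c.toPartialEquiv.source)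
    (d : Fin n → ℤˣ) (hd : ∀ j ∈ c.bdry, d j = 1) {O : Set (EuclideanSpace ℝ (Fin n))}
    (hO : IsOpen O) (hqO : c.toPartialEquiv q ∈ O)

theorem recenter_bdry : (c.recenter hq d hd hO hqO).bdry =
    c.bdry.filter fun j => c.toPartialEquiv q j = 0 := rfl

theorem recenter_wall : (c.recenter hq d hd hO hqO).wall =
    c.wall.filter fun j => c.toPartialEquiv q j = 0 := rfl

theorem recenter_apply (x : Y) : (c.recenter hq d hd hO hqO).toPartialEquiv x =
    flip d (c.toPartialEquiv x - c.toPartialEquiv q) := rfl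

theorem recenter_symm_apply (v : EuclideanSpace ℝ (Fin n)) :
    (c.recenter hq d hd hO hqO).toPartialEquiv.symm v =
    c.toPartialEquiv.symm (flip d v + c.toPartialEquiv q) := rfl

theorem recenter_source_subset :
    (c.recenter hq d hd hO hqO).toPartialEquiv.source ⊆ c.toPartialEquiv.source :=
  fun _ hx => hx.1

theorem mem_recenter_source {x : Y} :
    x ∈ (c.recenter hq d hd hO hqO).toPartialEquiv.source ↔ x ∈ c.toPartialEquiv.source ∧
      c.toPartialEquiv x ∈ O ∧
      c.toPartialEquiv x ∈ signRegion (c.bdry ∪ c.wall) (c.toPartialEquiv q) :=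
  ⟨fun hx => ⟨hx.1, hx.2.2⟩, fun hx => ⟨hx.1, c.toPartialEquiv.map_source hx.1, hx.2⟩⟩

theorem mem_recenter_target {v : EuclideanSpace ℝ (Fin n)} :
    v ∈ (c.recenter hq d hd hO hqO).toPartialEquiv.target ↔
      flip d v + c.toPartialEquiv q ∈ c.toPartialEquiv.target ∧
      flip d v + c.toPartialEquiv q ∈ O ∧
      flip d v + c.toPartialEquiv q ∈ signRegion (c.bdry ∪ c.wall) (c.toPartialEquiv q) :=
  ⟨fun hv => hv.1, fun hv => ⟨hv, hv.1⟩⟩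

end recenter

/-- An adapted chart onto a sector of a ball, with prescribed signs of one block. -/
theorem exists_ball (c : P.AdaptedChart p) (d : Fin n → ℤˣ) (hd : ∀ j ∈ c.bdry, d j = 1) :
    ∃ (c' : P.AdaptedChart p) (ρ : ℝ), 0 < ρ ∧
      c'.toPartialEquiv.target = Metric.ball 0 ρ ∩ sector c'.bdry ∧
      c'.bdry = c.bdry ∧ c'.wall = c.wall ∧
      c'.toPartialEquiv.source ⊆ c.toPartialEquiv.source ∧
      ∀ x, c'.toPartialEquiv x = flip d (c.toPartialEquiv x) := by
  obtain ⟨O, hO, h⟩ := c.target_eq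
  have h0 : (0 : EuclideanSpace ℝ (Fin n)) ∈ O ∩ sector c.bdry := by
    rw [← h, ← c.map_base]; exact c.toPartialEquiv.map_source c.mem_source
  obtain ⟨ρ, hρ, hρO⟩ := Metric.isOpen_iff.1 hO 0 h0.1
  have hb : c.toPartialEquiv p ∈ Metric.ball (0 : EuclideanSpace ℝ (Fin n)) ρ := by
    rw [c.map_base]; exact Metric.mem_ball_self hρ
  refine ⟨c.recenter c.mem_source d hd Metric.isOpen_ball hb, ρ, hρ, ?_, ?_, ?_,
    c.recenter_source_subset _ _ _ _ _, ?_⟩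
  · ext v
    rw [mem_recenter_target, recenter_bdry, h]
    simp only [c.map_base, signRegion_zero, Set.mem_univ, and_true, add_zero, Set.mem_inter_iff]
    have hnorm : ‖flip d v‖ = ‖v‖ := by
      simp only [EuclideanSpace.norm_eq, flip_apply]
      congr 1
      refine Finset.sum_congr rfl fun j _ => ?_
      rcases Int.units_eq_one_or (d j) with h | h <;> simp [h]
    have hsec : flip d v ∈ sector c.bdry ↔ v ∈ sector c.bdry := by
      refine forall₂_congr fun j hj => ?_
      simp [hd j hj]
    simp only [hsec, mem_ball_zero_iff, hnorm, PiLp.zero_apply, Finset.filter_true]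
    constructor
    · rintro ⟨⟨-, h1⟩, h2⟩; exact ⟨h2, h1⟩
    · rintro ⟨h1, h2⟩
      exact ⟨⟨hρO (by simpa [hnorm] using h1), h2⟩, h1⟩
  · simp [recenter_bdry, c.map_base]
  · simp [recenter_wall, c.map_base]
  · intro x; simp [recenter_apply, c.map_base]

end AdaptedChart
end CornerPartition

/-! ### Strata, blocks along strata, and open faces -/

namespace CornerPartition

variable {n : ℕ} {Y : Type*} [TopologicalSpace Y] [ChartedSpace (EuclideanQuadrant n) Y]
  {ι : Type*} {P : CornerPartition n Y ι}

namespace AdaptedChart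

variable {p : Y}

/-- Blocks through `p` correspond to sign vectors on the walls. The count does not mention the
chart, so the number of walls, and with it the stratum of `p`, is well defined. -/
theorem card_blocks (c : P.AdaptedChart p) :
    Nat.card {i // p ∈ P.block i} = 2 ^ c.wall.card := by
  classical
  have hex : ∀ s : c.wall → ℤˣ, ∃ i : ι, ∀ q ∈ c.toPartialEquiv.source,
      (q ∈ P.block i ↔ c.toPartialEquiv q ∈
        orthant c.wall (fun j => if h : j ∈ c.wall then s ⟨j, h⟩ else 1)) :=
    fun s => c.exists_block _
  choose f hf using hex
  have hfp : ∀ s, p ∈ P.block (f s) := fun s => by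
    rw [hf s p c.mem_source, c.map_base]; exact zero_mem_orthant _ _
  have hbij : Function.Bijective (fun s => (⟨f s, hfp s⟩ : {i // p ∈ P.block i})) := by
    constructor
    · intro s s' h
      simp only [Subtype.mk.injEq] at h
      -- A point in the open orthant of `s` lies in no closed orthant with other signs.
      let v : EuclideanSpace ℝ (Fin n) := WithLp.toLp 2 fun j =>
        if h : j ∈ c.wall then (((s ⟨j, h⟩ : ℤˣ) : ℤ) : ℝ) else 0
      obtain ⟨t, ht, q, -, hq, hcq⟩ := c.exists_add_smul c.mem_source Filter.univ_mem (v := v)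
        (fun j hj _ => by simp [v, Finset.disjoint_left.1 c.disjoint_bdry_wall hj])
      rw [c.map_base, zero_add] at hcq
      have h1 : q ∈ P.block (f s) := by
        rw [hf s q hq, hcq]
        intro j hj
        simp only [PiLp.smul_apply, smul_eq_mul, v, hj, dif_pos]
        rw [mul_left_comm, cast_units_mul_self]; linarith
      rw [h, hf s' q hq, hcq] at h1
      funext ⟨j, hj⟩
      have := h1 j hj
      simp only [PiLp.smul_apply, smul_eq_mul, v, hj, dif_pos] at this
      rcases Int.units_eq_one_or (s ⟨j, hj⟩) with h6 | h6 <;>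
      rcases Int.units_eq_one_or (s' ⟨j, hj⟩) with h7 | h7 <;>
      simp [h6, h7] at this ⊢ <;> linarith
    · rintro ⟨i, hi⟩
      obtain ⟨s, hs⟩ := c.exists_sign c.mem_source hi
      refine ⟨fun j => s j, Subtype.ext (c.block_unique (s := s) ?_ hs)⟩
      intro q hq
      rw [hf _ q hq]
      refine forall₂_congr fun j hj => ?_
      simp [hj]
  rw [← Nat.card_eq_of_bijective _ hbij, Nat.card_eq_fintype_card, Fintype.card_fun]
  simp

theorem card_wall_eq (c c' : P.AdaptedChart p) : c.wall.card = c'.wall.card :=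
  Nat.pow_right_injective le_rfl (c.card_blocks.symm.trans c'.card_blocks)

theorem mem_stratum_iff (c : P.AdaptedChart p) {q : Y} (hq : q ∈ c.toPartialEquiv.source) {k : ℕ} :
    q ∈ P.stratum k ↔ (c.wall.filter fun j => c.toPartialEquiv q j = 0).card = k := by
  let c' := c.recenter hq 1 (fun _ _ => rfl) isOpen_univ (Set.mem_univ _)
  constructor
  · rintro ⟨c'', h⟩
    rw [← h, c''.card_wall_eq c']; rfl
  · intro h
    exact ⟨c', h⟩

end AdaptedChart

theorem isClosed_block (hP : P.IsRegular) (i : ι) : IsClosed (P.block i) := by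
  refine isClosed_of_closure_subset fun p hp => ?_
  obtain ⟨c⟩ := hP p
  obtain ⟨q, hq, hi⟩ := mem_closure_iff_nhds.1 hp _ (c.open_source.mem_nhds c.mem_source)
  exact c.mem_block_base hq hi

theorem _root_.IsPreconnected.iff_of_locally_iff {X : Type*} [TopologicalSpace X] {S : Set X}
    (hS : IsPreconnected S) {Q : X → Prop}
    (h : ∀ p ∈ S, ∃ U ∈ 𝓝 p, ∀ q ∈ U, q ∈ S → (Q q ↔ Q p)) {p q : X} (hp : p ∈ S) (hq : q ∈ S) :
    Q p ↔ Q q := by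
  refine hS.induction₂ (fun x y => Q x ↔ Q y) (fun x hx => ?_) (fun _ _ _ _ _ _ h h' => h.trans h')
    (fun _ _ _ _ h => h.symm) hp hq
  obtain ⟨U, hU, h⟩ := h x hx
  filter_upwards [mem_nhdsWithin_of_mem_nhds hU, self_mem_nhdsWithin] with y hy hy'
  exact (h y hy hy').symm

/-- Near a point of the stratum, a point of the same stratum has as many vanishing wall coordinates
as there are walls. All of them vanish, so it lies in the same blocks, and the component is
connected. -/
theorem mem_block_iff_of_mem_component {k : ℕ} {p q : Y} {i : ι}
    (hq : q ∈ connectedComponentIn (P.stratum k) p) :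
    q ∈ P.block i ↔ p ∈ P.block i := by
  have hp : p ∈ P.stratum k := by
    by_contra h
    rw [connectedComponentIn_eq_empty h] at hq
    exact hq
  refine isPreconnected_connectedComponentIn.iff_of_locally_iff (Q := fun x => x ∈ P.block i)
    (fun x hx => ?_) hq (mem_connectedComponentIn hp)
  obtain ⟨c, hc⟩ := connectedComponentIn_subset _ _ hx
  refine ⟨_, c.open_source.mem_nhds c.mem_source, fun y hy hy' => ⟨c.mem_block_base hy, fun hi => ?_⟩⟩
  have h1 := (c.mem_stratum_iff hy).1 (connectedComponentIn_subset _ _ hy')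
  rw [← hc, Finset.card_filter_eq_iff] at h1
  obtain ⟨s, hs⟩ := c.exists_sign c.mem_source hi
  rw [hs y hy]
  intro j hj
  simp [h1 j hj]

theorem closure_component_subset_block_iff (hP : P.IsRegular) {k : ℕ} {p : Y}
    (hp : p ∈ P.stratum k) {i : ι} :
    closure (connectedComponentIn (P.stratum k) p) ⊆ P.block i ↔ p ∈ P.block i :=
  ⟨fun h => h (subset_closure (mem_connectedComponentIn hp)), fun h =>
    closure_minimal (fun _ hq => (mem_block_iff_of_mem_component hq).2 h) (isClosed_block hP i)⟩

/-- An adapted chart in which the block `i` is the positive orthant and the blocks `w a` are the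
adjacent orthants across the coordinate hyperplanes of certain wall coordinates `axis a`. -/
structure FramedChart (P : CornerPartition n Y ι) {k : ℕ} (i : ι) (w : Fin k → ι) (p : Y) extends
    P.AdaptedChart p where
  axis : Fin k → Fin n
  axis_injective : Function.Injective axis
  axis_mem : ∀ a, axis a ∈ wall
  mem_block_iff : ∀ q ∈ toPartialEquiv.source,
    (q ∈ P.block i ↔ ∀ j ∈ wall, 0 ≤ toPartialEquiv q j)
  mem_block_axis_iff : ∀ a, ∀ q ∈ toPartialEquiv.source,
    (q ∈ P.block (w a) ↔ toPartialEquiv q (axis a) ≤ 0 ∧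
      ∀ j ∈ wall, j ≠ axis a → 0 ≤ toPartialEquiv q j)

theorem exists_positive_chart (hP : P.IsRegular) {p : Y} {i : ι} (hi : p ∈ P.block i) :
    ∃ (c : P.AdaptedChart p) (ρ : ℝ), 0 < ρ ∧
      c.toPartialEquiv.target = Metric.ball 0 ρ ∩ sector c.bdry ∧
      ∀ q ∈ c.toPartialEquiv.source,
        (q ∈ P.block i ↔ ∀ j ∈ c.wall, 0 ≤ c.toPartialEquiv q j) := by
  classical
  obtain ⟨c⟩ := hP p
  obtain ⟨s, hs⟩ := c.exists_sign c.mem_source hi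
  obtain ⟨c', ρ, hρ, ht, hb, hw, hsub, happ⟩ := c.exists_ball
    (fun j => if j ∈ c.wall then s j else 1)
    (fun j hj => by simp [Finset.disjoint_left.1 c.disjoint_bdry_wall hj])
  refine ⟨c', ρ, hρ, ht, fun q hq => ?_⟩
  rw [hs q (hsub hq), hw]
  refine forall₂_congr fun j hj => ?_
  simp [happ, hj]

/-- The open face of the positive orthant in the hyperplane of the coordinate `j`. -/
def openFace {p : Y} (c : P.AdaptedChart p) (j : Fin n) : Set Y :=
  {q | q ∈ c.toPartialEquiv.source ∧ c.toPartialEquiv q j = 0 ∧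
    ∀ j' ∈ c.wall, j' ≠ j → 0 < c.toPartialEquiv q j'}

section openFace

variable {p : Y} (c : P.AdaptedChart p)

theorem openFace_subset_stratum {j : Fin n} (hj : j ∈ c.wall) : openFace c j ⊆ P.stratum 1 := by
  classical
  rintro q ⟨hq, h0, hpos⟩
  rw [c.mem_stratum_iff hq, Finset.card_eq_one]
  refine ⟨j, ?_⟩
  ext j'
  simp only [Finset.mem_filter, Finset.mem_singleton]
  constructor
  · rintro ⟨h1, h2⟩
    by_contra h
    exact (hpos j' h1 h).ne' h2
  · rintro rfl
    exact ⟨hj, h0⟩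

/-- Over a ball-shaped target the face is the continuous image of a convex set. -/
theorem isPreconnected_openFace {ρ : ℝ}
    (ht : c.toPartialEquiv.target = Metric.ball 0 ρ ∩ sector c.bdry) (j : Fin n) :
    IsPreconnected (openFace c j) := by
  have h1 : openFace c j = c.toPartialEquiv.symm '' (c.toPartialEquiv.target ∩
      {x | x j = 0 ∧ ∀ j' ∈ c.wall, j' ≠ j → 0 < x j'}) := by
    ext q
    constructor
    · rintro ⟨hq, h⟩
      exact ⟨_, ⟨c.toPartialEquiv.map_source hq, h⟩, c.toPartialEquiv.left_inv hq⟩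
    · rintro ⟨x, ⟨hx, h⟩, rfl⟩
      refine ⟨c.toPartialEquiv.map_target hx, ?_⟩
      rwa [c.toPartialEquiv.right_inv hx]
  rw [h1]
  refine IsPreconnected.image ?_ _ (c.continuousOn_symm.mono Set.inter_subset_left)
  rw [ht]
  refine Convex.isPreconnected (((convex_ball _ _).inter (convex_sector _)).inter ?_)
  rintro x ⟨hx0, hx⟩ y ⟨hy0, hy⟩ a b ha hb hab
  refine ⟨by simp [hx0, hy0], fun i hi hij => ?_⟩
  have h1 := hx i hi hij
  have h2 := hy i hi hij
  simp only [PiLp.add_apply, PiLp.smul_apply, smul_eq_mul]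
  rcases ha.eq_or_lt with rfl | ha
  · have : b = 1 := by linarith
    subst this; simpa using h2
  · have := mul_pos ha h1
    have := mul_nonneg hb h2.le
    linarith

theorem mem_closure_openFace {j : Fin n} {q : Y}
    (hq : q ∈ c.toPartialEquiv.source) (h0 : c.toPartialEquiv q j = 0)
    (hpos : ∀ j' ∈ c.wall, j' ≠ j → 0 ≤ c.toPartialEquiv q j') : q ∈ closure (openFace c j) := by
  rw [mem_closure_iff_nhds]
  intro U hU
  let v : EuclideanSpace ℝ (Fin n) := WithLp.toLp 2 fun j' => if j' = j then 0 else 1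
  -- The direction increases every coordinate except `j`, so it enters the open face.
  obtain ⟨t, ht, q', hq', hq's, hcq⟩ := c.exists_add_smul hq hU (v := v) (fun j' _ _ => by
    simp only [v]; split_ifs <;> norm_num)
  refine ⟨q', hq', hq's, ?_, fun j' hj' hne => ?_⟩
  · simp [hcq, h0, v]
  · have := hpos j' hj' hne
    simp only [hcq, PiLp.add_apply, PiLp.smul_apply, smul_eq_mul, v, hne, if_false]
    linarith

theorem exists_mem_openFace {i : ι}
    (hc : ∀ q ∈ c.toPartialEquiv.source,
        (q ∈ P.block i ↔ ∀ j ∈ c.wall, 0 ≤ c.toPartialEquiv q j))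
    {q : Y} (hq : q ∈ c.toPartialEquiv.source) (hqi : q ∈ P.block i) (hs : q ∈ P.stratum 1) :
    ∃ j ∈ c.wall, q ∈ openFace c j := by
  rw [c.mem_stratum_iff hq, Finset.card_eq_one] at hs
  obtain ⟨j, hj⟩ := hs
  have h1 : ∀ j', j' ∈ c.wall ∧ c.toPartialEquiv q j' = 0 ↔ j' = j := by
    intro j'
    simpa using Finset.ext_iff.1 hj j'
  refine ⟨j, ((h1 j).2 rfl).1, hq, ((h1 j).2 rfl).2, fun j' hj' hne => ?_⟩
  refine lt_of_le_of_ne ((hc q hq).1 hqi j' hj') fun h => hne ?_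
  exact (h1 j').1 ⟨hj', h.symm⟩

/-- The blocks at a point of an open face are the positive one and the adjacent one. -/
theorem eq_or_forall_mem_block_iff {i : ι}
    (hc : ∀ q ∈ c.toPartialEquiv.source,
        (q ∈ P.block i ↔ ∀ j ∈ c.wall, 0 ≤ c.toPartialEquiv q j))
    {j : Fin n} (hjw : j ∈ c.wall) {q : Y} (hq : q ∈ openFace c j) {i' : ι}
    (hi' : q ∈ P.block i') :
    i' = i ∨ ∀ q ∈ c.toPartialEquiv.source, (q ∈ P.block i' ↔ c.toPartialEquiv q j ≤ 0 ∧
      ∀ j' ∈ c.wall, j' ≠ j → 0 ≤ c.toPartialEquiv q j') := by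
  obtain ⟨s, hs⟩ := c.exists_sign hq.1 hi'
  have h1 : ∀ j' ∈ c.wall, j' ≠ j → s j' = 1 := by
    intro j' hj' hne
    have h2 := (hs q hq.1).1 hi' j' hj'
    have h3 := hq.2.2 j' hj' hne
    rcases Int.units_eq_one_or (s j') with h | h
    · exact h
    · rw [h] at h2
      simp at h2
      linarith
  rcases Int.units_eq_one_or (s j) with h | h
  · left
    refine c.block_unique hs fun q' hq' => ?_
    rw [hc q' hq']
    refine forall₂_congr fun j' hj' => ?_
    by_cases hne : j' = j
    · subst hne; simp [h]
    · simp [h1 j' hj' hne]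
  · right
    intro q' hq'
    rw [hs q' hq']
    constructor
    · intro h2
      refine ⟨by simpa [h] using h2 j hjw, fun j' hj' hne => ?_⟩
      simpa [h1 j' hj' hne] using h2 j' hj'
    · rintro ⟨h2, h3⟩ j' hj'
      by_cases hne : j' = j
      · subst hne; simpa [h] using h2
      · simpa [h1 j' hj' hne] using h3 j' hj' hne

end openFace

end CornerPartition

/-! ### The walls of a block along a facet -/

namespace CornerPartition

variable {n : ℕ} {Y : Type*} [TopologicalSpace Y] [ChartedSpace (EuclideanQuadrant n) Y]
  {ι : Type*} {P : CornerPartition n Y ι}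

/-- The codimension-1 facets of a block that contain a codimension-`k` facet of it, and charts that
exhibit them as coordinate hyperplanes. -/
theorem exists_walls (hP : P.IsRegular) {k : ℕ} {Z : Set Y} (hZ : P.IsFacet k Z) {i : ι}
    (hi : Z ⊆ P.block i) :
    ∃ (w : Fin k → ι) (W : Fin k → Set Y), Function.Injective W ∧
      (∀ W' : Set Y, (∃ a, W a = W') ↔ (P.IsFacet 1 W' ∧ Z ⊆ W' ∧ W' ⊆ P.block i)) ∧
      (∀ a, W a ⊆ P.block (w a)) ∧
      ∀ p ∈ Z, ∃ (c : P.FramedChart i w p) (ρ : ℝ), 0 < ρ ∧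
        c.toPartialEquiv.target = Metric.ball 0 ρ ∩ sector c.bdry := by
  classical
  obtain ⟨p₀, hp₀, rfl⟩ := hZ
  set Z := closure (connectedComponentIn (P.stratum k) p₀) with hZdef
  have hZconn : IsPreconnected Z := isPreconnected_connectedComponentIn.closure
  have hp₀Z : p₀ ∈ Z := subset_closure (mem_connectedComponentIn hp₀)
  obtain ⟨c₀, ρ₀, hρ₀, ht₀, hc₀⟩ := exists_positive_chart hP (hi hp₀Z)
  have hcard : Fintype.card c₀.wall = Fintype.card (Fin k) := by
    have := (c₀.mem_stratum_iff c₀.mem_source).1 hp₀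
    simpa [c₀.map_base] using this
  let e : Fin k ≃ c₀.wall := (Fintype.equivOfCardEq hcard).symm
  have hblock : ∀ a : Fin k, ∃ i' : ι, ∀ q ∈ c₀.toPartialEquiv.source,
      (q ∈ P.block i' ↔ c₀.toPartialEquiv q (e a) ≤ 0 ∧
        ∀ j' ∈ c₀.wall, j' ≠ (e a : Fin n) → 0 ≤ c₀.toPartialEquiv q j') := by
    intro a
    obtain ⟨i', hi'⟩ := c₀.exists_block (fun j => if j = (e a : Fin n) then -1 else 1)
    refine ⟨i', fun q hq => ?_⟩
    rw [hi' q hq]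
    constructor
    · intro h
      refine ⟨by simpa using h _ (e a).2, fun j' hj' hne => by simpa [hne] using h j' hj'⟩
    · rintro ⟨h1, h2⟩ j' hj'
      by_cases hne : j' = (e a : Fin n)
      · subst hne; simpa using h1
      · simpa [hne] using h2 j' hj' hne
  choose w hw using hblock
  have hface : ∀ a, p₀ ∈ closure (openFace c₀ (e a)) := fun a =>
    mem_closure_openFace c₀ c₀.mem_source (by simp [c₀.map_base]) (by simp [c₀.map_base])
  have hne : ∀ a, (openFace c₀ (e a)).Nonempty := fun a => closure_nonempty_iff.1 ⟨p₀, hface a⟩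
  choose x hx using hne
  have hxs : ∀ a, x a ∈ P.stratum 1 := fun a => openFace_subset_stratum c₀ (e a).2 (hx a)
  let C : Fin k → Set Y := fun a => connectedComponentIn (P.stratum 1) (x a)
  have hxi : ∀ a, x a ∈ P.block i := fun a => (hc₀ _ (hx a).1).2 fun j hj => by
    by_cases h : j = (e a : Fin n)
    · subst h; exact (hx a).2.1.ge
    · exact ((hx a).2.2 j hj h).le
  have hxw : ∀ a, x a ∈ P.block (w a) := fun a =>
    (hw a _ (hx a).1).2 ⟨(hx a).2.1.le, fun j hj h => ((hx a).2.2 j hj h).le⟩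
  -- The neighbouring block detects the label: in `w b` the coordinate `e b` is nonpositive, while
  -- at `x a` with `a ≠ b` it is positive. This gives distinct walls, and later distinct axes in
  -- every chart.
  have hxx : ∀ a b, x a ∈ P.block (w b) → a = b := by
    intro a b h
    by_contra hab
    have h1 := ((hw b _ (hx a).1).1 h).1
    have h2 := (hx a).2.2 (e b) (e b).2 fun h => hab (e.injective (Subtype.ext h)).symm
    linarith
  have hwi : ∀ a, w a ≠ i := by
    intro a h
    obtain ⟨t, ht, q, -, hq, hcq⟩ := c₀.exists_add_smul c₀.mem_source Filter.univ_mem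
      (v := WithLp.toLp 2 fun j => 1) (fun j hj _ => by simp)
    have h1 : q ∈ P.block i := (hc₀ q hq).2 fun j hj => by simp [hcq, c₀.map_base, ht.le]
    rw [← h, hw a q hq] at h1
    have := h1.1
    simp [hcq, c₀.map_base] at this
    linarith
  have hCw : ∀ a, closure (C a) ⊆ P.block (w a) := fun a =>
    (closure_component_subset_block_iff hP (hxs a)).2 (hxw a)
  have hCi : ∀ a, closure (C a) ⊆ P.block i := fun a =>
    (closure_component_subset_block_iff hP (hxs a)).2 (hxi a)
  have hZw : ∀ a, Z ⊆ P.block (w a) := fun a =>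
    (closure_component_subset_block_iff hP hp₀).2 <| by
      rw [hw a p₀ c₀.mem_source, c₀.map_base]; simp
  -- charts along `Z` that meet one of the open facets
  have hchart : ∀ {p : Y} (c : P.AdaptedChart p), (∀ q ∈ c.toPartialEquiv.source,
        (q ∈ P.block i ↔ ∀ j ∈ c.wall, 0 ≤ c.toPartialEquiv q j)) → ∀ a,
        (C a ∩ c.toPartialEquiv.source).Nonempty → ∃ j ∈ c.wall, ∃ y ∈ C a, y ∈ openFace c j ∧
        ∀ q ∈ c.toPartialEquiv.source,
          (q ∈ P.block (w a) ↔ c.toPartialEquiv q j ≤ 0 ∧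
            ∀ j' ∈ c.wall, j' ≠ j → 0 ≤ c.toPartialEquiv q j') := by
    rintro p c hc a ⟨y, hyC, hy⟩
    obtain ⟨j, hj, hyj⟩ := exists_mem_openFace c hc hy
      ((mem_block_iff_of_mem_component hyC).2 (hxi a)) (connectedComponentIn_subset _ _ hyC)
    refine ⟨j, hj, y, hyC, hyj, ?_⟩
    exact (eq_or_forall_mem_block_iff c hc hj hyj
      ((mem_block_iff_of_mem_component hyC).2 (hxw a))).resolve_left (hwi a)
  -- If the chart meets `C a`, one whole open face lies in `C a`. Points of `Z` in the chart lie in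
  -- both `i` and `w a`, hence on the hyperplane of that face and in its closure.
  have hsub : ∀ {p : Y} (c : P.AdaptedChart p) (ρ : ℝ),
      c.toPartialEquiv.target = Metric.ball 0 ρ ∩ sector c.bdry → (∀ q ∈ c.toPartialEquiv.source,
        (q ∈ P.block i ↔ ∀ j ∈ c.wall, 0 ≤ c.toPartialEquiv q j)) → ∀ a,
        (C a ∩ c.toPartialEquiv.source).Nonempty →
        ∀ q ∈ Z, q ∈ c.toPartialEquiv.source → q ∈ closure (C a) := by
    intro p c ρ ht hc a hne q hqZ hq
    obtain ⟨j, hj, y, hyC, hyj, hcw⟩ := hchart c hc a hne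
    have h1 : openFace c j ⊆ C a := by
      have h2 := (isPreconnected_openFace c ht j).subset_connectedComponentIn hyj
        (openFace_subset_stratum c hj)
      rwa [← connectedComponentIn_eq hyC] at h2
    refine closure_mono h1 (mem_closure_openFace c hq ?_ ?_)
    · exact le_antisymm ((hcw q hq).1 (hZw a hqZ)).1 ((hc q hq).1 (hi hqZ) j hj)
    · exact fun j' hj' _ => (hc q hq).1 (hi hqZ) j' hj'
  have hp₀C : ∀ a, p₀ ∈ closure (C a) := fun a => by
    refine closure_mono ?_ (hface a)
    exact (isPreconnected_openFace c₀ ht₀ (e a)).subset_connectedComponentIn (hx a)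
        (openFace_subset_stratum c₀ (e a).2)
  -- By the preceding step, membership in `closure (C a)` at one point of `Z` in a chart transfers
  -- to the centre and back, so it is locally constant along `Z`.
  have hZC : ∀ a, Z ⊆ closure (C a) := by
    intro a q hq
    refine (hZconn.iff_of_locally_iff (Q := fun q => q ∈ closure (C a)) (fun p hp => ?_)
      hp₀Z hq).1 (hp₀C a)
    obtain ⟨c, ρ, hρ, ht, hc⟩ := exists_positive_chart hP (hi hp)
    refine ⟨_, c.open_source.mem_nhds c.mem_source, fun q' hq' hq'Z => ⟨fun h => ?_, fun h => ?_⟩⟩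
    · have := mem_closure_iff_nhds.1 h _ (c.open_source.mem_nhds hq')
      rw [Set.inter_comm] at this
      exact hsub c ρ ht hc a this p hp c.mem_source
    · have := mem_closure_iff_nhds.1 h _ (c.open_source.mem_nhds c.mem_source)
      rw [Set.inter_comm] at this
      exact hsub c ρ ht hc a this q' hq'Z hq'
  refine ⟨w, fun a => closure (C a), ?_, fun W' => ⟨?_, ?_⟩, hCw, ?_⟩
  · intro a b hab
    refine hxx a b (hCw b ?_)
    have hab' : closure (C a) = closure (C b) := hab
    rw [← hab']
    exact subset_closure (mem_connectedComponentIn (hxs a))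
  · rintro ⟨a, rfl⟩
    exact ⟨⟨x a, hxs a, rfl⟩, hZC a, hCi a⟩
  -- No other walls exist: a codimension-1 facet of the block that contains `p₀` meets the chart
  -- `c₀` in one of its open faces, so it comes from the component `C a` of that face.
  · rintro ⟨⟨p₁, hp₁, rfl⟩, h1, h2⟩
    obtain ⟨y, hy, hyC⟩ := mem_closure_iff_nhds.1 (h1 hp₀Z) _
      (c₀.open_source.mem_nhds c₀.mem_source)
    obtain ⟨j, hj, hyj⟩ := exists_mem_openFace c₀ hc₀ hy (h2 (subset_closure hyC))
      (connectedComponentIn_subset _ _ hyC)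
    obtain ⟨a, ha⟩ := e.surjective ⟨j, hj⟩
    refine ⟨a, ?_⟩
    have ha' : (e a : Fin n) = j := by rw [ha]
    have h3 := (isPreconnected_openFace c₀ ht₀ (e a)).subset_connectedComponentIn (hx a)
        (openFace_subset_stratum c₀ (e a).2)
    have h4 : y ∈ C a := h3 (ha' ▸ hyj)
    change closure (C a) = _
    rw [connectedComponentIn_eq hyC]
    exact congrArg closure (connectedComponentIn_eq h4)
  · intro p hp
    obtain ⟨c, ρ, hρ, ht, hc⟩ := exists_positive_chart hP (hi hp)
    have hne : ∀ a, (C a ∩ c.toPartialEquiv.source).Nonempty := by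
      intro a
      have := mem_closure_iff_nhds.1 (hZC a hp) _ (c.open_source.mem_nhds c.mem_source)
      rwa [Set.inter_comm] at this
    choose ax hax y hyC hyj hcw using fun a => hchart c hc a (hne a)
    refine ⟨⟨c, ax, fun a b hab => ?_, hax, hc, hcw⟩, ρ, hρ, ht⟩
    refine hxx a b ((mem_block_iff_of_mem_component (hyC a)).1 ((hcw b _ (hyj a).1).2 ?_))
    rw [← hab]
    exact ⟨(hyj a).2.1.le, fun j' hj' h => ((hyj a).2.2 j' hj' h).le⟩

theorem exists_block_of_isFacet (hP : P.IsRegular) {k : ℕ} {Z : Set Y} (hZ : P.IsFacet k Z) :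
    ∃ i, Z ⊆ P.block i := by
  obtain ⟨p₀, hp₀, rfl⟩ := hZ
  obtain ⟨i, hi⟩ := Set.mem_iUnion.1 (P.iUnion_block ▸ Set.mem_univ p₀ : p₀ ∈ ⋃ i, P.block i)
  exact ⟨i, (closure_component_subset_block_iff hP hp₀).2 hi⟩

end CornerPartition

/-! ### Linear isomorphisms of sectors -/

theorem EuclideanSpace.map_apply_eq_sum {n : ℕ}
    (A : EuclideanSpace ℝ (Fin n) →L[ℝ] EuclideanSpace ℝ (Fin n)) (v : EuclideanSpace ℝ (Fin n))
    (l : Fin n) : A v l = ∑ j, A (EuclideanSpace.single j 1) l * v j := by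
  have h : v = ∑ j, v j • EuclideanSpace.single j (1 : ℝ) := by
    have := (EuclideanSpace.basisFun (Fin n) ℝ).sum_repr v
    simpa using this.symm
  conv_lhs => rw [h]
  rw [map_sum, WithLp.ofLp_sum, Finset.sum_apply]
  refine Finset.sum_congr rfl fun j _ => ?_
  simp [mul_comm]

/-- A linear isomorphism between (signed) sectors permutes the boundary coordinates up to positive
factors. -/
theorem exists_single_of_map_sector {n : ℕ}
    {A A' : EuclideanSpace ℝ (Fin n) →L[ℝ] EuclideanSpace ℝ (Fin n)}
    (hleft : ∀ v, A' (A v) = v) {N N' : Finset (Fin n)} {s s' : Fin n → ℝ}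
    (hs : ∀ j, s j * s j = 1) (hs' : ∀ j, s' j * s' j = 1)
    (hA : ∀ v, (∀ j ∈ N, 0 ≤ s j * v j) → ∀ l ∈ N', 0 ≤ s' l * A v l)
    (hA' : ∀ v, (∀ l ∈ N', 0 ≤ s' l * v l) → ∀ j ∈ N, 0 ≤ s j * A' v j) {j : Fin n} (hj : j ∈ N) :
    ∃ l ∈ N', 0 < s' l * s j * A (EuclideanSpace.single j 1) l ∧
      ∀ j', j' ≠ j → A (EuclideanSpace.single j' 1) l = 0 := by
  -- Rows indexed by `N'` vanish off `N`, where both signs of a basis vector are admissible, and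
  -- after the sign change are nonnegative on `N`.
  have aux : ∀ {N N' : Finset (Fin n)} {s s' : Fin n → ℝ}
      {A : EuclideanSpace ℝ (Fin n) →L[ℝ] EuclideanSpace ℝ (Fin n)}, (∀ j, s j * s j = 1) →
      (∀ j, s' j * s' j = 1) → (∀ v, (∀ j ∈ N, 0 ≤ s j * v j) → ∀ l ∈ N', 0 ≤ s' l * A v l) →
      (∀ l ∈ N', ∀ j ∉ N, A (EuclideanSpace.single j 1) l = 0) ∧
      (∀ l ∈ N', ∀ j ∈ N, 0 ≤ s' l * s j * A (EuclideanSpace.single j 1) l) := by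
    intro N N' s s' A hs hs' hA
    constructor
    · intro l hl j hj
      have h1 := hA (EuclideanSpace.single j 1) (fun j' hj' => by
        have : j' ≠ j := fun h => hj (h ▸ hj')
        simp [this]) l hl
      have h2 := hA (-EuclideanSpace.single j 1) (fun j' hj' => by
        have : j' ≠ j := fun h => hj (h ▸ hj')
        simp [this]) l hl
      rw [map_neg, PiLp.neg_apply] at h2
      have h3 : s' l * A (EuclideanSpace.single j 1) l = 0 := by linarith
      rcases mul_eq_zero.1 h3 with h | h
      · have := hs' l; rw [h] at this; simp at this
      · exact h
    · intro l hl j hj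
      have h1 := hA (s j • EuclideanSpace.single j 1) (fun j' hj' => by
        by_cases h : j' = j
        · subst h; simp [hs]
        · simp [h]) l hl
      rw [map_smul, PiLp.smul_apply, smul_eq_mul] at h1
      linarith
  obtain ⟨hA0, hA1⟩ := aux hs hs' hA
  obtain ⟨hA'0, hA'1⟩ := aux hs' hs hA'
  have hsum : ∀ j', ∑ l, A' (EuclideanSpace.single l 1) j * A (EuclideanSpace.single j' 1) l =
      if j = j' then 1 else 0 := by
    intro j'
    rw [← EuclideanSpace.map_apply_eq_sum A', hleft]
    simp
  obtain ⟨l, -, hl⟩ := Finset.exists_ne_zero_of_sum_ne_zero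
    (s := Finset.univ) (f := fun l => A' (EuclideanSpace.single l 1) j *
      A (EuclideanSpace.single j 1) l) (by rw [hsum]; simp)
  have hlN : l ∈ N' := by
    by_contra h
    exact hl (by simp [hA'0 j hj l h])
  have hne : s' l * s j * A (EuclideanSpace.single j 1) l ≠ 0 := by
    intro h
    rcases mul_eq_zero.1 h with h | h
    · rcases mul_eq_zero.1 h with h | h
      · have := hs' l; rw [h] at this; simp at this
      · have := hs j; rw [h] at this; simp at this
    · exact hl (by simp [h])
  refine ⟨l, hlN, lt_of_le_of_ne (hA1 l hlN j hj) hne.symm, fun j' hj' => ?_⟩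
  by_cases hj'N : j' ∈ N
  swap
  · exact hA0 l hlN j' hj'N
  -- An off-diagonal entry of `A' A = 1` is a vanishing sum of nonnegative terms, so each term
  -- vanishes; the factor of `A'` at `l` is nonzero by the choice of `l`.
  have h0 : ∑ m, s j * s j' * (A' (EuclideanSpace.single m 1) j *
      A (EuclideanSpace.single j' 1) m) = 0 := by
    rw [← Finset.mul_sum, hsum, if_neg (Ne.symm hj'), mul_zero]
  rw [Finset.sum_eq_zero_iff_of_nonneg] at h0
  · have h1 := h0 l (Finset.mem_univ _)
    have hsj : s j ≠ 0 := fun h => by have := hs j; rw [h] at this; simp at this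
    have hsj' : s j' ≠ 0 := fun h => by have := hs j'; rw [h] at this; simp at this
    have h2 : A' (EuclideanSpace.single l 1) j ≠ 0 := fun h => hl (by simp [h])
    simpa [hsj, hsj', h2] using h1
  · intro m _
    by_cases hm : m ∈ N'
    · have h1 := hA'1 j hj m hm
      have h2 := hA1 m hm j' hj'N
      have h3 := mul_nonneg h1 h2
      have h4 := hs' m
      have h5 : s j * s' m * A' (EuclideanSpace.single m 1) j *
        (s' m * s j' * A (EuclideanSpace.single j' 1) m) = (s' m * s' m) * (s j * s j' *
          (A' (EuclideanSpace.single m 1) j * A (EuclideanSpace.single j' 1) m)) := by ring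
      rw [h5, h4, one_mul] at h3
      exact h3
    · simp [hA'0 j hj m hm]

/-! ### Coordinate changes and tangent cones -/

namespace CornerPartition

variable {n : ℕ} {Y : Type*} [TopologicalSpace Y] [ChartedSpace (EuclideanQuadrant n) Y]
  {ι : Type*} {P : CornerPartition n Y ι}

namespace AdaptedChart

variable {p p' : Y} (c : P.AdaptedChart p) (c' : P.AdaptedChart p')

/-- The coordinate change between two charts. -/
noncomputable def transition : EuclideanSpace ℝ (Fin n) → EuclideanSpace ℝ (Fin n) :=
  fun x => c'.toPartialEquiv (c.toPartialEquiv.symm x)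

/-- The domain of the coordinate change. -/
def transitionDomain : Set (EuclideanSpace ℝ (Fin n)) :=
  c.toPartialEquiv.target ∩ c.toPartialEquiv.symm ⁻¹' c'.toPartialEquiv.source

theorem exists_transitionDomain_eq :
    ∃ O, IsOpen O ∧ c.transitionDomain c' = O ∩ sector c.bdry := by
  obtain ⟨O, hO, h⟩ := c.target_eq
  obtain ⟨u, hu, hu'⟩ := continuousOn_iff'.1 c.continuousOn_symm _ c'.open_source
  refine ⟨u ∩ O, hu.inter hO, ?_⟩
  rw [transitionDomain, Set.inter_comm, hu', h, Set.inter_assoc]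

theorem uniqueDiffOn_transitionDomain : UniqueDiffOn ℝ (c.transitionDomain c') := by
  obtain ⟨O, hO, h⟩ := c.exists_transitionDomain_eq c'
  rw [h]
  exact uniqueDiffOn_inter_sector _ hO

theorem contDiffOn_transition : ContDiffOn ℝ ∞ (c.transition c') (c.transitionDomain c') := by
  rw [← contMDiffOn_iff_contDiffOn]
  exact c'.contMDiffOn.comp (c.contMDiffOn_symm.mono Set.inter_subset_left) (fun x hx => hx.2)

theorem mapsTo_transition :
    Set.MapsTo (c.transition c') (c.transitionDomain c') (c'.transitionDomain c) := by
  rintro x ⟨hx, hx'⟩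
  refine ⟨c'.toPartialEquiv.map_source hx', ?_⟩
  simp only [transition, Set.mem_preimage]
  rw [c'.toPartialEquiv.left_inv hx']
  exact c.toPartialEquiv.map_target hx

theorem transition_transition {x : EuclideanSpace ℝ (Fin n)} (hx : x ∈ c.transitionDomain c') :
    c'.transition c (c.transition c' x) = x := by
  simp only [transition]
  rw [c'.toPartialEquiv.left_inv hx.2, c.toPartialEquiv.right_inv hx.1]

variable {c c'} {q : Y}

theorem transition_apply (hq : q ∈ c.toPartialEquiv.source) :
    c.transition c' (c.toPartialEquiv q) = c'.toPartialEquiv q := by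
  simp only [transition]
  rw [c.toPartialEquiv.left_inv hq]

theorem mem_transitionDomain (hq : q ∈ c.toPartialEquiv.source)
    (hq' : q ∈ c'.toPartialEquiv.source) : c.toPartialEquiv q ∈ c.transitionDomain c' :=
  ⟨c.toPartialEquiv.map_source hq, by
    rwa [Set.mem_preimage, c.toPartialEquiv.left_inv hq]⟩

variable (c c')

/-- The differential of the coordinate change at a point. -/
noncomputable def dtransition (q : Y) : EuclideanSpace ℝ (Fin n) →L[ℝ] EuclideanSpace ℝ (Fin n) :=
  fderivWithin ℝ (c.transition c') (c.transitionDomain c') (c.toPartialEquiv q)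

variable {c c'}

theorem hasFDerivWithinAt_transition (hq : q ∈ c.toPartialEquiv.source)
    (hq' : q ∈ c'.toPartialEquiv.source) :
    HasFDerivWithinAt (c.transition c') (c.dtransition c' q) (c.transitionDomain c')
      (c.toPartialEquiv q) :=
  ((c.contDiffOn_transition c').differentiableOn (by simp) _
    (mem_transitionDomain hq hq')).hasFDerivWithinAt

theorem dtransition_dtransition (hq : q ∈ c.toPartialEquiv.source)
    (hq' : q ∈ c'.toPartialEquiv.source) (v : EuclideanSpace ℝ (Fin n)) :
    c'.dtransition c q (c.dtransition c' q v) = v := by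
  have h1 := hasFDerivWithinAt_transition hq hq'
  have h2 := hasFDerivWithinAt_transition hq' hq
  rw [← transition_apply hq (c' := c')] at h2
  have h3 := h2.comp _ h1 (c.mapsTo_transition c')
  have h4 : HasFDerivWithinAt (c'.transition c ∘ c.transition c')
      (ContinuousLinearMap.id ℝ _) (c.transitionDomain c') (c.toPartialEquiv q) :=
    (hasFDerivWithinAt_id _ _).congr (fun x hx => c.transition_transition c' hx)
      (c.transition_transition c' (mem_transitionDomain hq hq'))
  have h5 := (c.uniqueDiffOn_transitionDomain c' _ (mem_transitionDomain hq hq')).eq h3 h4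
  exact DFunLike.congr_fun h5 v

/-- A short ray in the direction `v` stays in the block, and its image in the second chart obeys
that chart's inequalities. The differential is the limit of the difference quotients, so it points
into the block as well. -/
theorem dtransition_cone {i : ι} {s s' : Fin n → ℤˣ} (hs : ∀ q ∈ c.toPartialEquiv.source,
      (q ∈ P.block i ↔ c.toPartialEquiv q ∈ orthant c.wall s))
    (hs' : ∀ q ∈ c'.toPartialEquiv.source,
      (q ∈ P.block i ↔ c'.toPartialEquiv q ∈ orthant c'.wall s'))
    (hsb : ∀ j ∈ c.bdry, s j = 1) (hsb' : ∀ j ∈ c'.bdry, s' j = 1)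
    (hq : q ∈ c.toPartialEquiv.source) (hq' : q ∈ c'.toPartialEquiv.source) (hi : q ∈ P.block i)
    {v : EuclideanSpace ℝ (Fin n)}
    (hv : ∀ j ∈ c.bdry ∪ c.wall, c.toPartialEquiv q j = 0 → 0 ≤ (((s j : ℤˣ) : ℤ) : ℝ) * v j)
    {l : Fin n} (hl : l ∈ c'.bdry ∪ c'.wall) (hl0 : c'.toPartialEquiv q l = 0) :
    0 ≤ (((s' l : ℤˣ) : ℤ) : ℝ) * c.dtransition c' q v l := by
  have htend := c.tendsto_add_smul hq (v := v) (fun j hj h0 => by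
    have := hv j (Finset.mem_union_left _ hj) h0
    simpa [hsb j hj] using this)
  have hev := htend.eventually (c.eventually_nhdsWithin hq (c'.open_source.mem_nhds hq'))
  have hwall : ∀ᶠ t : ℝ in 𝓝[>] 0, ∀ j ∈ c.wall,
      0 ≤ (((s j : ℤˣ) : ℤ) : ℝ) * (c.toPartialEquiv q + t • v) j := by
    rw [Filter.eventually_all_finset]
    intro j hj
    have hge := (hs q hq).1 hi j hj
    rcases hge.eq_or_lt with h | h
    · have h0 : c.toPartialEquiv q j = 0 := by
        rcases mul_eq_zero.1 h.symm with h | h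
        · simp at h
        · exact h
      have := hv j (Finset.mem_union_right _ hj) h0
      filter_upwards [self_mem_nhdsWithin] with t ht
      simp only [PiLp.add_apply, PiLp.smul_apply, smul_eq_mul, h0, zero_add]
      rw [mul_left_comm]
      exact mul_nonneg (le_of_lt ht) this
    · have hcont : Continuous (fun x : EuclideanSpace ℝ (Fin n) =>
        (((s j : ℤˣ) : ℤ) : ℝ) * x j) := by fun_prop
      have := (hcont.tendsto (c.toPartialEquiv q)).comp (tendsto_nhdsWithin_iff.1 htend).1
      filter_upwards [this.eventually (lt_mem_nhds h)] with t ht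
      exact le_of_lt ht
  have hlim := (hasFDerivWithinAt_transition hq hq').lim (l := 𝓝[>] (0 : ℝ)) (c := fun t => t⁻¹)
    (d := fun t => t • v) (v := v) ?_ ?_ ?_
  · have hcont : Continuous (fun x : EuclideanSpace ℝ (Fin n) =>
        (((s' l : ℤˣ) : ℤ) : ℝ) * x l) := by fun_prop
    have hlim' := (hcont.tendsto _).comp hlim
    refine ge_of_tendsto hlim' ?_
    filter_upwards [hev, hwall, self_mem_nhdsWithin] with t h1 h2 ht
    simp only [Function.comp, PiLp.smul_apply, PiLp.sub_apply, smul_eq_mul, transition_apply hq,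
      hl0, sub_zero]
    rw [mul_left_comm]
    refine mul_nonneg (inv_nonneg.2 (le_of_lt ht)) ?_
    have h3 : c.toPartialEquiv.symm (c.toPartialEquiv q + t • v) ∈ P.block i := by
      rw [hs _ (c.toPartialEquiv.map_target h1.1), c.toPartialEquiv.right_inv h1.1]
      exact h2
    rcases Finset.mem_union.1 hl with hl | hl
    · rw [hsb' l hl]
      simpa [transition] using c'.nonneg_of_mem_bdry h1.2 hl
    · exact (hs' _ h1.2).1 h3 l hl
  · have : Continuous fun t : ℝ => t • v := by fun_prop
    simpa using this.continuousWithinAt.tendsto (x := 0) (s := Set.Ioi 0)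
  · filter_upwards [hev] with t ht
    exact ht
  · refine tendsto_const_nhds.congr' ?_
    filter_upwards [self_mem_nhdsWithin] with t ht
    rw [inv_smul_smul₀ (ne_of_gt ht)]

/-- The differential and its inverse exchange the tangent cones of one block at `q`, which are
signed sectors in the vanishing boundary and wall coordinates. -/
theorem exists_dtransition_single {i : ι} {s s' : Fin n → ℤˣ}
    (hs : ∀ q ∈ c.toPartialEquiv.source,
      (q ∈ P.block i ↔ c.toPartialEquiv q ∈ orthant c.wall s))
    (hs' : ∀ q ∈ c'.toPartialEquiv.source,
      (q ∈ P.block i ↔ c'.toPartialEquiv q ∈ orthant c'.wall s'))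
    (hsb : ∀ j ∈ c.bdry, s j = 1) (hsb' : ∀ j ∈ c'.bdry, s' j = 1)
    (hq : q ∈ c.toPartialEquiv.source) (hq' : q ∈ c'.toPartialEquiv.source) (hi : q ∈ P.block i)
    {j : Fin n} (hj : j ∈ c.bdry ∪ c.wall) (hj0 : c.toPartialEquiv q j = 0) :
    ∃ l ∈ c'.bdry ∪ c'.wall, c'.toPartialEquiv q l = 0 ∧
      0 < (((s' l : ℤˣ) : ℤ) : ℝ) * (((s j : ℤˣ) : ℤ) : ℝ) *
        c.dtransition c' q (EuclideanSpace.single j 1) l ∧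
      ∀ j', j' ≠ j → c.dtransition c' q (EuclideanSpace.single j' 1) l = 0 := by
  obtain ⟨l, hl, h1, h2⟩ := exists_single_of_map_sector
    (A := c.dtransition c' q) (A' := c'.dtransition c q)
    (N := (c.bdry ∪ c.wall).filter fun j => c.toPartialEquiv q j = 0)
    (N' := (c'.bdry ∪ c'.wall).filter fun j => c'.toPartialEquiv q j = 0)
    (s := fun j => (((s j : ℤˣ) : ℤ) : ℝ)) (s' := fun j => (((s' j : ℤˣ) : ℤ) : ℝ))
    (dtransition_dtransition hq hq')
    (fun j => cast_units_mul_self _) (fun j => cast_units_mul_self _)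
    (fun v hv l hl => dtransition_cone hs hs' hsb hsb' hq hq' hi
      (fun j hj h0 => hv j (Finset.mem_filter.2 ⟨hj, h0⟩)) (Finset.mem_filter.1 hl).1
      (Finset.mem_filter.1 hl).2)
    (fun v hv l hl => dtransition_cone hs' hs hsb' hsb hq' hq hi
      (fun j hj h0 => hv j (Finset.mem_filter.2 ⟨hj, h0⟩)) (Finset.mem_filter.1 hl).1
      (Finset.mem_filter.1 hl).2)
    (Finset.mem_filter.2 ⟨hj, hj0⟩)
  exact ⟨l, (Finset.mem_filter.1 hl).1, (Finset.mem_filter.1 hl).2, h1, h2⟩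

/-- The sign 1 on boundary coordinates lets boundary and wall inequalities be treated uniformly. -/
theorem exists_sign_bdry (c : P.AdaptedChart p) {i : ι} (hq : q ∈ c.toPartialEquiv.source)
    (hi : q ∈ P.block i) : ∃ s : Fin n → ℤˣ, (∀ q' ∈ c.toPartialEquiv.source,
      (q' ∈ P.block i ↔ c.toPartialEquiv q' ∈ orthant c.wall s)) ∧ ∀ j ∈ c.bdry, s j = 1 := by
  classical
  obtain ⟨s, hs⟩ := c.exists_sign hq hi
  refine ⟨fun j => if j ∈ c.bdry then 1 else s j, fun q' hq' => ?_, fun j hj => by simp [hj]⟩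
  rw [hs q' hq']
  refine forall₂_congr fun j hj => ?_
  simp [Finset.disjoint_right.1 c.disjoint_bdry_wall hj]

end AdaptedChart
end CornerPartition

/-! ### Comparison of the coordinates of two charts -/

namespace CornerPartition

variable {n : ℕ} {Y : Type*} [TopologicalSpace Y] [ChartedSpace (EuclideanQuadrant n) Y]
  {ι : Type*} {P : CornerPartition n Y ι}

/-- Near `p`, the function `v` has the sign of `u` and is at least of its size up to a constant. -/
def Dominates (p : Y) (u v : Y → ℝ) : Prop :=
  ∃ δ > 0, ∀ᶠ q in 𝓝 p, (0 ≤ u q → δ * u q ≤ v q) ∧ (u q ≤ 0 → v q ≤ δ * u q)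

theorem Dominates.sign_eq {p : Y} {u v : Y → ℝ} (h : Dominates p u v) :
    ∀ᶠ q in 𝓝 p, SignType.sign (v q) = SignType.sign (u q) := by
  obtain ⟨δ, hδ, h⟩ := h
  filter_upwards [h] with q hq
  rcases lt_trichotomy (u q) 0 with h | h | h
  · rw [sign_neg h, sign_neg]
    exact (hq.2 h.le).trans_lt (mul_neg_of_pos_of_neg hδ h)
  · have h1 := hq.1 h.ge
    have h2 := hq.2 h.le
    rw [h, mul_zero] at h1 h2
    rw [h, le_antisymm h2 h1]
  · rw [sign_pos h, sign_pos]
    exact (mul_pos hδ h).trans_le (hq.1 h.le)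

theorem Dominates.trans {p : Y} {u v w : Y → ℝ} (h : Dominates p u v) (h' : Dominates p v w) :
    Dominates p u w := by
  have hs := h.sign_eq
  obtain ⟨δ, hδ, h⟩ := h
  obtain ⟨δ', hδ', h'⟩ := h'
  refine ⟨δ' * δ, mul_pos hδ' hδ, ?_⟩
  filter_upwards [h, h', hs] with q h h' hs
  constructor
  · intro h0
    have h1 := h'.1 ((nonneg_iff_of_sign_eq hs).2 h0)
    have h2 := mul_le_mul_of_nonneg_left (h.1 h0) hδ'.le
    linarith
  · intro h0
    have h1 := h'.2 ((nonpos_iff_of_sign_eq hs).2 h0)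
    have h2 := mul_le_mul_of_nonneg_left (h.2 h0) hδ'.le
    linarith

theorem Dominates.refl (p : Y) (u : Y → ℝ) : Dominates p u u :=
  ⟨1, one_pos, Filter.Eventually.of_forall fun q => by simp⟩

theorem Dominates.convex {p : Y} {u v w ρ : Y → ℝ} (h : Dominates p u v) (h' : Dominates p u w)
    (hρ : ∀ q, ρ q ∈ Set.Icc (0 : ℝ) 1) :
    Dominates p u (fun q => (1 - ρ q) * v q + ρ q * w q) := by
  obtain ⟨δ, hδ, h⟩ := h
  obtain ⟨δ', hδ', h'⟩ := h'
  refine ⟨min δ δ', lt_min hδ hδ', ?_⟩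
  filter_upwards [h, h'] with q h h'
  have h0 := (hρ q).1
  have h1 := sub_nonneg.2 (hρ q).2
  constructor
  · intro hu
    have h2 : min δ δ' * u q ≤ v q :=
      (mul_le_mul_of_nonneg_right (min_le_left _ _) hu).trans (h.1 hu)
    have h3 : min δ δ' * u q ≤ w q :=
      (mul_le_mul_of_nonneg_right (min_le_right _ _) hu).trans (h'.1 hu)
    nlinarith [mul_le_mul_of_nonneg_left h2 h1, mul_le_mul_of_nonneg_left h3 h0]
  · intro hu
    have h2 : v q ≤ min δ δ' * u q :=
      (h.2 hu).trans (mul_le_mul_of_nonpos_right (min_le_left _ _) hu)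
    have h3 : w q ≤ min δ δ' * u q :=
      (h'.2 hu).trans (mul_le_mul_of_nonpos_right (min_le_right _ _) hu)
    nlinarith [mul_le_mul_of_nonneg_left h2 h1, mul_le_mul_of_nonneg_left h3 h0]

theorem Dominates.congr {p : Y} {u v v' : Y → ℝ} (h : Dominates p u v) (hv : v' =ᶠ[𝓝 p] v) :
    Dominates p u v' := by
  obtain ⟨δ, hδ, h⟩ := h
  refine ⟨δ, hδ, ?_⟩
  filter_upwards [h, hv] with q h hv
  rwa [hv]

/-- Two rows supported in the single column `j` would be proportional, which is impossible for a
surjective map. -/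
theorem _root_.EuclideanSpace.exists_ne_apply_ne_zero
    {A A' : EuclideanSpace ℝ (Fin n) →L[ℝ] EuclideanSpace ℝ (Fin n)} (hA : ∀ v, A (A' v) = v)
    {j l : Fin n} (hl : A (EuclideanSpace.single j 1) l ≠ 0)
    (h0 : ∀ j', j' ≠ j → A (EuclideanSpace.single j' 1) l = 0) {l' : Fin n} (hl' : l' ≠ l) :
    ∃ j', j' ≠ j ∧ A (EuclideanSpace.single j' 1) l' ≠ 0 := by
  by_contra! h
  have h1 : ∀ m, (∀ j', j' ≠ j → A (EuclideanSpace.single j' 1) m = 0) → ∀ v,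
      A v m = A (EuclideanSpace.single j 1) m * v j := by
    intro m hm v
    rw [EuclideanSpace.map_apply_eq_sum, Finset.sum_eq_single j]
    · intro j' _ hj'
      rw [hm j' hj', zero_mul]
    · simp
  have h2 := h1 l h0 (A' (EuclideanSpace.single l' 1))
  have h3 := h1 l' h (A' (EuclideanSpace.single l' 1))
  rw [hA] at h2 h3
  simp only [PiLp.single_apply, hl'.symm, if_false, if_true] at h2 h3
  rcases mul_eq_zero.1 h2.symm with h4 | h4
  · exact hl h4
  · rw [h4, mul_zero] at h3; exact one_ne_zero h3

namespace AdaptedChart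

variable {p : Y} (c c' : P.AdaptedChart p)

/-- The boundary and wall coordinates of two adapted charts at a point correspond to each other. -/
theorem exists_dominates {i : ι} (hi : p ∈ P.block i)
    (hc : ∀ q ∈ c.toPartialEquiv.source,
      (q ∈ P.block i ↔ ∀ j ∈ c.wall, 0 ≤ c.toPartialEquiv q j))
    (hc' : ∀ q ∈ c'.toPartialEquiv.source,
      (q ∈ P.block i ↔ ∀ j ∈ c'.wall, 0 ≤ c'.toPartialEquiv q j))
    {j : Fin n} (hj : j ∈ c.bdry ∪ c.wall) :
    ∃ l ∈ c'.bdry ∪ c'.wall,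
      Dominates p (fun q => c.toPartialEquiv q j) (fun q => c'.toPartialEquiv q l) := by
  obtain ⟨l, hl, -, ha, h0⟩ := exists_dtransition_single (c := c) (c' := c') (s := 1) (s' := 1)
    (i := i) (fun q hq => by simp [hc q hq, orthant]) (fun q hq => by simp [hc' q hq, orthant])
    (fun _ _ => rfl) (fun _ _ => rfl) c.mem_source c'.mem_source hi hj (by simp [c.map_base])
  refine ⟨l, hl, ?_⟩
  simp only [Pi.one_apply, Units.val_one, Int.cast_one, one_mul] at ha
  set g := c.transition c' with hg
  obtain ⟨O, hO, hD⟩ := c.exists_transitionDomain_eq c'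
  have h0D : (0 : EuclideanSpace ℝ (Fin n)) ∈ c.transitionDomain c' := by
    rw [← c.map_base]; exact mem_transitionDomain c.mem_source c'.mem_source
  have hT0 : c.dtransition c' p = fderivWithin ℝ g (c.transitionDomain c') 0 := by
    rw [dtransition, c.map_base]
  -- near `p` the coordinate `l` of the second chart vanishes where the coordinate `j` does
  have hcol : ∀ l' ∈ Finset.univ.filter (fun l' => l' ≠ l), ∃ j', j' ≠ j ∧
      c.dtransition c' p (EuclideanSpace.single j' 1) l' ≠ 0 := fun l' hl' =>
    EuclideanSpace.exists_ne_apply_ne_zero (dtransition_dtransition c'.mem_source c.mem_source)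
      ha.ne' h0 (Finset.mem_filter.1 hl').2
  have hev : ∀ᶠ x in 𝓝[c.transitionDomain c'] (0 : EuclideanSpace ℝ (Fin n)), ∀ l' ∈
      Finset.univ.filter (fun l' => l' ≠ l), ∃ j', j' ≠ j ∧
      fderivWithin ℝ g (c.transitionDomain c') x (EuclideanSpace.single j' 1) l' ≠ 0 := by
    rw [Filter.eventually_all_finset]
    intro l' hl'
    obtain ⟨j', hj', hne⟩ := hcol l' hl'
    have h1 := (c.contDiffOn_transition c').continuousOn_fderivWithin
      (c.uniqueDiffOn_transitionDomain c') (by simp) 0 h0D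
    have h2 : Continuous fun A : EuclideanSpace ℝ (Fin n) →L[ℝ] EuclideanSpace ℝ (Fin n) =>
        A (EuclideanSpace.single j' 1) l' := by fun_prop
    have h3 := h2.continuousAt.tendsto.comp h1.tendsto
    rw [hT0] at hne
    filter_upwards [h3.eventually (isOpen_ne.mem_nhds hne)] with x hx
    exact ⟨j', hj', hx⟩
  have hvan : ∀ᶠ x in 𝓝[c.transitionDomain c'] (0 : EuclideanSpace ℝ (Fin n)),
      x j = 0 → g x l = 0 := by
    filter_upwards [hev, self_mem_nhdsWithin] with x hx hxD hxj
    set q := c.toPartialEquiv.symm x with hq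
    have hqs : q ∈ c.toPartialEquiv.source := c.toPartialEquiv.map_target hxD.1
    have hqx : c.toPartialEquiv q = x := c.toPartialEquiv.right_inv hxD.1
    obtain ⟨i', hi'⟩ := Set.mem_iUnion.1
      (P.iUnion_block ▸ Set.mem_univ q : q ∈ ⋃ i, P.block i)
    obtain ⟨s, hs, hsb⟩ := c.exists_sign_bdry hqs hi'
    obtain ⟨s', hs', hsb'⟩ := c'.exists_sign_bdry hxD.2 hi'
    obtain ⟨l', -, h1, -, h3⟩ := exists_dtransition_single hs hs' hsb hsb' hqs hxD.2 hi' hj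
      (by rw [hqx]; exact hxj)
    -- The cone argument at the nearby point `q` yields some row supported in column `j`. By
    -- continuity of the derivative every row other than `l` has a nonzero entry off that column.
    have hll' : l' = l := by
      by_contra hne
      obtain ⟨j', hj', hne'⟩ := hx l' (by simp [hne])
      apply hne'
      have := h3 j' hj'
      rwa [dtransition, hqx] at this
    rw [← hll']
    exact h1
  set a := c.dtransition c' p (EuclideanSpace.single j 1) l with hadef
  rw [hD] at hvan hT0
  rw [nhdsWithin_inter_of_mem (mem_nhdsWithin_of_mem_nhds (hO.mem_nhds (hD ▸ h0D : _ ∈ O ∩ _).1)),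
    Metric.nhdsWithin_basis_ball.eventually_iff] at hvan
  obtain ⟨δ₁, hδ₁, hvan⟩ := hvan
  -- An approximation error of `a / 2` leaves at least half of the slope `a`.
  obtain ⟨b, hb⟩ : ∃ b : NNReal, (b : ℝ) = a / 2 := ⟨⟨a / 2, by positivity⟩, rfl⟩
  obtain ⟨δ₂, hδ₂, hδ₂O, -, happ⟩ := exists_approximatesLinearOn (convex_sector c.bdry) hO
    (hD ▸ c.uniqueDiffOn_transitionDomain c') (hD ▸ c.contDiffOn_transition c') (hD ▸ h0D)
    (c := b) (by rw [← NNReal.coe_pos, hb]; exact half_pos ha)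
  rw [← hg, ← hT0] at happ
  refine ⟨a / 2, half_pos ha, ?_⟩
  have hball : ∀ᶠ q in 𝓝 p, c.toPartialEquiv q ∈ Metric.ball 0 (min δ₁ δ₂) := by
    have := c.continuousAt c.mem_source
    refine this.eventually_mem ?_
    rw [c.map_base]
    exact Metric.ball_mem_nhds _ (lt_min hδ₁ hδ₂)
  filter_upwards [hball, c.open_source.mem_nhds c.mem_source] with q hqb hqs
  set x := c.toPartialEquiv q with hx
  have hgx : c'.toPartialEquiv q = g x := (transition_apply hqs).symm
  have hxs : x ∈ sector c.bdry := c.target_subset (c.toPartialEquiv.map_source hqs)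
  -- The comparison point is the projection to the hyperplane, where the coordinate `l` of `g`
  -- vanishes; thus `g x l` is governed by `a * x j` alone.
  set y := x - x j • EuclideanSpace.single j (1 : ℝ) with hy
  have hyj : ∀ m, y m = if m = j then 0 else x m := by
    intro m
    by_cases h : m = j
    · subst h; simp [hy]
    · simp [hy, h]
  have hys : y ∈ sector c.bdry := fun m hm => by
    rw [hyj]; split_ifs
    · exact le_rfl
    · exact hxs m hm
  have hyn : ‖y‖ ≤ ‖x‖ := by
    rw [EuclideanSpace.norm_eq, EuclideanSpace.norm_eq]
    refine Real.sqrt_le_sqrt (Finset.sum_le_sum fun m _ => ?_)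
    rw [hyj]
    split_ifs
    · simp [sq_nonneg]
    · exact le_rfl
  rw [mem_ball_zero_iff] at hqb
  have hgy : g y l = 0 := hvan
    ⟨mem_ball_zero_iff.2 (hyn.trans_lt (hqb.trans_le (min_le_left _ _))), hys⟩ (by simp [hyj])
  have h1 := happ x ⟨mem_ball_zero_iff.2 (hqb.trans_le (min_le_right _ _)), hxs⟩ y
    ⟨mem_ball_zero_iff.2 (hyn.trans_lt (hqb.trans_le (min_le_right _ _))), hys⟩
  have hxy : x - y = x j • EuclideanSpace.single j (1 : ℝ) := by rw [hy]; abel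
  have h2 := (PiLp.norm_apply_le (g x - g y - c.dtransition c' p (x - y)) l).trans h1
  rw [hxy, map_smul, norm_smul] at h2
  simp only [PiLp.sub_apply, PiLp.smul_apply, smul_eq_mul, hgy, ← hadef, hb, sub_zero,
    PiLp.norm_single, norm_one, mul_one, Real.norm_eq_abs] at h2
  rw [hgx]
  rw [abs_le] at h2
  constructor
  · intro h
    rw [abs_of_nonneg h] at h2
    linarith [h2.1]
  · intro h
    rw [abs_of_nonpos h] at h2
    linarith [h2.2]

end AdaptedChart
end CornerPartition

/-! ### Tubular pairs and their independence of the chart -/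

namespace CornerPartition

variable {n : ℕ} {Y : Type*} [TopologicalSpace Y] [ChartedSpace (EuclideanQuadrant n) Y]
  {ι : Type*} {P : CornerPartition n Y ι} {k : ℕ} {i : ι} {w : Fin k → ι} {p : Y}

namespace FramedChart

theorem base_mem_block (c : P.FramedChart i w p) : p ∈ P.block i :=
  (c.mem_block_iff p c.mem_source).2 fun j _ => by simp [c.map_base]

theorem axis_eq_zero (c : P.FramedChart i w p) {q : Y} (hq : q ∈ c.toPartialEquiv.source)
    (hi : q ∈ P.block i) {a : Fin k} (hw : q ∈ P.block (w a)) :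
    c.toPartialEquiv q (c.axis a) = 0 :=
  le_antisymm ((c.mem_block_axis_iff a q hq).1 hw).1
    ((c.mem_block_iff q hq).1 hi _ (c.axis_mem a))

/-- The translation of a framed chart to another point of the facet. -/
noncomputable def recenter (c : P.FramedChart i w p) {q : Y} (hq : q ∈ c.toPartialEquiv.source)
    (hi : q ∈ P.block i) (hw : ∀ a, q ∈ P.block (w a)) : P.FramedChart i w q where
  toAdaptedChart := c.toAdaptedChart.recenter hq 1 (fun _ _ => rfl) isOpen_univ (Set.mem_univ _)
  axis := c.axis
  axis_injective := c.axis_injective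
  axis_mem a := Finset.mem_filter.2 ⟨c.axis_mem a, c.axis_eq_zero hq hi (hw a)⟩
  mem_block_iff q' hq' := by
    rw [AdaptedChart.mem_recenter_source] at hq'
    rw [c.mem_block_iff q' hq'.1]
    simp only [AdaptedChart.recenter_wall, AdaptedChart.recenter_apply, flip_one, PiLp.sub_apply,
      Finset.mem_filter]
    constructor
    · rintro h j ⟨hj, h0⟩
      simpa [h0] using h j hj
    · intro h j hj
      by_cases h0 : c.toPartialEquiv q j = 0
      · simpa [h0] using h j ⟨hj, h0⟩
      · have := hq'.2.2 j (Finset.mem_union_right _ hj) h0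
        exact (pos_of_mul_pos_right this ((c.mem_block_iff q hq).1 hi j hj)).le
  mem_block_axis_iff a q' hq' := by
    rw [AdaptedChart.mem_recenter_source] at hq'
    rw [c.mem_block_axis_iff a q' hq'.1]
    simp only [AdaptedChart.recenter_wall, AdaptedChart.recenter_apply, flip_one, PiLp.sub_apply,
      Finset.mem_filter, c.axis_eq_zero hq hi (hw a), sub_zero]
    refine and_congr_right fun _ => ?_
    constructor
    · rintro h j ⟨hj, h0⟩ hne
      simpa [h0] using h j hj hne
    · intro h j hj hne
      by_cases h0 : c.toPartialEquiv q j = 0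
      · simpa [h0] using h j ⟨hj, h0⟩ hne
      · have := hq'.2.2 j (Finset.mem_union_right _ hj) h0
        exact (pos_of_mul_pos_right this ((c.mem_block_iff q hq).1 hi j hj)).le

section recenter

variable (c : P.FramedChart i w p) {q : Y} (hq : q ∈ c.toPartialEquiv.source)
    (hi : q ∈ P.block i) (hw : ∀ a, q ∈ P.block (w a))

theorem recenter_axis : (c.recenter hq hi hw).axis = c.axis := rfl

theorem recenter_apply (x : Y) : (c.recenter hq hi hw).toPartialEquiv x =
    c.toPartialEquiv x - c.toPartialEquiv q := by
  exact (c.toAdaptedChart.recenter_apply hq 1 (fun _ _ => rfl) isOpen_univ (Set.mem_univ _) x).trans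
    (flip_one _)

theorem mem_recenter_bdry_union_wall {j : Fin n} :
    j ∈ (c.recenter hq hi hw).bdry ∪ (c.recenter hq hi hw).wall ↔
      j ∈ c.bdry ∪ c.wall ∧ c.toPartialEquiv q j = 0 := by
  change j ∈ Finset.filter _ _ ∪ Finset.filter _ _ ↔ _
  rw [← Finset.filter_union, Finset.mem_filter]

end recenter

/-- The blocks pin down the labels. At a point of `w a` where only the axis `a` is negative, the
coordinate `l` is negative too, and in the second chart only its axis `a` can be negative on `w a`.
-/
theorem axis_eq_of_sign_eq (c c' : P.FramedChart i w p) {j l : Fin n}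
    (hl : l ∈ c'.bdry ∪ c'.wall)
    (hs : ∀ᶠ q in 𝓝 p, SignType.sign (c.toPartialEquiv q j) =
      SignType.sign (c'.toPartialEquiv q l)) {a : Fin k} (ha : j = c.axis a) : l = c'.axis a := by
  have hU := hs.and (c'.open_source.mem_nhds c'.mem_source)
  obtain ⟨t, ht, q, ⟨hq1, hq2⟩, hq, hcq⟩ := c.exists_add_smul c.mem_source hU
    (v := WithLp.toLp 2 fun m => if m = c.axis a then -1 else 1) (fun m hm _ => by
      have : m ≠ c.axis a := by
        rintro rfl
        exact Finset.disjoint_left.1 c.disjoint_bdry_wall hm (c.axis_mem a)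
      simp [this])
  rw [c.map_base, zero_add] at hcq
  have hblock : q ∈ P.block (w a) := by
    rw [c.mem_block_axis_iff a q hq, hcq]
    refine ⟨by simp [ht.le], fun m hm hne => by simp [hne, ht.le]⟩
  have hneg : c'.toPartialEquiv q l < 0 := by
    rw [← sign_eq_neg_one_iff, ← hq1, sign_eq_neg_one_iff, hcq, ha]
    simp [ht]
  by_contra hne
  rcases Finset.mem_union.1 hl with h | h
  · exact absurd (c'.nonneg_of_mem_bdry hq2 h) (not_le.2 hneg)
  · exact absurd (((c'.mem_block_axis_iff a q hq2).1 hblock).2 l h hne) (not_le.2 hneg)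

/-- In the chart, `r` is a retraction onto the plane where the axis coordinates vanish that
preserves the other faces, and the components of `f` are defining functions of the walls. -/
structure IsTubular (c : P.FramedChart i w p) (r : Y → Y) (f : Y → Fin k → ℝ) : Prop where
  axis_zero : ∀ᶠ q in 𝓝 p, ∀ a, c.toPartialEquiv (r q) (c.axis a) = 0
  fixed : ∀ᶠ q in 𝓝 p, (∀ a, c.toPartialEquiv q (c.axis a) = 0) → r q = q
  sign_eq : ∀ j ∈ c.bdry ∪ c.wall, (∀ a, j ≠ c.axis a) → ∀ᶠ q in 𝓝 p,
    SignType.sign (c.toPartialEquiv (r q) j) = SignType.sign (c.toPartialEquiv q j)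
  dominates : ∀ a, Dominates p (fun q => c.toPartialEquiv q (c.axis a)) (fun q => f q a)

theorem IsTubular.base_fixed {c : P.FramedChart i w p} {r : Y → Y} {f : Y → Fin k → ℝ}
    (h : c.IsTubular r f) : r p = p :=
  h.fixed.self_of_nhds fun a => by simp [c.map_base]

/-- Each boundary or wall coordinate of one chart has a counterpart in the other with the same sign
near `p`, axes matching axes. Every condition speaks of signs or of domination only; since `r` fixes
`p` and is continuous there, signs can also be compared at `r q`. -/
theorem IsTubular.of_chart {c : P.FramedChart i w p} {r : Y → Y} {f : Y → Fin k → ℝ}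
    (h : c.IsTubular r f) (hr : ContinuousAt r p) (c' : P.FramedChart i w p) :
    c'.IsTubular r f := by
  have hrt : Filter.Tendsto r (𝓝 p) (𝓝 p) := by
    have := hr.tendsto
    rwa [h.base_fixed] at this
  have key : ∀ l ∈ c'.bdry ∪ c'.wall, ∃ j ∈ c.bdry ∪ c.wall,
      Dominates p (fun q => c'.toPartialEquiv q l) (fun q => c.toPartialEquiv q j) ∧
      (∀ᶠ q in 𝓝 p, SignType.sign (c.toPartialEquiv q j) =
        SignType.sign (c'.toPartialEquiv q l)) ∧ (∀ a, l = c'.axis a → j = c.axis a) ∧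
        ∀ a, j = c.axis a → l = c'.axis a := by
    intro l hl
    obtain ⟨j, hj, hd⟩ := c'.toAdaptedChart.exists_dominates c.toAdaptedChart c.base_mem_block
      c'.mem_block_iff c.mem_block_iff hl
    refine ⟨j, hj, hd, hd.sign_eq, fun a => ?_, fun a => ?_⟩
    · exact axis_eq_of_sign_eq c' c hj (hd.sign_eq.mono fun q hq => hq.symm)
    · exact axis_eq_of_sign_eq c c' hl hd.sign_eq
  have hzero : ∀ a, ∀ᶠ q in 𝓝 p, (c'.toPartialEquiv q (c'.axis a) = 0 ↔
      c.toPartialEquiv q (c.axis a) = 0) := by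
    intro a
    obtain ⟨j, -, -, hs, hja, -⟩ := key _ (Finset.mem_union_right _ (c'.axis_mem a))
    rw [hja a rfl] at hs
    exact hs.mono fun q hq => (eq_zero_iff_of_sign_eq hq).symm
  rw [← Filter.eventually_all] at hzero
  refine ⟨?_, ?_, ?_, ?_⟩
  · filter_upwards [h.axis_zero, hrt.eventually hzero] with q h1 h2 a
    exact (h2 a).2 (h1 a)
  · filter_upwards [h.fixed, hzero] with q h1 h2 h3
    exact h1 fun a => (h2 a).1 (h3 a)
  · intro l hl hne
    obtain ⟨j, hj, -, hs, -, hja⟩ := key l hl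
    filter_upwards [hs, hrt.eventually hs, h.sign_eq j hj fun a ha => hne a (hja a ha)]
      with q h1 h2 h3
    rw [← h2, h3, h1]
  · intro a
    obtain ⟨j, -, hd, -, hja, -⟩ := key _ (Finset.mem_union_right _ (c'.axis_mem a))
    rw [hja a rfl] at hd
    exact hd.trans (h.dominates a)

end FramedChart

/-- `(r, f)` is smooth near `p` and of tubular form in some framed chart at `p`. -/
def IsTubularAt (P : CornerPartition n Y ι) (i : ι) (w : Fin k → ι) (r : Y → Y)
    (f : Y → Fin k → ℝ) (p : Y) : Prop :=
  (∀ᶠ q in 𝓝 p, ContMDiffAt (cornersModel n) (cornersModel n) ∞ r q ∧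
    ContMDiffAt (cornersModel n) 𝓘(ℝ, Fin k → ℝ) ∞ f q) ∧
  ∃ c : P.FramedChart i w p, c.IsTubular r f

theorem IsTubularAt.isTubular {r : Y → Y} {f : Y → Fin k → ℝ} (h : P.IsTubularAt i w r f p)
    (c : P.FramedChart i w p) : c.IsTubular r f := by
  obtain ⟨h1, c', h2⟩ := h
  exact h2.of_chart h1.self_of_nhds.1.continuousAt c

theorem IsTubularAt.fixed {r : Y → Y} {f : Y → Fin k → ℝ} (h : P.IsTubularAt i w r f p) :
    r p = p := by
  obtain ⟨-, c', h2⟩ := h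
  exact h2.base_fixed

theorem IsTubularAt.tendsto {r : Y → Y} {f : Y → Fin k → ℝ} (h : P.IsTubularAt i w r f p) :
    Filter.Tendsto r (𝓝 p) (𝓝 p) := by
  have := h.1.self_of_nhds.1.continuousAt.tendsto
  rwa [h.fixed] at this

theorem IsTubularAt.congr {r r' : Y → Y} {f f' : Y → Fin k → ℝ} (h : P.IsTubularAt i w r f p)
    (hr : r' =ᶠ[𝓝 p] r) (hf : f' =ᶠ[𝓝 p] f) : P.IsTubularAt i w r' f' p := by
  obtain ⟨h1, c, h2⟩ := h
  refine ⟨?_, c, ?_, ?_, ?_, ?_⟩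
  · filter_upwards [h1, hr.eventuallyEq_nhds, hf.eventuallyEq_nhds] with q h1 hr hf
    exact ⟨h1.1.congr_of_eventuallyEq hr, h1.2.congr_of_eventuallyEq hf⟩
  · filter_upwards [h2.axis_zero, hr] with q h hr
    rwa [hr]
  · filter_upwards [h2.fixed, hr] with q h hr
    rwa [hr]
  · intro j hj hne
    filter_upwards [h2.sign_eq j hj hne, hr] with q h hr
    rwa [hr]
  · intro a
    refine (h2.dominates a).congr ?_
    filter_upwards [hf] with q hf
    rw [hf]

/-- A criterion for `(c⁻¹ ∘ y, f)` to be of tubular form at a point of the domain of `c`. -/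
theorem FramedChart.isTubularAt_of_coords (c : P.FramedChart i w p) {q₀ : Y}
    (hq₀ : q₀ ∈ c.toPartialEquiv.source) (hi : q₀ ∈ P.block i) (hw : ∀ a, q₀ ∈ P.block (w a))
    {y : Y → EuclideanSpace ℝ (Fin n)} {f : Y → Fin k → ℝ}
    (hy : ∀ᶠ q in 𝓝 q₀,
      ContMDiffAt (cornersModel n) 𝓘(ℝ, EuclideanSpace ℝ (Fin n)) ∞ y q)
    (hyt : ∀ᶠ q in 𝓝 q₀, y q ∈ c.toPartialEquiv.target)
    (hya : ∀ᶠ q in 𝓝 q₀, ∀ a, y q (c.axis a) = 0)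
    (hyf : ∀ᶠ q in 𝓝 q₀, (∀ a, c.toPartialEquiv q (c.axis a) = 0) → y q = c.toPartialEquiv q)
    (hys : ∀ j ∈ c.bdry ∪ c.wall, c.toPartialEquiv q₀ j = 0 → (∀ a, j ≠ c.axis a) →
      ∀ᶠ q in 𝓝 q₀, SignType.sign (y q j) = SignType.sign (c.toPartialEquiv q j))
    (hf : ∀ᶠ q in 𝓝 q₀, ContMDiffAt (cornersModel n) 𝓘(ℝ, Fin k → ℝ) ∞ f q)
    (hfd : ∀ a, Dominates q₀ (fun q => c.toPartialEquiv q (c.axis a)) (fun q => f q a)) :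
    P.IsTubularAt i w (fun q => c.toPartialEquiv.symm (y q)) f q₀ := by
  refine ⟨?_, c.recenter hq₀ hi hw, ?_, ?_, ?_, ?_⟩
  · filter_upwards [hy, hyt.eventually_nhds, hf] with q h1 h2 h3
    refine ⟨?_, h3⟩
    have h4 := c.contMDiffOn_symm _ h2.self_of_nhds
    exact (ContMDiffWithinAt.comp q (s := y ⁻¹' c.toPartialEquiv.target) h4
      h1.contMDiffWithinAt (fun x hx => hx)).contMDiffAt h2
  · filter_upwards [hyt, hya] with q h1 h2 a
    rw [c.recenter_apply, c.recenter_axis, c.toPartialEquiv.right_inv h1]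
    simp [h2 a, c.axis_eq_zero hq₀ hi (hw a)]
  · filter_upwards [hyf, c.open_source.mem_nhds hq₀] with q h1 hq h2
    rw [h1, c.toPartialEquiv.left_inv hq]
    intro a
    have := h2 a
    rw [c.recenter_apply, c.recenter_axis] at this
    simpa [c.axis_eq_zero hq₀ hi (hw a)] using this
  · intro j hj hne
    rw [c.mem_recenter_bdry_union_wall] at hj
    filter_upwards [hyt, hys j hj.1 hj.2 hne] with q h1 h2
    rw [c.recenter_apply, c.recenter_apply, c.toPartialEquiv.right_inv h1]
    simpa [hj.2] using h2
  · intro a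
    have : ∀ q, (c.recenter hq₀ hi hw).toPartialEquiv q ((c.recenter hq₀ hi hw).axis a) =
        c.toPartialEquiv q (c.axis a) := fun q => by
      rw [c.recenter_apply, c.recenter_axis]
      simp [c.axis_eq_zero hq₀ hi (hw a)]
    simp only [this]
    exact hfd a

end CornerPartition

/-! ### Gluing tubular pairs -/

namespace CornerPartition

variable {n : ℕ} {Y : Type*} [TopologicalSpace Y] [ChartedSpace (EuclideanQuadrant n) Y]
  {ι : Type*} {P : CornerPartition n Y ι} {k : ℕ} {i : ι} {w : Fin k → ι} {p : Y}

namespace FramedChart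

open Classical in
/-- The projection onto the plane where the axis coordinates vanish. -/
noncomputable def proj (c : P.FramedChart i w p) (x : EuclideanSpace ℝ (Fin n)) :
    EuclideanSpace ℝ (Fin n) := WithLp.toLp 2 fun j => if ∃ a, j = c.axis a then 0 else x j

variable (c : P.FramedChart i w p)

theorem proj_axis (x : EuclideanSpace ℝ (Fin n)) (a : Fin k) : c.proj x (c.axis a) = 0 := by
  simp [proj]

theorem proj_of_ne (x : EuclideanSpace ℝ (Fin n)) {j : Fin n} (h : ∀ a, j ≠ c.axis a) :
    c.proj x j = x j := by
  have : ¬ ∃ a, j = c.axis a := by push Not; exact h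
  simp [proj, this]

theorem proj_eq_self {x : EuclideanSpace ℝ (Fin n)} (h : ∀ a, x (c.axis a) = 0) :
    c.proj x = x := by
  ext j
  by_cases hj : ∃ a, j = c.axis a
  · obtain ⟨a, rfl⟩ := hj
    rw [proj_axis, h]
  · push Not at hj
    exact c.proj_of_ne x hj

theorem contDiff_proj : ContDiff ℝ ∞ c.proj := by
  rw [contDiff_euclidean]
  intro j
  by_cases hj : ∃ a, j = c.axis a
  · obtain ⟨a, rfl⟩ := hj
    simp only [proj_axis]
    exact contDiff_const
  · push Not at hj
    simp only [c.proj_of_ne _ hj]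
    fun_prop

theorem norm_proj_le (x : EuclideanSpace ℝ (Fin n)) : ‖c.proj x‖ ≤ ‖x‖ := by
  rw [EuclideanSpace.norm_eq, EuclideanSpace.norm_eq]
  refine Real.sqrt_le_sqrt (Finset.sum_le_sum fun j _ => ?_)
  by_cases hj : ∃ a, j = c.axis a
  · obtain ⟨a, rfl⟩ := hj
    rw [proj_axis]
    simp [sq_nonneg]
  · push Not at hj
    rw [c.proj_of_ne _ hj]

theorem proj_mem_sector {x : EuclideanSpace ℝ (Fin n)} (hx : x ∈ sector c.bdry) :
    c.proj x ∈ sector c.bdry := by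
  intro j hj
  by_cases hj' : ∃ a, j = c.axis a
  · obtain ⟨a, rfl⟩ := hj'
    rw [proj_axis]
  · push Not at hj'
    rw [c.proj_of_ne _ hj']
    exact hx j hj

theorem proj_mem_target {ρ₀ : ℝ}
    (ht : c.toPartialEquiv.target = Metric.ball 0 ρ₀ ∩ sector c.bdry) {x : EuclideanSpace ℝ (Fin n)} (hx : x ∈ c.toPartialEquiv.target) :
    c.proj x ∈ c.toPartialEquiv.target := by
  rw [ht] at hx ⊢
  exact ⟨mem_ball_zero_iff.2 ((c.norm_proj_le x).trans_lt (mem_ball_zero_iff.1 hx.1)),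
    c.proj_mem_sector hx.2⟩

theorem convex_target {ρ₀ : ℝ}
    (ht : c.toPartialEquiv.target = Metric.ball 0 ρ₀ ∩ sector c.bdry) : Convex ℝ c.toPartialEquiv.target := by
  rw [ht]
  exact (convex_ball _ _).inter (convex_sector _)


theorem contMDiffAt {q : Y} (hq : q ∈ c.toPartialEquiv.source) :
    ContMDiffAt (cornersModel n) 𝓘(ℝ, EuclideanSpace ℝ (Fin n)) ∞ c.toPartialEquiv q :=
  c.contMDiffOn.contMDiffAt (c.open_source.mem_nhds hq)

theorem contMDiffAt_axis {q : Y} (hq : q ∈ c.toPartialEquiv.source) :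
    ContMDiffAt (cornersModel n) 𝓘(ℝ, Fin k → ℝ) ∞ (fun q a => c.toPartialEquiv q (c.axis a)) q := by
  have h : ContDiff ℝ ∞ (fun (x : EuclideanSpace ℝ (Fin n)) (a : Fin k) => x (c.axis a)) := by
    fun_prop
  exact (h.contMDiff.contMDiffAt).comp q (c.contMDiffAt hq)

/-- The local model that the bump functions glue: coordinate projection together with the axis
coordinates. -/
theorem isTubularAt_proj {ρ₀ : ℝ}
    (ht : c.toPartialEquiv.target = Metric.ball 0 ρ₀ ∩ sector c.bdry) {q : Y}
    (hq : q ∈ c.toPartialEquiv.source) (hi : q ∈ P.block i) (hw : ∀ a, q ∈ P.block (w a)) :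
    P.IsTubularAt i w (fun q => c.toPartialEquiv.symm (c.proj (c.toPartialEquiv q)))
      (fun q a => c.toPartialEquiv q (c.axis a)) q := by
  have hs := c.open_source.mem_nhds hq
  refine c.isTubularAt_of_coords hq hi hw ?_ ?_ ?_ ?_ ?_ ?_ ?_
  · filter_upwards [hs] with x hx
    exact (c.contDiff_proj.contMDiff.contMDiffAt).comp x (c.contMDiffAt hx)
  · filter_upwards [hs] with x hx
    exact c.proj_mem_target ht (c.toPartialEquiv.map_source hx)
  · exact Filter.Eventually.of_forall fun x a => c.proj_axis _ a
  · exact Filter.Eventually.of_forall fun x hx => c.proj_eq_self hx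
  · exact fun j _ _ hne => Filter.Eventually.of_forall fun x => by rw [c.proj_of_ne _ hne]
  · filter_upwards [hs] with x hx
    exact c.contMDiffAt_axis hx
  · exact fun a => Dominates.refl _ _

theorem sign_convex {a b t : ℝ} (ht : t ∈ Set.Icc (0 : ℝ) 1)
    (h : SignType.sign a = SignType.sign b) :
    SignType.sign ((1 - t) * a + t * b) = SignType.sign b := by
  have h0 := ht.1
  have h1 := sub_nonneg.2 ht.2
  rcases lt_trichotomy b 0 with hb | hb | hb
  · rw [sign_neg hb, sign_eq_neg_one_iff] at h
    rw [sign_neg hb, sign_neg]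
    rcases h0.eq_or_lt with rfl | h0
    · simpa using h
    · have := mul_neg_of_pos_of_neg h0 hb
      have := mul_nonpos_of_nonneg_of_nonpos h1 h.le
      linarith
  · subst hb
    rw [sign_zero, sign_eq_zero_iff] at h
    simp [h]
  · rw [sign_pos hb, sign_eq_one_iff] at h
    rw [sign_pos hb, sign_pos]
    rcases h0.eq_or_lt with rfl | h0
    · simpa using h
    · have := mul_pos h0 hb
      have := mul_nonneg h1 h.le
      linarith

/-- After expressing the given pair in the recentred chart, all conditions are convex: the target is
convex, and numbers of equal sign have convex combinations of that sign. -/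
theorem isTubularAt_convex {ρ₀ : ℝ}
    (ht : c.toPartialEquiv.target = Metric.ball 0 ρ₀ ∩ sector c.bdry) {q : Y}
    (hq : q ∈ c.toPartialEquiv.source) (hi : q ∈ P.block i) (hw : ∀ a, q ∈ P.block (w a))
    {ρ : Y → ℝ} (hρ : ContMDiff (cornersModel n) 𝓘(ℝ) ∞ ρ) (hρ01 : ∀ q, ρ q ∈ Set.Icc (0 : ℝ) 1)
    {r : Y → Y} {f : Y → Fin k → ℝ} (h : P.IsTubularAt i w r f q) :
    P.IsTubularAt i w (fun q => c.toPartialEquiv.symm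
        ((1 - ρ q) • c.toPartialEquiv (r q) + ρ q • c.proj (c.toPartialEquiv q)))
      (fun q a => (1 - ρ q) * f q a + ρ q * c.toPartialEquiv q (c.axis a)) q := by
  have hs := c.open_source.mem_nhds hq
  have hrs : ∀ᶠ x in 𝓝 q, r x ∈ c.toPartialEquiv.source := h.tendsto.eventually_mem hs
  have hrec := h.isTubular (c.recenter hq hi hw)
  have haxis : ∀ x a, (c.recenter hq hi hw).toPartialEquiv x ((c.recenter hq hi hw).axis a) =
        c.toPartialEquiv x (c.axis a) := fun x a => by
      rw [c.recenter_apply, c.recenter_axis]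
      simp [c.axis_eq_zero hq hi (hw a)]
  have hρ' : ContMDiff (cornersModel n) 𝓘(ℝ) ∞ fun x => 1 - ρ x := contMDiff_const.sub hρ
  refine c.isTubularAt_of_coords hq hi hw ?_ ?_ ?_ ?_ ?_ ?_ ?_
  · filter_upwards [hs, hrs, h.1] with x hx hrx hsm
    refine ContMDiffAt.add (ContMDiffAt.smul (hρ' x) ?_) (ContMDiffAt.smul (hρ x) ?_)
    · exact (c.contMDiffAt hrx).comp x hsm.1
    · exact (c.contDiff_proj.contMDiff.contMDiffAt).comp x (c.contMDiffAt hx)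
  · filter_upwards [hs, hrs] with x hx hrx
    exact c.convex_target ht (c.toPartialEquiv.map_source hrx)
      (c.proj_mem_target ht (c.toPartialEquiv.map_source hx)) (sub_nonneg.2 (hρ01 x).2)
      (hρ01 x).1 (by ring)
  · filter_upwards [hrec.axis_zero] with x hx a
    have := hx a
    rw [haxis] at this
    simp [this, c.proj_axis]
  · filter_upwards [hrec.fixed] with x hx h0
    simp only [haxis] at hx
    rw [hx h0, c.proj_eq_self h0, ← add_smul]
    simp
  · intro j hj h0 hne
    filter_upwards [hrec.sign_eq j ((c.mem_recenter_bdry_union_wall hq hi hw).2 ⟨hj, h0⟩) hne]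
      with x hx
    rw [c.recenter_apply, c.recenter_apply] at hx
    simp only [PiLp.sub_apply, h0, sub_zero] at hx
    simp only [PiLp.add_apply, PiLp.smul_apply, smul_eq_mul, c.proj_of_ne _ hne]
    exact sign_convex (hρ01 x) hx
  · filter_upwards [hs, h.1] with x hx hsm
    exact ContMDiffAt.add (ContMDiffAt.smul (hρ' x) hsm.2)
      (ContMDiffAt.smul (hρ x) (c.contMDiffAt_axis hx))
  · intro a
    have := hrec.dominates a
    simp only [haxis] at this
    exact this.convex (Dominates.refl _ _) hρ01

/-- Modification of a pair of tubular form inside a chart. -/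
theorem exists_glue {ρ₀ : ℝ}
    (ht : c.toPartialEquiv.target = Metric.ball 0 ρ₀ ∩ sector c.bdry)
    {ρ : Y → ℝ} (hρ : ContMDiff (cornersModel n) 𝓘(ℝ) ∞ ρ) (hρ01 : ∀ q, ρ q ∈ Set.Icc (0 : ℝ) 1)
    (hsupp : tsupport ρ ⊆ c.toPartialEquiv.source) (F : Y → Y × (Fin k → ℝ)) :
    ∃ F' : Y → Y × (Fin k → ℝ), (∀ q ∉ tsupport ρ, F' q = F q) ∧
      ∀ q ∈ P.block i, (∀ a, q ∈ P.block (w a)) →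
        (P.IsTubularAt i w (fun x => (F x).1) (fun x => (F x).2) q →
          P.IsTubularAt i w (fun x => (F' x).1) (fun x => (F' x).2) q) ∧
        (ρ =ᶠ[𝓝 q] 1 → P.IsTubularAt i w (fun x => (F' x).1) (fun x => (F' x).2) q) := by
  classical
  let r' : Y → Y := fun q => c.toPartialEquiv.symm
        ((1 - ρ q) • c.toPartialEquiv (F q).1 + ρ q • c.proj (c.toPartialEquiv q))
  let f' : Y → Fin k → ℝ := fun q a => (1 - ρ q) * (F q).2 a + ρ q * c.toPartialEquiv q (c.axis a)
  let F' : Y → Y × (Fin k → ℝ) := fun q => if q ∈ tsupport ρ then (r' q, f' q) else F q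
  have hout : ∀ q ∉ tsupport ρ, F' q = F q := fun q hq => by simp [F', hq]
  have hin : ∀ q ∈ tsupport ρ, F' q = (r' q, f' q) := fun q hq => by simp [F', hq]
  have hzero : ∀ q ∉ tsupport ρ, ρ q = 0 := fun q hq => image_eq_zero_of_notMem_tsupport hq
  refine ⟨F', hout, fun q hi hw => ⟨fun h => ?_, fun h => ?_⟩⟩
  · by_cases hq : q ∈ tsupport ρ
    · have hqs := hsupp hq
      -- Near a tubular point `r` stays in the chart, so where `ρ = 0` the interpolation formula
      -- returns the old pair and no jump occurs at the edge of the support.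
      have key : F' =ᶠ[𝓝 q] fun x => (r' x, f' x) := by
        have hrs := h.tendsto.eventually_mem (c.open_source.mem_nhds hqs)
        filter_upwards [hrs] with x hx
        by_cases hxs : x ∈ tsupport ρ
        · exact hin x hxs
        · rw [hout x hxs]
          ext1
          · simp only [r', hzero x hxs, sub_zero, one_smul, zero_smul, add_zero]
            rw [c.toPartialEquiv.left_inv hx]
          · ext a
            simp [f', hzero x hxs]
      exact (c.isTubularAt_convex ht hqs hi hw hρ hρ01 h).congr (key.fun_comp Prod.fst)
        (key.fun_comp Prod.snd)
    · have key : F' =ᶠ[𝓝 q] F := by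
        filter_upwards [(isClosed_tsupport ρ).isOpen_compl.mem_nhds hq] with x hx
        exact hout x hx
      exact h.congr (key.fun_comp Prod.fst) (key.fun_comp Prod.snd)
  · have key : F' =ᶠ[𝓝 q] fun x => (c.toPartialEquiv.symm (c.proj (c.toPartialEquiv x)),
        fun a => c.toPartialEquiv x (c.axis a)) := by
      filter_upwards [h] with x hx
      have hx1 : ρ x = 1 := hx
      have hxs : x ∈ tsupport ρ := by
        by_contra hn
        rw [hzero x hn] at hx1
        exact zero_ne_one hx1
      rw [hin x hxs]
      ext1
      · simp [r', hx1]
      · ext a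
        simp [f', hx1]
    have hqs : q ∈ c.toPartialEquiv.source := by
      refine hsupp ?_
      by_contra hn
      have h1 : ρ q = 1 := h.self_of_nhds
      rw [hzero q hn] at h1
      exact zero_ne_one h1
    exact (c.isTubularAt_proj ht hqs hi hw).congr (key.fun_comp Prod.fst) (key.fun_comp Prod.snd)

end FramedChart

end CornerPartition

/-! ### Bump functions along a connected closed set -/

/-- A connected, locally compact, paracompact Hausdorff space is σ-compact. -/
theorem sigmaCompactSpace_of_connected {X : Type*} [TopologicalSpace X] [T2Space X]
    [ParacompactSpace X] [LocallyCompactSpace X] [ConnectedSpace X] : SigmaCompactSpace X := by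
  classical
  have hex : ∀ x : X, ∃ K, IsCompact K ∧ K ∈ 𝓝 x := fun x => exists_compact_mem_nhds x
  choose K hK hKx using hex
  obtain ⟨v, hvo, hvc, hvf, hvK⟩ := precise_refinement (fun x => interior (K x))
    (fun x => isOpen_interior) (Set.eq_univ_of_forall fun x =>
      Set.mem_iUnion.2 ⟨x, mem_interior_iff_mem_nhds.2 (hKx x)⟩)
  have hcomp : ∀ x, IsCompact (closure (v x)) := fun x =>
    (hK x).of_isClosed_subset isClosed_closure
      (closure_minimal ((hvK x).trans interior_subset) (hK x).isClosed)
  have hstep : ∀ C : {C : Set X // IsCompact C}, ∃ C' : {C : Set X // IsCompact C},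
      ∀ a, (v a ∩ C.1).Nonempty → v a ⊆ C'.1 := by
    rintro ⟨C, hC⟩
    have hfin := hvf.finite_nonempty_inter_compact hC
    refine ⟨⟨⋃ a ∈ {a | (v a ∩ C).Nonempty}, closure (v a), hfin.isCompact_biUnion fun a _ =>
      hcomp a⟩, fun a ha => ?_⟩
    exact subset_closure.trans (Set.subset_biUnion_of_mem (u := fun a => closure (v a)) ha)
  choose S hS using hstep
  obtain ⟨x₀⟩ := (inferInstance : Nonempty X)
  -- Starting from a point, each compact set absorbs the finitely many precompact members of the
  -- cover that meet its predecessor. The union is clopen, hence everything.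
  let C : ℕ → {C : Set X // IsCompact C} := fun m => Nat.rec ⟨{x₀}, isCompact_singleton⟩
    (fun _ => S) m
  have hCS : ∀ m a, (v a ∩ (C m).1).Nonempty → v a ⊆ (C (m + 1)).1 := fun m => hS (C m)
  have hcov : ∀ x, ∃ a, x ∈ v a := fun x => Set.mem_iUnion.1 (hvc ▸ Set.mem_univ x)
  have hclopen : IsClopen (⋃ m, (C m).1) := by
    constructor
    · refine isClosed_of_closure_subset fun x hx => ?_
      obtain ⟨a, ha⟩ := hcov x
      obtain ⟨y, hya, hy⟩ := mem_closure_iff_nhds.1 hx _ ((hvo a).mem_nhds ha)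
      obtain ⟨m, hm⟩ := Set.mem_iUnion.1 hy
      exact Set.mem_iUnion.2 ⟨m + 1, hCS m a ⟨y, hya, hm⟩ ha⟩
    · refine isOpen_iff_mem_nhds.2 fun x hx => ?_
      obtain ⟨m, hm⟩ := Set.mem_iUnion.1 hx
      obtain ⟨a, ha⟩ := hcov x
      refine Filter.mem_of_superset ((hvo a).mem_nhds ha) ?_
      exact (hCS m a ⟨x, ha, hm⟩).trans (Set.subset_iUnion (fun m => (C m).1) (m + 1))
  have huniv : (⋃ m, (C m).1) = Set.univ :=
    hclopen.eq_univ ⟨x₀, Set.mem_iUnion.2 ⟨0, Set.mem_singleton x₀⟩⟩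
  exact ⟨⟨fun m => (C m).1, fun m => (C m).2, huniv⟩⟩

section bump

variable {n : ℕ} {Y : Type*} [TopologicalSpace Y] [T2Space Y] [ParacompactSpace Y]
  [ChartedSpace (EuclideanQuadrant n) Y] [IsManifold (cornersModel n) ∞ Y]

/-- Bump functions along a connected closed set, equal to one near its points. -/
theorem exists_bump_sequence {Z : Set Y} (hZ : IsClosed Z) (hZc : IsConnected Z)
    {U : Y → Set Y} (hU : ∀ p ∈ Z, U p ∈ 𝓝 p) :
    ∃ ρ : ℕ → Y → ℝ, (∀ m, ContMDiff (cornersModel n) 𝓘(ℝ) ∞ (ρ m)) ∧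
      (∀ m q, ρ m q ∈ Set.Icc (0 : ℝ) 1) ∧
      (∀ m, ρ m = 0 ∨ ∃ p ∈ Z, tsupport (ρ m) ⊆ U p) ∧
      LocallyFinite (fun m => tsupport (ρ m)) ∧ ∀ p ∈ Z, ∃ m, ρ m =ᶠ[𝓝 p] 1 := by
  classical
  obtain ⟨⟨p₀, hp₀⟩, hZp⟩ := hZc
  have : LocallyConnectedSpace Y := ChartedSpace.locallyConnectedSpace (EuclideanQuadrant n) Y
  have : LocallyCompactSpace Y := Manifold.locallyCompact_of_finiteDimensional (cornersModel n)
  have hopen : IsOpen (connectedComponent p₀) := isOpen_connectedComponent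
  have hclosed : IsClosed (connectedComponent p₀) := isClosed_connectedComponent
  -- Bump coverings need σ-compactness, which holds on the connected component containing `Z`. This
  -- component is clopen, so extension by zero stays smooth.
  let M : TopologicalSpace.Opens Y := ⟨connectedComponent p₀, hopen⟩
  have hZM : Z ⊆ connectedComponent p₀ := hZp.subset_connectedComponent hp₀
  have hemb : Topology.IsClosedEmbedding (Subtype.val : M → Y) := hclosed.isClosedEmbedding_subtypeVal
  have hoemb : Topology.IsOpenEmbedding (Subtype.val : M → Y) := hopen.isOpenEmbedding_subtypeVal
  have : ParacompactSpace M := hemb.paracompactSpace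
  have : LocallyCompactSpace M := hopen.locallyCompactSpace
  have : ConnectedSpace M := isConnected_iff_connectedSpace.1 isConnected_connectedComponent
  have : SigmaCompactSpace M := sigmaCompactSpace_of_connected
  obtain ⟨κ, f, hf⟩ := SmoothBumpCovering.exists_isSubordinate (cornersModel n)
    (s := (Subtype.val ⁻¹' Z : Set M)) (hZ.preimage continuous_subtype_val)
    (U := fun x => Subtype.val ⁻¹' U x.1)
    (fun x hx => continuous_subtype_val.continuousAt.preimage_mem_nhds (hU x.1 hx))
  have hne : ∀ i, (Function.support (f i)).Nonempty := fun i => (f i).nonempty_support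
  have hcount : Countable κ := by
    have := f.locallyFinite.countable_univ hne
    exact Set.countable_univ_iff.1 this
  obtain ⟨e, he⟩ := exists_injective_nat κ
  let g : κ → Y → ℝ := fun i y => if h : y ∈ M then f i ⟨y, h⟩ else 0
  have hg : ∀ i (x : M), g i x.1 = f i x := fun i x => by simp [g, x.2]
  have hg0 : ∀ i, ∀ y ∉ M, g i y = 0 := fun i y hy => by simp [g, hy]
  have hsupp : ∀ i, tsupport (g i) ⊆ Subtype.val '' tsupport (f i) := by
    intro i
    refine closure_minimal ?_ (hemb.isClosedMap _ (isClosed_tsupport _))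
    intro y hy
    by_cases hyM : y ∈ M
    · exact ⟨⟨y, hyM⟩, subset_tsupport _ (by rw [Function.mem_support, ← hg]; exact hy), rfl⟩
    · exact absurd (hg0 i y hyM) hy
  have hsm : ∀ i, ContMDiff (cornersModel n) 𝓘(ℝ) ∞ (g i) := by
    intro i y
    by_cases hyM : y ∈ M
    · refine (contMDiffAt_subtype_iff (U := M) (x := ⟨y, hyM⟩)).1 ?_
      simp only [hg]
      exact (f i).contMDiff _
    · refine contMDiffAt_const (c := (0 : ℝ)) |>.congr_of_eventuallyEq ?_
      filter_upwards [hclosed.isOpen_compl.mem_nhds hyM] with x hx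
      exact hg0 i x hx
  have hlf : LocallyFinite fun i => tsupport (g i) := by
    intro y
    by_cases hyM : y ∈ M
    · obtain ⟨t, ht, hfin⟩ := f.locallyFinite.closure ⟨y, hyM⟩
      refine ⟨Subtype.val '' t, hoemb.isOpenMap.image_mem_nhds ht, hfin.subset ?_⟩
      rintro i ⟨_, hz, ⟨x, hx, rfl⟩⟩
      obtain ⟨x', hx', hxx⟩ := hsupp i hz
      exact ⟨x, Subtype.val_injective hxx ▸ hx', hx⟩
    · refine ⟨(connectedComponent p₀)ᶜ, hclosed.isOpen_compl.mem_nhds hyM,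
        Set.finite_empty.subset ?_⟩
      rintro i ⟨z, hz, hz'⟩
      obtain ⟨x', -, rfl⟩ := hsupp i hz
      exact hz' x'.2
  -- The countable family is listed by natural numbers; unused indices carry the zero function.
  let ρ : ℕ → Y → ℝ := Function.extend e g (fun _ _ => 0)
  have hρe : ∀ i, ρ (e i) = g i := fun i => he.extend_apply g _ i
  have hρ : ∀ m, ρ m = 0 ∨ ∃ i, m = e i ∧ ρ m = g i := by
    intro m
    by_cases h : ∃ i, e i = m
    · obtain ⟨i, rfl⟩ := h
      exact Or.inr ⟨i, rfl, hρe i⟩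
    · exact Or.inl (Function.extend_apply' g _ m h)
  refine ⟨ρ, fun m => ?_, fun m q => ?_, fun m => ?_, fun y => ?_, fun p hp => ?_⟩
  · rcases hρ m with h | ⟨i, -, h⟩
    · rw [h]; exact contMDiff_const
    · rw [h]; exact hsm i
  · rcases hρ m with h | ⟨i, -, h⟩
    · rw [h]; simp
    · rw [h]
      by_cases hq : q ∈ M
      · rw [hg i ⟨q, hq⟩]; exact ⟨(f i).nonneg, (f i).le_one⟩
      · rw [hg0 i q hq]; simp
  · rcases hρ m with h | ⟨i, -, h⟩
    · exact Or.inl h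
    · refine Or.inr ⟨(f.c i).1, f.c_mem' i, ?_⟩
      rw [h]
      refine (hsupp i).trans ?_
      rintro _ ⟨x, hx, rfl⟩
      exact hf i hx
  · obtain ⟨t, ht, hfin⟩ := hlf y
    refine ⟨t, ht, (hfin.image e).subset ?_⟩
    rintro m ⟨z, hz, hzt⟩
    rcases hρ m with h | ⟨i, rfl, h⟩
    · simp only [h] at hz
      simp [tsupport] at hz
    · simp only [h] at hz
      exact ⟨i, ⟨z, hz, hzt⟩, rfl⟩
  · refine ⟨e (f.ind ⟨p, hZM hp⟩ hp), ?_⟩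
    rw [hρe]
    have h1 := f.eventuallyEq_one ⟨p, hZM hp⟩ hp
    have h2 : 𝓝 p = Filter.map Subtype.val (𝓝 (⟨p, hZM hp⟩ : M)) :=
      (hoemb.map_nhds_eq ⟨p, hZM hp⟩).symm
    rw [h2, Filter.EventuallyEq, Filter.eventually_map]
    filter_upwards [h1] with x hx
    rw [hg, hx]; rfl

/-- Local constructions that can be modified inside small sets by means of bump functions can be
made along a connected closed set. -/
theorem exists_forall_good_of_local {Z : Set Y} (hZ : IsClosed Z) (hZc : IsConnected Z)
    {T : Type*} [Nonempty T] {Good : (Y → T) → Y → Prop}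
    (hcongr : ∀ F F' p, F' =ᶠ[𝓝 p] F → Good F p → Good F' p)
    (hstep : ∀ p ∈ Z, ∃ U ∈ 𝓝 p, ∀ ρ : Y → ℝ, ContMDiff (cornersModel n) 𝓘(ℝ) ∞ ρ →
      (∀ q, ρ q ∈ Set.Icc (0 : ℝ) 1) → tsupport ρ ⊆ U → ∀ F : Y → T,
      ∃ F' : Y → T, (∀ q ∉ tsupport ρ, F' q = F q) ∧
        ∀ q ∈ Z, (Good F q → Good F' q) ∧ (ρ =ᶠ[𝓝 q] 1 → Good F' q)) :
    ∃ F, ∀ p ∈ Z, Good F p := by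
  classical
  choose! U hU hstep using hstep
  obtain ⟨ρ, hρs, hρ01, hρU, hlf, hone⟩ := exists_bump_sequence (n := n) hZ hZc hU
  have hex : ∀ m, ∀ F : Y → T, ∃ F' : Y → T, (∀ q ∉ tsupport (ρ m), F' q = F q) ∧
        ∀ q ∈ Z, (Good F q → Good F' q) ∧ (ρ m =ᶠ[𝓝 q] 1 → Good F' q) := by
    intro m F
    rcases hρU m with h | ⟨p, hp, h⟩
    · refine ⟨F, fun _ _ => rfl, fun q _ => ⟨id, fun h1 => ?_⟩⟩
      have := h1.self_of_nhds
      rw [h] at this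
      exact absurd this zero_ne_one
    · exact hstep p hp (ρ m) (hρs m) (hρ01 m) h F
  choose S hS1 hS2 using hex
  -- The initial map is arbitrary: a point becomes good at the first bump equal to 1 near it, and
  -- later steps preserve this.
  let F : ℕ → Y → T := fun m => Nat.rec (fun _ => Classical.arbitrary T) (fun m G => S m G) m
  have hF1 : ∀ m, ∀ q ∉ tsupport (ρ m), F (m + 1) q = F m q := fun m => hS1 m (F m)
  have hF2 : ∀ m, ∀ q ∈ Z, (Good (F m) q → Good (F (m + 1)) q) ∧
      (ρ m =ᶠ[𝓝 q] 1 → Good (F (m + 1)) q) := fun m => hS2 m (F m)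
  -- Only finitely many supports meet a small neighbourhood, so the sequence is eventually constant
  -- there.
  have hstab : ∀ p : Y, ∃ V ∈ 𝓝 p, ∃ N, ∀ q ∈ V, ∀ m ≥ N, F m q = F N q := by
    intro p
    obtain ⟨V, hV, hfin⟩ := hlf p
    obtain ⟨N, hN⟩ := hfin.bddAbove
    refine ⟨V, hV, N + 1, fun q hq m hm => ?_⟩
    induction m, hm using Nat.le_induction with
    | base => rfl
    | succ m hm ih =>
      rw [hF1 m q, ih]
      intro hqm
      have := hN (show m ∈ _ from ⟨q, hqm, hq⟩)
      omega
  choose V hV N hN using hstab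
  refine ⟨fun q => F (N q) q, fun p hp => ?_⟩
  obtain ⟨m₀, hm₀⟩ := hone p hp
  have hgood : ∀ m ≥ m₀ + 1, Good (F m) p := by
    intro m hm
    induction m, hm using Nat.le_induction with
    | base => exact (hF2 m₀ p hp).2 hm₀
    | succ m hm ih => exact (hF2 m p hp).1 ih
  refine hcongr (F (max (N p) (m₀ + 1))) _ p ?_ (hgood _ (le_max_right _ _))
  filter_upwards [hV p] with q hq
  have hqq : q ∈ V q := mem_of_mem_nhds (hV q)
  rw [hN p q hq _ (le_max_left _ _), ← hN q q hqq _ (le_max_left _ (N p)),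
    hN p q hq _ (le_max_right _ _)]

end bump

/-! ### Framed charts straightening a tubular pair -/

namespace CornerPartition

variable {n : ℕ} {Y : Type*} [TopologicalSpace Y] [ChartedSpace (EuclideanQuadrant n) Y]
  {ι : Type*} {P : CornerPartition n Y ι} {k : ℕ} {i : ι} {w : Fin k → ι} {p : Y}

namespace FramedChart

variable (c : P.FramedChart i w p)

open Classical in
/-- The vector with axis coordinates `t` and the other coordinates those of `x`. -/
noncomputable def assemble (t : Fin k → ℝ) (x : EuclideanSpace ℝ (Fin n)) :
    EuclideanSpace ℝ (Fin n) :=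
  WithLp.toLp 2 fun j => if h : ∃ a, j = c.axis a then t h.choose else x j

theorem assemble_axis (t : Fin k → ℝ) (x : EuclideanSpace ℝ (Fin n)) (a : Fin k) :
    c.assemble t x (c.axis a) = t a := by
  have h : ∃ b, c.axis a = c.axis b := ⟨a, rfl⟩
  have h1 : h.choose = a := (c.axis_injective h.choose_spec).symm
  simp only [assemble, h, dif_pos, h1]

theorem assemble_of_ne (t : Fin k → ℝ) (x : EuclideanSpace ℝ (Fin n)) {j : Fin n}
    (hj : ∀ a, j ≠ c.axis a) : c.assemble t x j = x j := by
  have h : ¬ ∃ b, j = c.axis b := by push Not; exact hj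
  simp only [assemble, h, dif_neg, not_false_eq_true]

theorem contDiff_assemble : ContDiff ℝ ∞
    (fun z : (Fin k → ℝ) × EuclideanSpace ℝ (Fin n) => c.assemble z.1 z.2) := by
  rw [contDiff_euclidean]
  intro j
  by_cases hj : ∃ a, j = c.axis a
  · obtain ⟨a, rfl⟩ := hj
    simp only [assemble_axis]
    fun_prop
  · push Not at hj
    simp only [c.assemble_of_ne _ _ hj]
    fun_prop

theorem ext_axis {x y : EuclideanSpace ℝ (Fin n)} (h : ∀ a, x (c.axis a) = y (c.axis a))
    (h' : ∀ j, (∀ a, j ≠ c.axis a) → x j = y j) : x = y := by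
  ext j
  by_cases hj : ∃ a, j = c.axis a
  · obtain ⟨a, rfl⟩ := hj
    exact h a
  · push Not at hj
    exact h' j hj

/-- Composition of a framed chart with a diffeomorphism that preserves the signs of coordinates. -/
noncomputable def comp
    (G : PartialEquiv (EuclideanSpace ℝ (Fin n)) (EuclideanSpace ℝ (Fin n)))
    (hs : ∃ O, IsOpen O ∧ G.source = c.toPartialEquiv.target ∩ O)
    (ht : ∃ O, IsOpen O ∧ G.target = O ∩ sector c.bdry)
    (hG : ContDiffOn ℝ ∞ G G.source) (hG' : ContDiffOn ℝ ∞ G.symm G.target)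
    (hq' : 0 ∈ G.source) (hq0 : G 0 = 0)
    (hsign : ∀ x ∈ G.source, ∀ j ∈ c.wall, SignType.sign (G x j) = SignType.sign (x j)) :
    P.FramedChart i w p where
  toAdaptedChart := c.toAdaptedChart.comp G c.bdry c.wall p 1 c.disjoint_bdry_wall subset_rfl hs ht
    hG hG' c.mem_source (by rwa [c.map_base]) (by rwa [c.map_base])
    (fun x hx j hj => by simpa using hsign x hx j hj) (fun j hj hj' => absurd hj hj')
  axis := c.axis
  axis_injective := c.axis_injective
  axis_mem := c.axis_mem
  mem_block_iff q hq := by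
    rw [c.mem_block_iff q hq.1]
    exact forall₂_congr fun j hj => (nonneg_iff_of_sign_eq (hsign _ hq.2 j hj)).symm
  mem_block_axis_iff a q hq := by
    rw [c.mem_block_axis_iff a q hq.1]
    exact and_congr (nonpos_iff_of_sign_eq (hsign _ hq.2 _ (c.axis_mem a))).symm
      (forall₃_congr fun j hj _ => (nonneg_iff_of_sign_eq (hsign _ hq.2 j hj)).symm)

/-- The directional derivative along a coordinate half-line. -/
theorem tendsto_slope_single {L : Finset (Fin n)} {O : Set (EuclideanSpace ℝ (Fin n))}
    (hO : IsOpen O) (h0 : 0 ∈ O) {G : EuclideanSpace ℝ (Fin n) → EuclideanSpace ℝ (Fin n)}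
    (hG : ContDiffOn ℝ ∞ G (O ∩ sector L)) (hG0 : G 0 = 0) (m l : Fin n) :
    (∀ᶠ t : ℝ in 𝓝[>] 0, t • EuclideanSpace.single m (1 : ℝ) ∈ O ∩ sector L) ∧
    Filter.Tendsto (fun t : ℝ => t⁻¹ * G (t • EuclideanSpace.single m (1 : ℝ)) l) (𝓝[>] 0)
      (𝓝 (fderivWithin ℝ G (O ∩ sector L) 0 (EuclideanSpace.single m 1) l)) := by
  have hcont : Continuous fun t : ℝ => t • EuclideanSpace.single m (1 : ℝ) := by fun_prop
  have htend : Filter.Tendsto (fun t : ℝ => t • EuclideanSpace.single m (1 : ℝ)) (𝓝[>] 0)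
      (𝓝 0) := by
    simpa using hcont.continuousWithinAt.tendsto (x := 0) (s := Set.Ioi 0)
  have hmem : ∀ᶠ t : ℝ in 𝓝[>] 0, t • EuclideanSpace.single m (1 : ℝ) ∈ O ∩ sector L := by
    filter_upwards [htend.eventually_mem (hO.mem_nhds h0), self_mem_nhdsWithin] with t ht ht'
    refine ⟨ht, fun j _ => ?_⟩
    have : (0 : ℝ) ≤ t := le_of_lt ht'
    by_cases h : j = m
    · subst h; simpa using this
    · simp [h]
  refine ⟨hmem, ?_⟩
  have h := ((hG.differentiableOn (by simp) 0 ⟨h0, zero_mem_sector L⟩).hasFDerivWithinAt).lim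
    (l := 𝓝[>] (0 : ℝ)) (c := fun t => t⁻¹) (d := fun t => t • EuclideanSpace.single m (1 : ℝ))
    (v := EuclideanSpace.single m (1 : ℝ)) htend (by simpa using hmem) ?_
  · have hc : Continuous fun x : EuclideanSpace ℝ (Fin n) => x l := by fun_prop
    simpa [hG0, Function.comp_def] using (hc.tendsto _).comp h
  · refine tendsto_const_nhds.congr' ?_
    filter_upwards [self_mem_nhdsWithin] with t ht
    rw [inv_smul_smul₀ (ne_of_gt ht)]

end FramedChart

/-- A framed chart in which the fibres of `r` are the coordinate planes of the axis coordinates and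
the components of `f` are the axis coordinates. -/
theorem IsTubularAt.exists_chart {r : Y → Y} {f : Y → Fin k → ℝ} (h : P.IsTubularAt i w r f p) :
    ∃ (c' : P.FramedChart i w p) (ρ : ℝ), 0 < ρ ∧
      c'.toPartialEquiv.target = Metric.ball 0 ρ ∩ sector c'.bdry ∧
      (∀ q ∈ c'.toPartialEquiv.source, ContinuousAt r q ∧ ContinuousAt f q) ∧
      (∀ q ∈ c'.toPartialEquiv.source, ∀ a, c'.toPartialEquiv q (c'.axis a) = f q a) ∧
      (∀ q ∈ c'.toPartialEquiv.source, ∀ z ∈ c'.toPartialEquiv.source,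
        (∀ a, c'.toPartialEquiv z (c'.axis a) = 0) →
        (∀ j, (∀ a, j ≠ c'.axis a) → c'.toPartialEquiv q j = c'.toPartialEquiv z j) → r q = z) ∧
      ∀ q ∈ c'.toPartialEquiv.source, ∀ q' ∈ c'.toPartialEquiv.source, r q = r q' → f q = f q' →
        q = q' := by
  obtain ⟨hsm, c, hc⟩ := id h
  have hrs : ∀ᶠ q in 𝓝 p, r q ∈ c.toPartialEquiv.source :=
    h.tendsto.eventually_mem (c.open_source.mem_nhds c.mem_source)
  have hsign : ∀ᶠ q in 𝓝 p, ∀ j ∈ c.bdry ∪ c.wall, (∀ a, j ≠ c.axis a) →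
      SignType.sign (c.toPartialEquiv (r q) j) = SignType.sign (c.toPartialEquiv q j) := by
    rw [Filter.eventually_all_finset]
    intro j hj
    by_cases hne : ∀ a, j ≠ c.axis a
    · filter_upwards [hc.sign_eq j hj hne] with q hq _ using hq
    · exact Filter.Eventually.of_forall fun q hne' => absurd hne' hne
  have hdom : ∃ δ : Fin k → ℝ, (∀ a, 0 < δ a) ∧ ∀ᶠ q in 𝓝 p, ∀ a,
      (0 ≤ c.toPartialEquiv q (c.axis a) → δ a * c.toPartialEquiv q (c.axis a) ≤ f q a) ∧
      SignType.sign (f q a) = SignType.sign (c.toPartialEquiv q (c.axis a)) := by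
    choose δ hδ hd using hc.dominates
    refine ⟨δ, hδ, Filter.eventually_all.2 fun a => ?_⟩
    filter_upwards [hd a, (hc.dominates a).sign_eq] with q h1 h2
    exact ⟨h1.1, h2⟩
  obtain ⟨δ, hδ, hdom⟩ := hdom
  have hall := hsm.and (hrs.and (hsign.and (hdom.and (hc.axis_zero.and hc.fixed))))
  have hev := c.eventually_nhdsWithin c.mem_source hall
  rw [c.map_base, Metric.nhdsWithin_basis_ball.eventually_iff] at hev
  obtain ⟨ε, hε, hev⟩ := hev
  set O : Set (EuclideanSpace ℝ (Fin n)) := Metric.ball 0 ε with hOdef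
  have hO : IsOpen O := Metric.isOpen_ball
  have h0O : (0 : EuclideanSpace ℝ (Fin n)) ∈ O := Metric.mem_ball_self hε
  have hOt : O ∩ sector c.bdry ⊆ c.toPartialEquiv.target := fun x hx => (hev hx).1
  -- The candidate coordinates: `f` on the axes, and the coordinates of the retracted point
  -- elsewhere.
  let y : Y → EuclideanSpace ℝ (Fin n) := fun q => c.assemble (f q) (c.toPartialEquiv (r q))
  let G : EuclideanSpace ℝ (Fin n) → EuclideanSpace ℝ (Fin n) := fun x =>
    y (c.toPartialEquiv.symm x)
  have hG : ContDiffOn ℝ ∞ G (O ∩ sector c.bdry) := by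
    rw [← contMDiffOn_iff_contDiffOn]
    intro x hx
    obtain ⟨hxt, ⟨hr, hf⟩, hrx, -⟩ := hev hx
    have h1 := ((c.contMDiffOn_symm x hxt).mono hOt)
    have h2 : ContMDiffAt (cornersModel n) 𝓘(ℝ, EuclideanSpace ℝ (Fin n)) ∞ y
        (c.toPartialEquiv.symm x) :=
      (c.contDiff_assemble.contMDiff.contMDiffAt).comp _
        (hf.prodMk_space ((c.contMDiffAt hrx).comp _ hr))
    exact h2.comp_contMDiffWithinAt x h1
  have hcs : ∀ x ∈ O ∩ sector c.bdry, c.toPartialEquiv (c.toPartialEquiv.symm x) = x :=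
    fun x hx => c.toPartialEquiv.right_inv (hOt hx)
  have hGax : ∀ x a, G x (c.axis a) = f (c.toPartialEquiv.symm x) a := fun x a =>
    c.assemble_axis _ _ a
  have hGne : ∀ x j, (∀ a, j ≠ c.axis a) → G x j = c.toPartialEquiv
      (r (c.toPartialEquiv.symm x)) j := fun x j hj => c.assemble_of_ne _ _ hj
  have hGsign : ∀ x ∈ O ∩ sector c.bdry, ∀ j ∈ c.bdry ∪ c.wall,
      SignType.sign (G x j) = SignType.sign (x j) := by
    intro x hx j hj
    obtain ⟨-, -, -, hs, hd, -⟩ := hev hx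
    by_cases hj' : ∃ a, j = c.axis a
    · obtain ⟨a, rfl⟩ := hj'
      rw [hGax, (hd a).2, hcs x hx]
    · push Not at hj'
      rw [hGne x j hj', hs j hj hj', hcs x hx]
  have hGfix : ∀ x ∈ O ∩ sector c.bdry, (∀ a, x (c.axis a) = 0) → G x = x := by
    intro x hx hx0
    obtain ⟨-, -, -, -, hd, -, hfix⟩ := hev hx
    rw [hcs x hx] at hfix hd
    refine c.ext_axis (fun a => ?_) (fun j hj => ?_)
    · rw [hGax, hx0 a, ← sign_eq_zero_iff, (hd a).2, hx0 a, sign_zero]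
    · rw [hGne x j hj, hfix hx0, hcs x hx]
  have hG0 : G 0 = 0 := hGfix 0 ⟨h0O, zero_mem_sector _⟩ (by simp)
  -- The differential is block triangular: it fixes the non-axis basis vectors, and an axis row has
  -- only its diagonal entry, since `f a` vanishes with its axis coordinate. That entry is at least
  -- `δ a > 0` by domination.
  have hinj : ∀ v, fderivWithin ℝ G (O ∩ sector c.bdry) 0 v = 0 → v = 0 := by
    intro v hv
    set A := fderivWithin ℝ G (O ∩ sector c.bdry) 0 with hA
    have hslope := FramedChart.tendsto_slope_single hO h0O hG hG0
    have h1 : ∀ m, (∀ a, m ≠ c.axis a) → ∀ l,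
        A (EuclideanSpace.single m 1) l = (EuclideanSpace.single m (1 : ℝ)) l := by
      intro m hm l
      obtain ⟨h1, h2⟩ := hslope m l
      refine tendsto_nhds_unique h2 (tendsto_const_nhds.congr' ?_)
      filter_upwards [h1, self_mem_nhdsWithin] with t ht ht'
      rw [hGfix _ ht fun a => by simp [(hm a).symm]]
      have : (t : ℝ) ≠ 0 := ne_of_gt ht'
      simp [this]
    have h2 : ∀ a m, m ≠ c.axis a → A (EuclideanSpace.single m 1) (c.axis a) = 0 := by
      intro a m hm
      obtain ⟨h1, h2⟩ := hslope m (c.axis a)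
      refine tendsto_nhds_unique h2 (tendsto_const_nhds.congr' ?_)
      filter_upwards [h1] with t ht
      have h3 := hGsign _ ht (c.axis a) (Finset.mem_union_right _ (c.axis_mem a))
      have h4 : (t • EuclideanSpace.single m (1 : ℝ)) (c.axis a) = 0 := by simp [hm.symm]
      rw [h4, sign_zero, sign_eq_zero_iff] at h3
      rw [h3, mul_zero]
    have h3 : ∀ a, 0 < A (EuclideanSpace.single (c.axis a) 1) (c.axis a) := by
      intro a
      obtain ⟨h1, h2⟩ := hslope (c.axis a) (c.axis a)
      refine (hδ a).trans_le (ge_of_tendsto h2 ?_)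
      filter_upwards [h1, self_mem_nhdsWithin] with t ht ht'
      have ht0 : (0 : ℝ) < t := ht'
      obtain ⟨-, -, -, -, hd, -⟩ := hev ht
      have h4 : (t • EuclideanSpace.single (c.axis a) (1 : ℝ)) (c.axis a) = t := by simp
      have h5 := (hd a).1
      rw [hcs _ ht, h4] at h5
      rw [hGax, inv_mul_eq_div, le_div_iff₀ ht0]
      exact h5 ht0.le
    have h4 : ∀ a, v (c.axis a) = 0 := by
      intro a
      have h5 : A v (c.axis a) = 0 := by rw [hv]; rfl
      rw [EuclideanSpace.map_apply_eq_sum, Finset.sum_eq_single (c.axis a)] at h5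
      · exact (mul_eq_zero.1 h5).resolve_left (h3 a).ne'
      · intro m _ hm
        rw [h2 a m hm, zero_mul]
      · simp
    refine c.ext_axis (fun a => by rw [h4 a]; rfl) (fun l hl => ?_)
    have h5 : A v l = 0 := by rw [hv]; rfl
    rw [EuclideanSpace.map_apply_eq_sum, Finset.sum_eq_single l] at h5
    · rw [h1 l hl] at h5
      simpa using h5
    · intro m _ hm
      by_cases hm' : ∃ a, m = c.axis a
      · obtain ⟨a, rfl⟩ := hm'
        rw [h4 a, mul_zero]
      · push Not at hm'
        rw [h1 m hm']
        simp [hm.symm]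
    · simp
  obtain ⟨e, ρ, O', hρ, hO', hO'O, h0O', hes, het, heG, hesm⟩ := exists_partialEquiv_sector c.bdry
    hO h0O hG hG0 hinj
    (fun x hx j hj hpos => (pos_iff_of_sign_eq (hGsign x hx j (Finset.mem_union_left _ hj))).2 hpos)
    (fun x hx j hj h0 =>
      (eq_zero_iff_of_sign_eq (hGsign x hx j (Finset.mem_union_left _ hj))).2 h0)
  have hesO : e.source ⊆ O ∩ sector c.bdry := by
    rw [hes]; exact Set.inter_subset_inter_left _ hO'O
  have h0e : (0 : EuclideanSpace ℝ (Fin n)) ∈ e.source := by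
    rw [hes]; exact ⟨h0O', zero_mem_sector _⟩
  let c' : P.FramedChart i w p := c.comp e
    ⟨O', hO', by
      refine Set.Subset.antisymm (fun x hx => ⟨hOt (hesO hx), ?_⟩) (fun x hx => ?_)
      · rw [hes] at hx; exact hx.1
      · rw [hes]; exact ⟨hx.2, c.target_subset hx.1⟩⟩
    ⟨_, Metric.isOpen_ball, het⟩ ((hG.mono hesO).congr heG) hesm h0e
    (by rw [heG h0e, hG0])
    (fun x hx j hj => by
      rw [heG hx]; exact hGsign x (hesO hx) j (Finset.mem_union_right _ hj))
  have hc's : ∀ q ∈ c'.toPartialEquiv.source, q ∈ c.toPartialEquiv.source ∧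
      c.toPartialEquiv q ∈ O ∩ sector c.bdry ∧ c'.toPartialEquiv q = y q := by
    intro q hq
    have hq1 : q ∈ c.toPartialEquiv.source := hq.1
    have hq2 : c.toPartialEquiv q ∈ e.source := hq.2
    refine ⟨hq1, hesO hq2, ?_⟩
    change e (c.toPartialEquiv q) = _
    rw [heG hq2]
    simp only [G, c.toPartialEquiv.left_inv hq1]
  have hgood : ∀ q ∈ c'.toPartialEquiv.source, _ := fun q hq => (hev (hc's q hq).2.1).2
  have hinv : ∀ q ∈ c'.toPartialEquiv.source,
      c.toPartialEquiv.symm (c.toPartialEquiv q) = q := fun q hq =>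
    c.toPartialEquiv.left_inv (hc's q hq).1
  refine ⟨c', ρ, hρ, ?_, ?_, ?_, ?_, ?_⟩
  · change (c.toPartialEquiv.trans e).target = _
    have hbd : c'.bdry = c.bdry := rfl
    rw [PartialEquiv.trans_target, het, hbd, ← het, Set.inter_eq_left]
    exact fun x hx => hOt (hesO (e.map_target hx))
  · intro q hq
    have h1 := hgood q hq
    rw [hinv q hq] at h1
    exact ⟨h1.1.1.continuousAt, h1.1.2.continuousAt⟩
  · intro q hq a
    rw [(hc's q hq).2.2]
    exact c.assemble_axis _ _ a
  · intro q hq z hz hz0 hqz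
    have h1 := hgood q hq
    have h2 := hgood z hz
    rw [hinv q hq] at h1
    rw [hinv z hz] at h2
    have hfz : ∀ a, f z a = 0 := fun a => by
      rw [← hz0 a, (hc's z hz).2.2]; exact (c.assemble_axis _ _ a).symm
    have hrz : r z = z := by
      refine h2.2.2.2.2.2 fun a => ?_
      rw [← sign_eq_zero_iff, ← (h2.2.2.2.1 a).2, hfz a, sign_zero]
    -- The point `z` is fixed by `r`. Both `r q` and `z` have zero axis coordinates in the old
    -- chart, and their other coordinates agree because those are what the new chart records.
    refine c.toPartialEquiv.injOn h1.2.1 (hc's z hz).1 ?_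
    refine c.ext_axis (fun a => ?_) (fun j hj => ?_)
    · rw [h1.2.2.2.2.1 a, ← hrz, h2.2.2.2.2.1 a]
    · have h3 := hqz j hj
      rw [(hc's q hq).2.2, (hc's z hz).2.2] at h3
      have h4 : c.toPartialEquiv (r q) j = c.toPartialEquiv (r z) j :=
        (c.assemble_of_ne (f q) _ hj).symm.trans (h3.trans (c.assemble_of_ne (f z) _ hj))
      rw [h4, hrz]
  · intro q hq q' hq' hr hf
    refine c'.toPartialEquiv.injOn hq hq' ?_
    rw [(hc's q hq).2.2, (hc's q' hq').2.2]
    simp only [y, hr, hf]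

end CornerPartition

/-! ### Tubes and normal cubes in straightened charts -/

namespace CornerPartition

variable {n : ℕ} {Y : Type*} [TopologicalSpace Y] [ChartedSpace (EuclideanQuadrant n) Y]
  {ι : Type*} {P : CornerPartition n Y ι} {k : ℕ} {i : ι} {w : Fin k → ι} {p : Y}

namespace FramedChart

variable (c : P.FramedChart i w p)

/-- The vector with axis coordinates `t` and the other coordinates zero. -/
noncomputable def axisVec (t : Fin k → ℝ) : EuclideanSpace ℝ (Fin n) :=
  ∑ a, EuclideanSpace.single (c.axis a) (t a)

theorem axisVec_axis (t : Fin k → ℝ) (a : Fin k) : c.axisVec t (c.axis a) = t a := by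
  rw [axisVec, WithLp.ofLp_sum, Finset.sum_apply, Finset.sum_eq_single a]
  · simp
  · intro b _ hb
    have : c.axis a ≠ c.axis b := fun h => hb (c.axis_injective h).symm
    simp [this]
  · simp

theorem axisVec_of_ne (t : Fin k → ℝ) {j : Fin n} (hj : ∀ a, j ≠ c.axis a) :
    c.axisVec t j = 0 := by
  rw [axisVec, WithLp.ofLp_sum, Finset.sum_apply]
  exact Finset.sum_eq_zero fun a _ => by simp [hj a]

theorem axisVec_zero : c.axisVec 0 = 0 :=
  c.ext_axis (fun a => by rw [axisVec_axis]; rfl) (fun j hj => by rw [c.axisVec_of_ne _ hj]; rfl)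

theorem contDiff_axisVec : ContDiff ℝ ∞ c.axisVec := by
  rw [contDiff_euclidean]
  intro j
  by_cases hj : ∃ a, j = c.axis a
  · obtain ⟨a, rfl⟩ := hj
    simp only [axisVec_axis]
    fun_prop
  · push Not at hj
    simp only [c.axisVec_of_ne _ hj]
    fun_prop

/-- The base point uses half of the radius, and the `k` axis steps together at most the other half;
the denominator has `k + 1` so that `k = 0` is allowed. Axis steps leave the boundary coordinates
unchanged. -/
theorem add_axisVec_mem_target {ρ : ℝ}
    (ht : c.toPartialEquiv.target = Metric.ball 0 ρ ∩ sector c.bdry) {z : Y}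
    (hz : z ∈ c.toPartialEquiv.source) (hzρ : ‖c.toPartialEquiv z‖ < ρ / 2) {t : Fin k → ℝ}
    (htρ : ∀ a, |t a| ≤ ρ / (2 * (k + 1))) :
    c.toPartialEquiv z + c.axisVec t ∈ c.toPartialEquiv.target := by
  have hρ : 0 < ρ := by
    have := (norm_nonneg _).trans_lt hzρ
    linarith
  rw [ht]
  refine ⟨mem_ball_zero_iff.2 ?_, fun j hj => ?_⟩
  · have h1 : ‖c.axisVec t‖ ≤ k * (ρ / (2 * (k + 1))) := by
      refine (norm_sum_le _ _).trans ?_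
      refine (Finset.sum_le_card_nsmul _ _ (ρ / (2 * (k + 1))) fun a _ => ?_).trans ?_
      · simpa using htρ a
      · simp
    have h2 : (k : ℝ) * (ρ / (2 * (k + 1))) ≤ ρ / 2 := by
      rw [← mul_div_assoc, div_le_div_iff₀ (by positivity) (by positivity)]
      nlinarith
    linarith [norm_add_le (c.toPartialEquiv z) (c.axisVec t)]
  · have hne : ∀ a, j ≠ c.axis a := by
      rintro a rfl
      exact Finset.disjoint_left.1 c.disjoint_bdry_wall hj (c.axis_mem a)
    rw [PiLp.add_apply, c.axisVec_of_ne _ hne, add_zero]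
    exact c.nonneg_of_mem_bdry hz hj

/-- Recentring the chart at `z` makes the cube linear. The embedding `b` selects the axes: all of
them for the cube of the facet, a single one for the normal interval of a wall. -/
theorem isNormalCubeParam {z : Y} (hz : z ∈ c.toPartialEquiv.source) (hi : z ∈ P.block i)
    (hw : ∀ a, z ∈ P.block (w a)) {m : ℕ} {Z : Set Y} (b : Fin m ↪ Fin k)
    (hvan : ∀ q ∈ Z ∩ c.toPartialEquiv.source, ∀ a, c.toPartialEquiv q (c.axis (b a)) = 0)
    {ε : ℝ} (hε : 0 < ε) {γ : (Fin m → ℝ) → Y}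
    (hmem : ∀ t ∈ stdCube m, c.toPartialEquiv z +
      ∑ a, EuclideanSpace.single (c.axis (b a)) (ε * t a) ∈ c.toPartialEquiv.target)
    (hγ : ∀ t ∈ stdCube m, γ t = c.toPartialEquiv.symm (c.toPartialEquiv z +
      ∑ a, EuclideanSpace.single (c.axis (b a)) (ε * t a))) :
    P.IsNormalCubeParam m Z z γ := by
  have hz0 : ∀ a, c.toPartialEquiv z (c.axis a) = 0 := fun a => c.axis_eq_zero hz hi (hw a)
  refine ⟨c.toAdaptedChart.recenter hz 1 (fun _ _ => rfl) isOpen_univ (Set.mem_univ _),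
    b.trans ⟨c.axis, c.axis_injective⟩, ε, hε, fun a => ?_, fun q hq a => ?_, fun t ht => ?_⟩
  · exact Finset.mem_filter.2 ⟨c.axis_mem _, hz0 _⟩
  · have h1 := hvan q ⟨hq.1, AdaptedChart.recenter_source_subset _ _ _ _ _ _ hq.2⟩ a
    rw [AdaptedChart.recenter_apply]
    simp [h1, hz0]
  · rw [AdaptedChart.mem_recenter_target, AdaptedChart.recenter_symm_apply, flip_one, hγ t ht,
      add_comm]
    refine ⟨⟨hmem t ht, Set.mem_univ _, fun j hj h0 => ?_⟩, rfl⟩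
    have h1 : (∑ a, EuclideanSpace.single ((b.trans ⟨c.axis, c.axis_injective⟩) a) (ε * t a) :
        EuclideanSpace ℝ (Fin n)) j = 0 := by
      rw [WithLp.ofLp_sum, Finset.sum_apply]
      refine Finset.sum_eq_zero fun a _ => ?_
      have : j ≠ c.axis (b a) := fun h => h0 (h ▸ hz0 (b a))
      simp [this]
    rw [PiLp.add_apply, h1, add_zero]
    exact mul_self_pos.2 h0

/-- The chart is adapted to the retraction `r` and the functions `f`. -/
structure IsTube (c : P.FramedChart i w p) (r : Y → Y) (f : Y → Fin k → ℝ) (ρ : ℝ) : Prop where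
  pos : 0 < ρ
  target_eq : c.toPartialEquiv.target = Metric.ball 0 ρ ∩ sector c.bdry
  continuousAt : ∀ q ∈ c.toPartialEquiv.source, ContinuousAt r q ∧ ContinuousAt f q
  axis_eq : ∀ q ∈ c.toPartialEquiv.source, ∀ a, c.toPartialEquiv q (c.axis a) = f q a
  retract_eq : ∀ q ∈ c.toPartialEquiv.source, ∀ z ∈ c.toPartialEquiv.source,
        (∀ a, c.toPartialEquiv z (c.axis a) = 0) →
        (∀ j, (∀ a, j ≠ c.axis a) → c.toPartialEquiv q j = c.toPartialEquiv z j) → r q = z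
  injective : ∀ q ∈ c.toPartialEquiv.source, ∀ q' ∈ c.toPartialEquiv.source, r q = r q' →
    f q = f q' → q = q'

/-- The points of the chart with small coordinates. -/
def core (c : P.FramedChart i w p) (ρ : ℝ) : Set Y :=
  {z | z ∈ c.toPartialEquiv.source ∧ ‖c.toPartialEquiv z‖ < ρ / 2}

theorem core_mem_nhds {ρ : ℝ} {z : Y} (hz : z ∈ c.core ρ) : c.core ρ ∈ 𝓝 z := by
  have h := c.continuousOn.norm.isOpen_inter_preimage c.open_source (isOpen_Iio (a := ρ / 2))
  exact h.mem_nhds hz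

theorem base_mem_core {ρ : ℝ} (hρ : 0 < ρ) : p ∈ c.core ρ :=
  ⟨c.mem_source, by rw [c.map_base]; simpa using hρ⟩

/-- The point with axis coordinates `t` over the point `z` of the facet. -/
noncomputable def shift (c : P.FramedChart i w p) (z : Y) (t : Fin k → ℝ) : Y :=
  c.toPartialEquiv.symm (c.toPartialEquiv z + c.axisVec t)

variable {c}

section tube

variable {r : Y → Y} {f : Y → Fin k → ℝ} {ρ : ℝ}

theorem IsTube.shift_mem (h : c.IsTube r f ρ) {z : Y} (hz : z ∈ c.core ρ) {t : Fin k → ℝ}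
    (ht : ∀ a, |t a| ≤ ρ / (2 * (k + 1))) : c.shift z t ∈ c.toPartialEquiv.source :=
  c.toPartialEquiv.map_target (c.add_axisVec_mem_target h.target_eq hz.1 hz.2 ht)

theorem IsTube.apply_shift (h : c.IsTube r f ρ) {z : Y} (hz : z ∈ c.core ρ) {t : Fin k → ℝ}
    (ht : ∀ a, |t a| ≤ ρ / (2 * (k + 1))) :
    c.toPartialEquiv (c.shift z t) = c.toPartialEquiv z + c.axisVec t :=
  c.toPartialEquiv.right_inv (c.add_axisVec_mem_target h.target_eq hz.1 hz.2 ht)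

theorem IsTube.function_shift (h : c.IsTube r f ρ) {z : Y} (hz : z ∈ c.core ρ)
    (hi : z ∈ P.block i) (hw : ∀ a, z ∈ P.block (w a)) {t : Fin k → ℝ}
    (ht : ∀ a, |t a| ≤ ρ / (2 * (k + 1))) : f (c.shift z t) = t := by
  funext a
  rw [← h.axis_eq _ (h.shift_mem hz ht), h.apply_shift hz ht, PiLp.add_apply, axisVec_axis,
    c.axis_eq_zero hz.1 hi (hw a), zero_add]

theorem IsTube.retract_shift (h : c.IsTube r f ρ) {z : Y} (hz : z ∈ c.core ρ)
    (hi : z ∈ P.block i) (hw : ∀ a, z ∈ P.block (w a)) {t : Fin k → ℝ}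
    (ht : ∀ a, |t a| ≤ ρ / (2 * (k + 1))) : r (c.shift z t) = z := by
  refine h.retract_eq _ (h.shift_mem hz ht) z hz.1 (fun a => c.axis_eq_zero hz.1 hi (hw a))
    fun j hj => ?_
  rw [h.apply_shift hz ht, PiLp.add_apply, c.axisVec_of_ne _ hj, add_zero]

theorem shift_zero {z : Y} (hz : z ∈ c.toPartialEquiv.source) : c.shift z 0 = z := by
  rw [shift, axisVec_zero, add_zero, c.toPartialEquiv.left_inv hz]

theorem IsTube.continuousOn_shift (h : c.IsTube r f ρ) {z : Y} (hz : z ∈ c.core ρ)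
    {t : Fin k → ℝ} (ht : ∀ a, |t a| ≤ ρ / (2 * (k + 1))) :
    ContinuousOn (fun τ : ℝ => c.shift z (τ • t)) (Set.Icc 0 1) := by
  refine c.continuousOn_symm.comp (t := c.toPartialEquiv.target) ?_ fun τ hτ => ?_
  · exact (continuous_const.add (c.contDiff_axisVec.continuous.comp
      (continuous_id.smul continuous_const))).continuousOn
  · refine c.add_axisVec_mem_target h.target_eq hz.1 hz.2 fun a => ?_
    rw [Pi.smul_apply, smul_eq_mul, abs_mul, abs_of_nonneg hτ.1]
    exact (mul_le_of_le_one_left (abs_nonneg _) hτ.2).trans (ht a)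

/-- The tubes of different charts agree. -/
theorem IsTube.shift_eq_shift [T2Space Y] (h : c.IsTube r f ρ) {p' : Y} {c' : P.FramedChart i w p'}
    {ρ' : ℝ} (h' : c'.IsTube r f ρ') {z : Y} (hz : z ∈ c.core ρ) (hz' : z ∈ c'.core ρ')
    (hi : z ∈ P.block i) (hw : ∀ a, z ∈ P.block (w a)) {t : Fin k → ℝ}
    (ht : ∀ a, |t a| ≤ ρ / (2 * (k + 1))) (ht' : ∀ a, |t a| ≤ ρ' / (2 * (k + 1))) :
    c.shift z t = c'.shift z t := by
  have hsc : ∀ {ρ : ℝ}, (∀ a, |t a| ≤ ρ / (2 * (k + 1))) → ∀ τ ∈ Set.Icc (0 : ℝ) 1, ∀ a,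
      |(τ • t) a| ≤ ρ / (2 * (k + 1)) := by
    intro ρ ht τ hτ a
    rw [Pi.smul_apply, smul_eq_mul, abs_mul, abs_of_nonneg hτ.1]
    exact (mul_le_of_le_one_left (abs_nonneg _) hτ.2).trans (ht a)
  have hcont := h.continuousOn_shift hz ht
  have hcont' := h'.continuousOn_shift hz' ht'
  -- Injectivity of `(r, f)` is only known inside one chart, so agreement is propagated along the
  -- segment from `z`. It is an open condition by that injectivity and a closed one by the Hausdorff
  -- property.
  have key : c.shift z ((0 : ℝ) • t) = c'.shift z ((0 : ℝ) • t) ↔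
      c.shift z ((1 : ℝ) • t) = c'.shift z ((1 : ℝ) • t) := by
    refine (isPreconnected_Icc (a := (0 : ℝ)) (b := 1)).iff_of_locally_iff
      (Q := fun τ => c.shift z (τ • t) = c'.shift z (τ • t)) (fun τ hτ => ?_)
      (by simp) (by simp)
    by_cases heq : c.shift z (τ • t) = c'.shift z (τ • t)
    · have hmem := h.shift_mem hz (hsc ht τ hτ)
      have h1 : ∀ᶠ σ in 𝓝[Set.Icc 0 1] τ, c'.shift z (σ • t) ∈ c.toPartialEquiv.source :=
        (hcont' τ hτ).eventually_mem (c.open_source.mem_nhds (by simpa only [← heq] using hmem))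
      refine ⟨_, eventually_nhdsWithin_iff.1 h1, fun σ hσ hσ' => iff_of_true ?_ heq⟩
      refine h.injective _ (h.shift_mem hz (hsc ht σ hσ')) _ (hσ hσ') ?_ ?_
      · rw [h.retract_shift hz hi hw (hsc ht σ hσ'), h'.retract_shift hz' hi hw (hsc ht' σ hσ')]
      · rw [h.function_shift hz hi hw (hsc ht σ hσ'), h'.function_shift hz' hi hw (hsc ht' σ hσ')]
    · obtain ⟨u, v, hu, hv, hxu, hxv, huv⟩ := t2_separation heq
      have h1 : ∀ᶠ σ in 𝓝[Set.Icc 0 1] τ, c.shift z (σ • t) ∈ u :=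
        (hcont τ hτ).eventually_mem (hu.mem_nhds hxu)
      have h2 : ∀ᶠ σ in 𝓝[Set.Icc 0 1] τ, c'.shift z (σ • t) ∈ v :=
        (hcont' τ hτ).eventually_mem (hv.mem_nhds hxv)
      refine ⟨_, eventually_nhdsWithin_iff.1 (h1.and h2), fun σ hσ hσ' => iff_of_false ?_ heq⟩
      intro he
      exact Set.disjoint_left.1 huv (hσ hσ').1 (by simpa only [he] using (hσ hσ').2)
  rw [zero_smul, one_smul, shift_zero hz.1, shift_zero hz'.1] at key
  exact key.1 rfl

end tube

end FramedChart

end CornerPartition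

/-! ### The global trivialization -/

/-- Small smooth positive functions near a connected closed set. -/
theorem exists_contMDiffAt_lt {n : ℕ} {Y : Type*} [TopologicalSpace Y] [T2Space Y]
    [ParacompactSpace Y] [ChartedSpace (EuclideanQuadrant n) Y] [IsManifold (cornersModel n) ∞ Y]
    {Z : Set Y} (hZ : IsClosed Z) (hZc : IsConnected Z)
    {U : Z → Set Y} {η : Z → ℝ} (hU : ∀ p : Z, U p ∈ 𝓝 (p : Y)) (hη : ∀ p, 0 < η p) :
    ∃ ε : Y → ℝ, ∀ z ∈ Z, ContMDiffAt (cornersModel n) 𝓘(ℝ) ∞ ε z ∧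
      ∃ p : Z, z ∈ U p ∧ 0 < ε z ∧ ε z < η p := by
  refine exists_forall_good_of_local (n := n) hZ hZc
    (Good := fun ε z => ContMDiffAt (cornersModel n) 𝓘(ℝ) ∞ ε z ∧
      ∃ p : Z, z ∈ U p ∧ 0 < ε z ∧ ε z < η p) (fun F F' p h hF => ?_) fun p hp => ?_
  · rw [h.self_of_nhds]
    exact ⟨hF.1.congr_of_eventuallyEq h, hF.2⟩
  refine ⟨U ⟨p, hp⟩, hU ⟨p, hp⟩, fun ρ hρ hρ01 hsupp F => ?_⟩
  have hp0 := hη ⟨p, hp⟩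
  -- Interpolation with the constant `η / 2`: the result is positive and below the larger of the old
  -- and new bounds, so whichever of the two charts has the larger bound is the witness.
  refine ⟨fun q => (1 - ρ q) * F q + ρ q * (η ⟨p, hp⟩ / 2), fun q hq => ?_, fun q _ =>
    ⟨fun hF => ⟨?_, ?_⟩, fun h1 => ⟨?_, ⟨p, hp⟩, ?_, ?_⟩⟩⟩
  · simp [image_eq_zero_of_notMem_tsupport hq]
  · exact ((contMDiffAt_const.sub hρ.contMDiffAt).mul hF.1).add
      (hρ.contMDiffAt.mul contMDiffAt_const)
  · obtain ⟨-, p', hq, h0, h1⟩ := hF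
    obtain ⟨hρ0, hρ1⟩ := hρ01 q
    by_cases hqs : q ∈ tsupport ρ
    · rcases le_total (η ⟨p, hp⟩) (η p') with hle | hle
      · refine ⟨p', hq, ?_, ?_⟩
        · nlinarith [mul_nonneg (sub_nonneg.2 hρ1) h0.le, mul_nonneg hρ0 hp0.le]
        · nlinarith
      · refine ⟨⟨p, hp⟩, hsupp hqs, ?_, ?_⟩
        · nlinarith [mul_nonneg (sub_nonneg.2 hρ1) h0.le, mul_nonneg hρ0 hp0.le]
        · nlinarith
    · refine ⟨p', hq, ?_⟩
      simp [image_eq_zero_of_notMem_tsupport hqs, h0, h1]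
  · refine (contMDiffAt_const (c := η ⟨p, hp⟩ / 2)).congr_of_eventuallyEq ?_
    filter_upwards [h1] with x hx
    simp [hx]
  · refine hsupp (subset_tsupport _ ?_)
    simp [h1.self_of_nhds]
  · simp [h1.self_of_nhds, hp0]

namespace CornerPartition

variable {n : ℕ} {Y : Type*} [TopologicalSpace Y] [ChartedSpace (EuclideanQuadrant n) Y]
  {ι : Type*} {P : CornerPartition n Y ι} {k : ℕ} {i : ι} {w : Fin k → ι} {p : Y}

theorem abs_smul_le_of_mem_stdCube {t : Fin k → ℝ} (ht : t ∈ stdCube k) {ε η : ℝ} (h0 : 0 < ε)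
    (h : ε ≤ η) (a : Fin k) : |(ε • t) a| ≤ η := by
  rw [Pi.smul_apply, smul_eq_mul, abs_mul, abs_of_pos h0]
  exact (mul_le_of_le_one_right h0.le (abs_le.2 ⟨ht.1 a, ht.2 a⟩)).trans h

theorem FramedChart.contMDiffWithinAt_shift (c : P.FramedChart i w p) {ρ : ℝ}
    (ht : c.toPartialEquiv.target = Metric.ball 0 ρ ∩ sector c.bdry) {z : Y} (hz : z ∈ c.core ρ)
    {ε : Y → ℝ} (hε : ContMDiffAt (cornersModel n) 𝓘(ℝ) ∞ ε z) {t : Fin k → ℝ}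
    {S : Set (Y × (Fin k → ℝ))} (hzt : (z, t) ∈ S)
    (hS : ∀ x ∈ S, x.1 ∈ c.core ρ ∧ ∀ a, |(ε x.1 • x.2) a| ≤ ρ / (2 * (k + 1))) :
    ContMDiffWithinAt ((cornersModel n).prod 𝓘(ℝ, Fin k → ℝ)) (cornersModel n) ∞
      (fun x : Y × (Fin k → ℝ) => c.shift x.1 (ε x.1 • x.2)) S (z, t) := by
  have hmaps : Set.MapsTo (fun x : Y × (Fin k → ℝ) =>
      c.toPartialEquiv x.1 + c.axisVec (ε x.1 • x.2)) S c.toPartialEquiv.target := fun x hx =>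
    c.add_axisVec_mem_target ht (hS x hx).1.1 (hS x hx).1.2 (hS x hx).2
  refine ContMDiffWithinAt.comp (z, t) (t := c.toPartialEquiv.target)
    (c.contMDiffOn_symm _ (hmaps hzt)) ?_ hmaps
  refine ContMDiffAt.contMDiffWithinAt ?_
  have h1 : ContMDiffAt ((cornersModel n).prod 𝓘(ℝ, Fin k → ℝ)) 𝓘(ℝ, EuclideanSpace ℝ (Fin n)) ∞
      (fun x : Y × (Fin k → ℝ) => c.toPartialEquiv x.1) (z, t) :=
    ContMDiffAt.comp (z, t) (c.contMDiffAt hz.1) contMDiffAt_fst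
  have h2 : ContMDiffAt ((cornersModel n).prod 𝓘(ℝ, Fin k → ℝ)) 𝓘(ℝ) ∞
      (fun x : Y × (Fin k → ℝ) => ε x.1) (z, t) :=
    ContMDiffAt.comp (z, t) hε contMDiffAt_fst
  have h3 : ContMDiffAt ((cornersModel n).prod 𝓘(ℝ, Fin k → ℝ)) 𝓘(ℝ, Fin k → ℝ) ∞
      (fun x : Y × (Fin k → ℝ) => ε x.1 • x.2) (z, t) := h2.smul contMDiffAt_snd
  exact h1.add (c.contDiff_axisVec.contMDiff.contMDiffAt.comp (z, t) h3)

/-- The tubes along `Z` fit together to a trivialized bundle of normal cubes. -/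
theorem exists_trivialization_of_isTube [T2Space Y] {Z : Set Y} (hi : Z ⊆ P.block i)
    (hw : ∀ a, Z ⊆ P.block (w a)) {r : Y → Y} {f : Y → Fin k → ℝ} {ρ : Z → ℝ}
    (c : ∀ p : Z, P.FramedChart i w p) (hc : ∀ p, (c p).IsTube r f (ρ p)) {ε : Y → ℝ}
    (hε : ∀ z ∈ Z, ContMDiffAt (cornersModel n) 𝓘(ℝ) ∞ ε z ∧
      ∃ p : Z, z ∈ (c p).core (ρ p) ∧ 0 < ε z ∧ ε z < ρ p / (2 * (k + 1)))
    {W : Fin k → Set Y} (hWi : ∀ a, W a ⊆ P.block i) (hWw : ∀ a, W a ⊆ P.block (w a)) :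
    ∃ (E : P.NormalCubeBundle k Z) (Φ : Y → (Fin k → ℝ) → Y), E.IsTrivialization Φ ∧
      ∀ p ∈ Z, (∀ a, P.IsNormalCubeParam 1 (W a) p (fun τ => Φ p (Pi.single a (τ 0)))) ∧
        ∀ t ∈ stdCube k, (∀ a, 0 ≤ t a) → Φ p t ∈ P.block i := by
  classical
  have hpos : ∀ z ∈ Z, 0 < ε z := fun z hz => by
    obtain ⟨-, p, -, h, -⟩ := hε z hz
    exact h
  choose π hπ using fun z : Z => (hε z z.2).2
  -- The value is defined by one chosen chart for each `z`. Agreement of tubes lets any chart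
  -- compute it, so smoothness can be checked in a single chart near each point.
  obtain ⟨Φ, hΦ⟩ : ∃ Φ : Y → (Fin k → ℝ) → Y, ∀ p : Z, ∀ z ∈ Z, z ∈ (c p).core (ρ p) →
      ε z < ρ p / (2 * (k + 1)) → ∀ t ∈ stdCube k, Φ z t = (c p).shift z (ε z • t) := by
    refine ⟨fun z t => if h : z ∈ Z then (c (π ⟨z, h⟩)).shift z (ε z • t) else z,
      fun p z hz hzc hzε t ht => ?_⟩
    refine (dif_pos hz).trans ?_
    obtain ⟨h1, h2, h3⟩ := hπ ⟨z, hz⟩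
    exact (hc _).shift_eq_shift (hc p) h1 hzc (hi hz) (fun a => hw a hz)
      (abs_smul_le_of_mem_stdCube ht h2 h3.le) (abs_smul_le_of_mem_stdCube ht h2 hzε.le)
  have hret : ∀ z ∈ Z, ∀ t ∈ stdCube k, r (Φ z t) = z := fun z hz t ht => by
    obtain ⟨-, p, h1, h2, h3⟩ := hε z hz
    rw [hΦ p z hz h1 h3 t ht]
    exact (hc p).retract_shift h1 (hi hz) (fun a => hw a hz)
      (abs_smul_le_of_mem_stdCube ht h2 h3.le)
  have hfun : ∀ z ∈ Z, ∀ t ∈ stdCube k, f (Φ z t) = ε z • t := fun z hz t ht => by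
    obtain ⟨-, p, h1, h2, h3⟩ := hε z hz
    rw [hΦ p z hz h1 h3 t ht]
    exact (hc p).function_shift h1 (hi hz) (fun a => hw a hz)
      (abs_smul_le_of_mem_stdCube ht h2 h3.le)
  have hcont : ∀ z ∈ Z, ∀ t ∈ stdCube k,
      ContinuousAt r (Φ z t) ∧ ContinuousAt f (Φ z t) := fun z hz t ht => by
    obtain ⟨-, p, h1, h2, h3⟩ := hε z hz
    rw [hΦ p z hz h1 h3 t ht]
    exact (hc p).continuousAt _ ((hc p).shift_mem h1 (abs_smul_le_of_mem_stdCube ht h2 h3.le))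
  have hsmooth : ContMDiffOn ((cornersModel n).prod 𝓘(ℝ, Fin k → ℝ)) (cornersModel n) ∞
      (fun x : Y × (Fin k → ℝ) => Φ x.1 x.2) (Z ×ˢ stdCube k) := by
    rintro ⟨z, t⟩ ⟨hz, ht⟩
    obtain ⟨hεz, p, h1, h2, h3⟩ := hε z hz
    let O : Set (Y × (Fin k → ℝ)) :=
      Prod.fst ⁻¹' {x | x ∈ (c p).core (ρ p) ∧ ε x < ρ p / (2 * (k + 1))}
    have hO : O ∈ 𝓝 (z, t) := continuous_fst.continuousAt.preimage_mem_nhds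
      (Filter.inter_mem ((c p).core_mem_nhds h1) (hεz.continuousAt.eventually_lt_const h3))
    have hS : ∀ x ∈ (Z ×ˢ stdCube k) ∩ O,
        x.1 ∈ (c p).core (ρ p) ∧ ∀ a, |(ε x.1 • x.2) a| ≤ ρ p / (2 * (k + 1)) := fun x hx =>
      ⟨hx.2.1, abs_smul_le_of_mem_stdCube hx.1.2 (hpos _ hx.1.1) hx.2.2.le⟩
    have hzt : (z, t) ∈ (Z ×ˢ stdCube k) ∩ O := ⟨⟨hz, ht⟩, h1, h3⟩
    refine ContMDiffWithinAt.mono_of_mem_nhdsWithin (s := (Z ×ˢ stdCube k) ∩ O) ?_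
      (inter_mem_nhdsWithin _ hO)
    exact ((c p).contMDiffWithinAt_shift (hc p).target_eq h1 hεz hzt hS).congr
      (fun x hx => hΦ p x.1 hx.1.1 hx.2.1 hx.2.2 x.2 hx.1.2) (hΦ p z hz h1 h3 t ht)
  have hemb : Topology.IsEmbedding (fun x : ↥(Z ×ˢ stdCube k) => Φ x.1.1 x.1.2) := by
    set g : ↥(Z ×ˢ stdCube k) → Y := fun x => Φ x.1.1 x.1.2 with hg
    have hgc : Continuous g := continuousOn_iff_continuous_domRestrict.1 hsmooth.continuousOn
    -- The base point is recovered by `r`, and the parameter by rescaling `f`; this continuous left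
    -- inverse gives the embedding.
    let h : Set.range g → Y × (Fin k → ℝ) := fun q => (r q, (ε (r q))⁻¹ • f q)
    have hh : Continuous h := by
      rw [continuous_iff_continuousAt]
      rintro ⟨_, ⟨⟨z, t⟩, hz, ht⟩, rfl⟩
      have hr : ContinuousAt (fun q : Set.range g => r q) ⟨g ⟨(z, t), hz, ht⟩, _, rfl⟩ :=
        ContinuousAt.comp (f := Subtype.val) (hcont z hz t ht).1 continuous_subtype_val.continuousAt
      have hf : ContinuousAt (fun q : Set.range g => f q) ⟨g ⟨(z, t), hz, ht⟩, _, rfl⟩ :=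
        ContinuousAt.comp (f := Subtype.val) (hcont z hz t ht).2 continuous_subtype_val.continuousAt
      have hrz : r (g ⟨(z, t), hz, ht⟩) = z := hret z hz t ht
      have hεc : ContinuousAt (fun q : Set.range g => ε (r q)) ⟨g ⟨(z, t), hz, ht⟩, _, rfl⟩ := by
        refine ContinuousAt.comp (g := ε) (f := fun q : Set.range g => r q) ?_ hr
        simp only [hrz]
        exact (hε z hz).1.continuousAt
      refine hr.prodMk ((hεc.inv₀ ?_).smul hf)
      simp only [hrz]
      exact (hpos z hz).ne'
    have hcomp : h ∘ Set.rangeFactorization g = Subtype.val := by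
      funext x
      refine Prod.ext (hret _ x.2.1 _ x.2.2) ?_
      change (ε (r (g x)))⁻¹ • f (g x) = x.1.2
      rw [hg, hret _ x.2.1 _ x.2.2, hfun _ x.2.1 _ x.2.2, smul_smul,
        inv_mul_cancel₀ (hpos _ x.2.1).ne', one_smul]
    have h1 : Topology.IsEmbedding (Set.rangeFactorization g) :=
      Topology.IsEmbedding.of_comp (hgc.subtype_mk _) hh (hcomp ▸ Topology.IsEmbedding.subtypeVal)
    exact Topology.IsEmbedding.subtypeVal.comp h1
  have hcube : ∀ z ∈ Z, P.IsNormalCubeParam k Z z (Φ z) := fun z hz => by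
    obtain ⟨-, p, h1, h2, h3⟩ := hε z hz
    refine (c p).isNormalCubeParam h1.1 (hi hz) (fun a => hw a hz)
      (Function.Embedding.refl (Fin k)) (fun q hq a =>
        (c p).axis_eq_zero hq.2 (hi hq.1) (hw a hq.1)) h2 (fun t ht => ?_)
      (fun t ht => hΦ p z hz h1 h3 t ht)
    exact (c p).add_axisVec_mem_target (hc p).target_eq h1.1 h1.2
      (abs_smul_le_of_mem_stdCube ht h2 h3.le)
  have htriv : P.IsCubeTrivialization k Z (fun z => Φ z '' stdCube k) Z Φ :=
    ⟨hsmooth, hemb, fun z hz => ⟨hcube z hz, rfl⟩⟩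
  refine ⟨⟨fun z => Φ z '' stdCube k, fun z hz => ⟨Φ z, hcube z hz, rfl⟩,
    fun z hz z' hz' hne => ?_, fun z _ => ⟨Set.univ, isOpen_univ, Set.mem_univ z, Φ, ?_⟩⟩,
    Φ, htriv, fun z hz => ⟨fun a => ?_, fun t ht ht0 => ?_⟩⟩
  · rw [Set.disjoint_left]
    rintro _ ⟨t, ht, rfl⟩ ⟨t', ht', he⟩
    -- Cubes over different points are disjoint because `r` sends each one to its base point.
    exact hne (by rw [← hret z hz t ht, ← he, hret z' hz' t' ht'])
  · rwa [Set.inter_univ]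
  · obtain ⟨-, p, h1, h2, h3⟩ := hε z hz
    have hmem : ∀ τ ∈ stdCube 1, (Pi.single a (τ 0) : Fin k → ℝ) ∈ stdCube k := fun τ hτ => by
      refine ⟨fun b => ?_, fun b => ?_⟩
      all_goals
        rcases eq_or_ne b a with rfl | hb
        · first | simpa using hτ.1 0 | simpa using hτ.2 0
        · simp [hb]
    have hsum : ∀ τ : Fin 1 → ℝ, ∑ b, EuclideanSpace.single ((c p).axis
        ((⟨fun _ => a, Function.injective_of_subsingleton _⟩ : Fin 1 ↪ Fin k) b)) (ε z * τ b) =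
        (c p).axisVec (ε z • Pi.single a (τ 0)) := fun τ => by
      rw [Fin.sum_univ_one, FramedChart.axisVec, Finset.sum_eq_single a]
      · simp
      · intro b _ hb
        simp [hb]
      · simp
    -- The axis coordinate `a` vanishes on `W a`, which lies in both `i` and `w a`.
    refine (c p).isNormalCubeParam h1.1 (hi hz) (fun a => hw a hz)
      ⟨fun _ => a, Function.injective_of_subsingleton _⟩ (fun q hq b =>
        (c p).axis_eq_zero hq.2 (hWi a hq.1) (hWw a hq.1)) h2 (fun τ hτ => ?_) (fun τ hτ => ?_)
    · rw [hsum]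
      exact (c p).add_axisVec_mem_target (hc p).target_eq h1.1 h1.2
        (abs_smul_le_of_mem_stdCube (hmem τ hτ) h2 h3.le)
    · rw [hsum]
      exact hΦ p z hz h1 h3 _ (hmem τ hτ)
  · obtain ⟨-, p, h1, h2, h3⟩ := hε z hz
    have hle := abs_smul_le_of_mem_stdCube ht h2 h3.le
    rw [hΦ p z hz h1 h3 t ht, (c p).mem_block_iff _ ((hc p).shift_mem h1 hle),
      (hc p).apply_shift h1 hle]
    intro j hj
    have hj0 := ((c p).mem_block_iff _ h1.1).1 (hi hz) j hj
    rw [PiLp.add_apply]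
    -- Nonnegative parameters only increase the axis coordinates and leave the other wall
    -- coordinates unchanged, so the positive orthant is not left.
    by_cases hja : ∃ a, j = (c p).axis a
    · obtain ⟨a, rfl⟩ := hja
      rw [FramedChart.axisVec_axis]
      exact add_nonneg hj0 (mul_nonneg h2.le (ht0 a))
    · push Not at hja
      rwa [(c p).axisVec_of_ne _ hja, add_zero]

theorem IsFacet.isClosed {Z : Set Y} (hZ : P.IsFacet k Z) : IsClosed Z := by
  obtain ⟨p, -, rfl⟩ := hZ
  exact isClosed_closure

theorem IsFacet.isConnected {Z : Set Y} (hZ : P.IsFacet k Z) : IsConnected Z := by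
  obtain ⟨p, hp, rfl⟩ := hZ
  exact (isConnected_connectedComponentIn_iff.2 hp).closure

/-- A facet has a tubular neighbourhood, compatible with the walls of a block that contains it. -/
theorem exists_isTube [T2Space Y] [ParacompactSpace Y] [IsManifold (cornersModel n) ∞ Y]
    {Z : Set Y} (hZ : P.IsFacet k Z) (hi : Z ⊆ P.block i) (hw : ∀ a, Z ⊆ P.block (w a))
    (hchart : ∀ p ∈ Z, ∃ (c : P.FramedChart i w p) (ρ : ℝ), 0 < ρ ∧
      c.toPartialEquiv.target = Metric.ball 0 ρ ∩ sector c.bdry) :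
    ∃ (r : Y → Y) (f : Y → Fin k → ℝ) (ρ : Z → ℝ) (c : ∀ p : Z, P.FramedChart i w p),
      ∀ p, (c p).IsTube r f (ρ p) := by
  obtain ⟨p₀, hp₀⟩ := hZ.isConnected.nonempty
  have : Nonempty (Y × (Fin k → ℝ)) := ⟨(p₀, 0)⟩
  obtain ⟨F, hF⟩ := exists_forall_good_of_local (n := n) hZ.isClosed hZ.isConnected
    (Good := fun (F : Y → Y × (Fin k → ℝ)) p =>
      P.IsTubularAt i w (fun x => (F x).1) (fun x => (F x).2) p)
    (fun F F' p h hF => hF.congr (h.fun_comp Prod.fst) (h.fun_comp Prod.snd))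
    (fun p hp => by
      obtain ⟨c, ρ₀, -, ht⟩ := hchart p hp
      refine ⟨c.toPartialEquiv.source, c.open_source.mem_nhds c.mem_source,
        fun ρ hρ hρ01 hsupp F => ?_⟩
      obtain ⟨F', h1, h2⟩ := c.exists_glue ht hρ hρ01 hsupp F
      exact ⟨F', h1, fun q hq => h2 q (hi hq) fun a => hw a hq⟩)
  have hex : ∀ p : Z, ∃ (c : P.FramedChart i w p) (ρ : ℝ),
      c.IsTube (fun x => (F x).1) (fun x => (F x).2) ρ := fun p => by
    obtain ⟨c, ρ, h1, h2, h3, h4, h5, h6⟩ := (hF p p.2).exists_chart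
    exact ⟨c, ρ, h1, h2, h3, h4, h5, h6⟩
  choose c ρ h using hex
  exact ⟨_, _, ρ, c, h⟩

theorem exists_walls_and_trivialization [T2Space Y] [ParacompactSpace Y]
    [IsManifold (cornersModel n) ∞ Y] (hP : P.IsRegular) {Z : Set Y} (hZ : P.IsFacet k Z)
    (hi : Z ⊆ P.block i) :
    ∃ W : Fin k → Set Y, Function.Injective W ∧
      (∀ W' : Set Y, (∃ a, W a = W') ↔ (P.IsFacet 1 W' ∧ Z ⊆ W' ∧ W' ⊆ P.block i)) ∧
      ∃ (E : P.NormalCubeBundle k Z) (Φ : Y → (Fin k → ℝ) → Y), E.IsTrivialization Φ ∧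
        ∀ p ∈ Z,
          (∀ a, P.IsNormalCubeParam 1 (W a) p (fun τ => Φ p (Pi.single a (τ 0)))) ∧
          ∀ t ∈ stdCube k, (∀ a, 0 ≤ t a) → Φ p t ∈ P.block i := by
  obtain ⟨w, W, hinj, hW, hWw, hchart⟩ := exists_walls hP hZ hi
  have hWa : ∀ a, P.IsFacet 1 (W a) ∧ Z ⊆ W a ∧ W a ⊆ P.block i := fun a => (hW _).1 ⟨a, rfl⟩
  have hw : ∀ a, Z ⊆ P.block (w a) := fun a => (hWa a).2.1.trans (hWw a)
  obtain ⟨r, f, ρ, c, hc⟩ := exists_isTube hZ hi hw hchart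
  obtain ⟨ε, hε⟩ := exists_contMDiffAt_lt (n := n) hZ.isClosed hZ.isConnected
    (U := fun p => (c p).core (ρ p)) (η := fun p => ρ p / (2 * (k + 1)))
    (fun p => (c p).core_mem_nhds ((c p).base_mem_core (hc p).pos))
    (fun p => div_pos (hc p).pos (by positivity))
  exact ⟨W, hinj, hW, exists_trivialization_of_isTube hi hw c hc hε (fun a => (hWa a).2.2) hWw⟩

end CornerPartition

theorem lemma1p1p4p2 {n : ℕ} {Y : Type*} [TopologicalSpace Y] [T2Space Y] [ParacompactSpace Y]
    [ChartedSpace (EuclideanQuadrant n) Y] [IsManifold (cornersModel n) ∞ Y] {ι : Type*}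
    (P : CornerPartition n Y ι) (hP : P.IsRegular) (k : ℕ) (Z : Set Y) (hZ : P.IsFacet k Z) :
    -- `Z` has a trivial normal-cube bundle
    (∃ E : P.NormalCubeBundle k Z, E.IsTrivial) ∧
    -- `Z` lies in some block, and for each such block the `k` walls of the block that contain `Z`
    -- give a global frame of normal intervals, pointing into the block, along the axes of the cubes
    (∃ i, Z ⊆ P.block i) ∧
    ∀ i, Z ⊆ P.block i →
      ∃ W : Fin k → Set Y, Function.Injective W ∧
        (∀ W' : Set Y, (∃ a, W a = W') ↔ (P.IsFacet 1 W' ∧ Z ⊆ W' ∧ W' ⊆ P.block i)) ∧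
        ∃ (E : P.NormalCubeBundle k Z) (Φ : Y → (Fin k → ℝ) → Y), E.IsTrivialization Φ ∧
          ∀ p ∈ Z,
            (∀ a, P.IsNormalCubeParam 1 (W a) p (fun τ => Φ p (Pi.single a (τ 0)))) ∧
            ∀ t ∈ stdCube k, (∀ a, 0 ≤ t a) → Φ p t ∈ P.block i := by
  obtain ⟨i, hi⟩ := CornerPartition.exists_block_of_isFacet hP hZ
  obtain ⟨W, -, -, E, Φ, hΦ, -⟩ := CornerPartition.exists_walls_and_trivialization hP hZ hi
  exact ⟨⟨E, Φ, hΦ⟩, ⟨i, hi⟩, fun i hi =>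
    CornerPartition.exists_walls_and_trivialization hP hZ hi⟩
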